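/- An integral chain in a group $G$ is a finite formal sum $c=g_1+\dots+g_k$ of elements of $G$ (with $-g$ identified with $g^{-1}$). Its stable commutator length is $\mathrm{scl}_G(c)=\inf_S \frac{-\chi^-(S)}{2n(S)}\in[0,\infty]$, where $S$ runs over the compact oriented surfaces mapped to a space with fundamental group $G$ whose boundary wraps around each of the loops representing $g_1,\dots,g_k$ with the same total degree $n(S)>0$, and $\chi^-(S)$ is the Euler characteristic of $S$ after removing disk and sphere components (and $\mathrm{scl}_G(c)=\infty$ if no such surface exists, that is, if $c$ is nontrivial in $H_1(G;\mathbb Q)$). A number $C$ is a spectral gap of $G$ for integral chains if $\mathrm{scl}_G(c)\notin(0,C)$ for all integral chains $c$ in $G$; the optimal spectral gap is the largest such $C\in[0,\infty]$ (it is $\infty$ if no integral chain has positive finite scl). For $m\ge 1$ let $\Delta_m$ be the graph with vertices $v_0,\dots,v_m$ in which $v_i$ and $v_j$ are adjacent if and only if $|i-j|\ge 2$. For a simplicial graph $\Gamma$, the opposite path length $\Delta(\Gamma)\in\{0,1,2,\dots,\infty\}$ is the largest $m\ge1$ such that $\Delta_m$ is an induced subgraph of $\Gamma$; it is $0$ if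 there is no such $m$, and $\infty$ if there is no largest one. The right-angled Artin group $\mathrm{A}(\Gamma)$ is generated by the vertices of $\Gamma$ subject to the relations $[v,w]=1$ for adjacent $v,w$; the right-angled Coxeter group $\mathrm{C}(\Gamma)$ is its quotient by the additional relations $v^2=1$ for all vertices $v$. We use the conventions $1/0=\infty$ and $1/\infty=0$. **Theorem.** 1. For every simplicial graph $\Gamma$, the optimal spectral gap of $\mathrm{A}(\Gamma)$ for integral chains is at least $\frac{1}{24+12\Delta(\Gamma)}$ and at most $\frac{1}{\Delta(\Gamma)}$. 2. For every simplicial graph $\Gamma$, the optimal spectral gap of $\mathrm{C}(\Gamma)$ for integral chains is at least $\frac{1}{24+12\Delta(\Gamma)}$; and it is at most $\frac{1}{\Delta(\Gamma)}$, provided, in the case $\Delta(\Gamma)=1$, that $\Gamma$ has three pairwise non-adjacent distinct vertices. 3. For every $m\ge1$ the finite graph $\Delta_m$ has $\Delta(\Delta_m)=m$, and the gaps are not uniform: there is no $C>0$ that is a spectral gap for integral chains of $\mathrm{A}(\Gamma)$ for all finite simplicial graphs $\Gamma$, and none for $\mathrm{C}(\Gamma)$ for all finite simplicial graphs $\Gamma$.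 -/

import Mathlib

open scoped ENNReal commutatorElement

/-! ### Stable commutator length of integral chains

An integral chain `g₁ + ⋯ + gₖ` in a group `G` (a finite formal sum of elements) is given by the
family `c : Fin k → G` of its terms.  Integer coefficients are obtained by repeating terms, and
`-g` is `g⁻¹`. -/

/-- A boundary circle of a surface mapped to a space with fundamental group `G`: it wraps
`winding` times (possibly a negative number or zero) around the loop representing the term
`c index`; `conj` is the path joining it to the base point. -/
structure BoundaryCircle (G : Type*) (k : ℕ) where
  index : Fin k
  winding : ℤ
  conj : G

/-- The element of `G` represented by a boundary circle. -/
def BoundaryCircle.value {G : Type*} [Group G] {k : ℕ} (c : Fin k → G)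
    (b : BoundaryCircle G k) : G :=
  b.conj * c b.index ^ b.winding * b.conj⁻¹

/-- A connected compact oriented surface together with a map (up to homotopy) to a space with
fundamental group `G`, whose boundary circles all wrap around loops representing terms of `c`.
The surface of genus `p` with `q` boundary circles has fundamental group
`⟨a₁, b₁, …, aₚ, bₚ, z₁, …, z_q ∣ [a₁, b₁] ⋯ [aₚ, bₚ] z₁ ⋯ z_q = 1⟩`, where the `zᵢ` are the
boundary circles, so that the map is given by the images of these generators. -/
structure SurfaceComponent {G : Type*} [Group G] {k : ℕ} (c : Fin k → G) where
  handles : List (G × G)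
  boundary : List (BoundaryCircle G k)
  relation : (handles.map fun h => ⁅h.1, h.2⁆).prod *
    (boundary.map fun b => b.value c).prod = 1

namespace SurfaceComponent

variable {G : Type*} [Group G] {k : ℕ} {c : Fin k → G}

/-- `-χ⁻` of a connected surface of genus `p` with `q` boundary circles.  It is `2p + q - 2`, but
`0` for the sphere and the disk, which is what the truncated subtraction gives. -/
def negChi (S : SurfaceComponent c) : ℕ :=
  2 * S.handles.length + S.boundary.length - 2

/-- The total degree with which the boundary of the surface wraps around the `j`-th loop. -/
def windingAt (S : SurfaceComponent c) (j : Fin k) : ℤ :=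
  (S.boundary.map fun b => if b.index = j then b.winding else 0).sum

end SurfaceComponent

/-- An admissible surface for the chain `c`: a compact oriented surface, not necessarily connected,
whose boundary wraps around each of the loops representing the terms of `c` with the same total
degree `n > 0`. -/
structure AdmissibleSurface {G : Type*} [Group G] {k : ℕ} (c : Fin k → G) where
  components : List (SurfaceComponent c)
  degree : ℕ
  degree_pos : 0 < degree
  winding_eq : ∀ j : Fin k, (components.map fun S => S.windingAt j).sum = degree

/-- `-χ⁻` of an admissible surface: minus the Euler characteristic after removing all disk and
sphere components. -/
def AdmissibleSurface.negChi {G : Type*} [Group G] {k : ℕ} {c : Fin k → G}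
    (S : AdmissibleSurface c) : ℕ :=
  (S.components.map fun K => K.negChi).sum

/-- Stable commutator length of the integral chain `c`: the infimum of `-χ⁻(S) / (2 n(S))` over all
admissible surfaces `S`.  If the class of `c` in `H₁(G; ℚ)` is nonzero, there is no admissible
surface, and the infimum is `∞`. -/
noncomputable def scl {G : Type*} [Group G] {k : ℕ} (c : Fin k → G) : ℝ≥0∞ :=
  ⨅ S : AdmissibleSurface c, (S.negChi : ℝ≥0∞) / (2 * (S.degree : ℝ≥0∞))

/-- `C` is a spectral gap of `G` for integral chains: no integral chain has stable commutator
length in the open interval `(0, C)`. -/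
def HasChainGap (G : Type*) [Group G] (C : ℝ≥0∞) : Prop :=
  ∀ (k : ℕ) (c : Fin k → G), scl c ∉ Set.Ioo 0 C

/-- The optimal spectral gap of `G` for integral chains: the largest `C` that is a gap (`0` if there
is no gap, `∞` if no integral chain has a positive finite stable commutator length). -/
noncomputable def optimalChainGap (G : Type*) [Group G] : ℝ≥0∞ :=
  sSup {C : ℝ≥0∞ | HasChainGap G C}

/-! ### Right-angled Artin and Coxeter groups -/

/-- The commutators `[v, w]` of adjacent vertices. -/
def commutationRels {V : Type*} (Γ : SimpleGraph V) : Set (FreeGroup V) :=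
  {r | ∃ v w : V, Γ.Adj v w ∧ r = ⁅FreeGroup.of v, FreeGroup.of w⁆}

/-- The squares of the generators. -/
def squareRels (V : Type*) : Set (FreeGroup V) :=
  {r | ∃ v : V, r = FreeGroup.of v ^ 2}

/-- The right-angled Artin group of a simplicial graph. -/
abbrev RightAngledArtinGroup {V : Type*} (Γ : SimpleGraph V) : Type _ :=
  PresentedGroup (commutationRels Γ)

/-- The right-angled Coxeter group of a simplicial graph. -/
abbrev RightAngledCoxeterGroup {V : Type*} (Γ : SimpleGraph V) : Type _ :=
  PresentedGroup (commutationRels Γ ∪ squareRels V)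

/-! ### The opposite path length -/

/-- The opposite path `Δ_m` on the vertices `v₀, …, v_m`: `vᵢ` and `vⱼ` are adjacent if and only if
`|i - j| ≥ 2`. -/
def oppositePath (m : ℕ) : SimpleGraph (Fin (m + 1)) where
  Adj i j := (i : ℕ) + 2 ≤ j ∨ (j : ℕ) + 2 ≤ i
  symm := ⟨fun _ _ h => h.symm⟩
  loopless := ⟨fun _ h => by omega⟩

/-- The opposite path length: the largest `m ≥ 1` such that `Δ_m` is an induced subgraph of `Γ`; it
is `0` if there is none (that is, if `Γ` is complete), and `∞` if there is no largest one. -/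
noncomputable def oppositePathLength {V : Type*} (Γ : SimpleGraph V) : ℕ∞ :=
  ⨆ (m : ℕ) (_ : 1 ≤ m) (_ : Nonempty (oppositePath m ↪g Γ)), (m : ℕ∞)

/-!
Both families of groups are graph products of cyclic groups (`GraphGroup Γ Q`: the vertices in `Q`
have order two), and both bounds are obtained for all of them by the same means.

**Lower bound.**  A homogeneous quasimorphism `ψ` of defect `D` gives `ψ c / (2 D) ≤ scl c`, the
easy direction of Bavard duality (`IsHomogeneousQuasimorphism.le_scl`).  The quasimorphisms come
from trees: a vertex `v` splits the group, with `par {v}ᶜ` as a vertex group, and the vertices of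
the orbit of the base point in the Bass–Serre tree are encoded as reduced words (`word`).  Counting
disjoint translates of a path `w` along these words, with sign, is a quasimorphism of defect `3`.
Homogenization only doubles the defect (`exists_homogenization`), which gives defect `6`.

Let `w` consist of `Δ + 2` periods of the axis of an element `g`, where `Δ` is the opposite path
length.  If no translate of the inverse of `w` occurs along the axis of `g`, the quasimorphism is at
least `1 / (Δ + 2)` on `g` (`exists_count_quasimorphism`).  If such a translate occurs along the
axis of another term `e` of the chain that is no longer than `g`, then a conjugate `k` of `e⁻¹`
translates most of the segment along itself, and so does `g`; hence the commutator of `g` and `k`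
fixes `Δ + 1` consecutive translates of the base point.  The supports of elements that fix more and
more translates shrink like the layers of a breadth first search in the complement graph.  A
shortest path in that graph is an induced opposite path, so the layers are stationary after `Δ`
steps, and the elements fixing the segment form a standard parabolic subgroup which is normalized
by `g` and `k` (`exists_par_eq_fixer`).  Up to elliptic factors, `g` and `k` therefore commute, and
`[g] + [e] = [g] - [k]` can be replaced by the class of an element that translates by the
difference of the two lengths (`exists_chainClass_sub_eq`).  These replacements do not change the
class of the chain in `ChainClass`, which retains the values of all homogeneous quasimorphisms and
vanishes only on chains of stable commutator length zero.  A chain of minimal total length in its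
class is thus either detected by a counting quasimorphism or elliptic
(`exists_quasimorphism_or_exists_chain_par`), and induction on the support leaves only the
alternatives `scl c = 0` and `scl c ≥ 1 / (2 * 6 * (Δ + 2))`.

**Upper bound.**  Let `a 1, a 2, …` be elements that commute unless their indices are adjacent, let
`t` commute with all of them but `a 1`, and put `x = a m ⋯ a 1` and `h = a (m + 1)`.  Conjugating
`h` by `x` up to `m` times produces only words in `a 1, …` that avoid `a 1` until the last step, so
`(h x t) ^ n (x t) ^ (-n) = (h x) ^ n x ^ (-n)` for `n = m + 1` (`descProd_mul_pow_eq`).  This is a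
sphere with four holes that bounds `[h x t] - [x t] + [x] - [h x]` with multiplicity `n`
(`scl_descProd_artin`).  If the `a i` are involutions, then `h x` and `x` are inverted by the same
element, and two copies of a pair of pants already bound `2 n ([h x t] - [x t])`
(`scl_descProd_coxeter`).  Positivity holds since the complement of an opposite path is connected:
the parabolic subgroup above is then trivial, so an element of full support that is not conjugate
to its inverse is separated from the other terms of the chain by a counting quasimorphism
(`exists_separating_quasimorphism`).  The group of an induced subgraph is a retract
(`optimalChainGap_le_of_embedding`), which transfers the chains to every graph that contains a long
opposite path.  Applied to the opposite paths themselves, they rule out a uniform gap.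
-/

/-! ### Homogeneous quasimorphisms -/

/-- A homogeneous quasimorphism `ψ : G → ℝ` whose defect is at most `D`. -/
structure IsHomogeneousQuasimorphism {G : Type*} [Group G] (ψ : G → ℝ) (D : ℝ) : Prop where
  bound : ∀ g h, |ψ (g * h) - ψ g - ψ h| ≤ D
  map_pow : ∀ g (n : ℕ), ψ (g ^ n) = n * ψ g

theorem eq_zero_of_forall_nat_mul_abs_le {a C : ℝ} (h : ∀ n : ℕ, n * |a| ≤ C) : a = 0 := by
  by_contra ha
  obtain ⟨n, hn⟩ := exists_nat_gt (C / |a|)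
  have := h n
  rw [div_lt_iff₀ (abs_pos.2 ha)] at hn
  linarith

namespace IsHomogeneousQuasimorphism

variable {G : Type*} [Group G] {ψ : G → ℝ} {D : ℝ}

theorem map_one (h : IsHomogeneousQuasimorphism ψ D) : ψ 1 = 0 := by
  simpa using h.map_pow 1 0

theorem nonneg (h : IsHomogeneousQuasimorphism ψ D) : 0 ≤ D :=
  (abs_nonneg _).trans (h.bound 1 1)

theorem map_inv (h : IsHomogeneousQuasimorphism ψ D) (g : G) : ψ g⁻¹ = -ψ g := by
  have : ψ g + ψ g⁻¹ = 0 := by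
    refine eq_zero_of_forall_nat_mul_abs_le (C := D) fun n => ?_
    have := h.bound (g ^ n) (g⁻¹ ^ n)
    rw [h.map_pow, h.map_pow, inv_pow, mul_inv_cancel, h.map_one] at this
    rw [← abs_neg] at this
    rw [← Nat.abs_cast n, ← abs_mul]
    rw [abs_le] at *
    constructor <;> linarith
  linarith

theorem map_zpow (h : IsHomogeneousQuasimorphism ψ D) (g : G) (n : ℤ) : ψ (g ^ n) = n * ψ g := by
  obtain ⟨n, rfl | rfl⟩ := n.eq_nat_or_neg
  · simpa using h.map_pow g n
  · simp [h.map_inv, h.map_pow]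

theorem map_conj (h : IsHomogeneousQuasimorphism ψ D) (g k : G) : ψ (k * g * k⁻¹) = ψ g := by
  have : ψ (k * g * k⁻¹) - ψ g = 0 := by
    refine eq_zero_of_forall_nat_mul_abs_le (C := 2 * D) fun n => ?_
    have h1 := h.bound (k * g ^ n) k⁻¹
    have h2 := h.bound k (g ^ n)
    rw [← conj_pow, h.map_pow, h.map_inv] at h1
    rw [h.map_pow] at h2
    rw [← Nat.abs_cast n, ← abs_mul]
    rw [abs_le] at *
    constructor <;> linarith
  linarith

theorem abs_map_commutator_le (h : IsHomogeneousQuasimorphism ψ D) (a b : G) :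
    |ψ ⁅a, b⁆| ≤ D := by
  have := h.bound (a * b * a⁻¹) b⁻¹
  rw [h.map_conj, h.map_inv] at this
  simpa [commutatorElement_def] using this

theorem abs_map_prod_sub_le (h : IsHomogeneousQuasimorphism ψ D) (a : G) (l : List G) :
    |ψ (a :: l).prod - ((a :: l).map ψ).sum| ≤ l.length * D := by
  induction l generalizing a with
  | nil => simp
  | cons b l ih =>
    have h1 := ih b
    have h2 := h.bound a (b :: l).prod
    rw [List.prod_cons (a := a), List.map_cons (a := a), List.sum_cons, List.length_cons]
    rw [abs_le] at *
    push_cast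
    constructor <;> linarith

theorem abs_map_prod_sub_le' (h : IsHomogeneousQuasimorphism ψ D) (l : List G) :
    |ψ l.prod - (l.map ψ).sum| ≤ l.length * D := by
  cases l with
  | nil => simp [h.map_one]
  | cons a l =>
    refine (h.abs_map_prod_sub_le a l).trans ?_
    have := h.nonneg
    simp only [List.length_cons]
    push_cast
    linarith

theorem abs_sum_map_commutator_le (h : IsHomogeneousQuasimorphism ψ D) (l : List (G × G)) :
    |((l.map fun h => ⁅h.1, h.2⁆).map ψ).sum| ≤ l.length * D := by
  induction l with
  | nil => simp
  | cons a l ih =>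
    have := h.abs_map_commutator_le a.1 a.2
    simp only [List.map_cons, List.sum_cons, List.length_cons]
    rw [abs_le] at *
    push_cast
    constructor <;> linarith

variable {k : ℕ} {c : Fin k → G}

/-- A surface of genus `p` with `q` boundary circles writes the inverse of one of the circles as a
product of `p` commutators and `q - 1` other circles. -/
theorem abs_sum_boundary_le (h : IsHomogeneousQuasimorphism ψ D) (S : SurfaceComponent c) :
    |((S.boundary.map fun b => b.value c).map ψ).sum| ≤ S.negChi * D := by
  have hD := h.nonneg
  have hrel := S.relation
  unfold SurfaceComponent.negChi
  have hh := h.abs_sum_map_commutator_le S.handles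
  rcases hb : S.boundary with _ | ⟨b, bs⟩
  · simp only [List.map_nil, List.sum_nil, abs_zero]
    positivity
  · rw [hb] at hrel
    set L := S.handles.map fun h => ⁅h.1, h.2⁆ with hL
    set B := bs.map fun b => b.value c with hB
    simp only [List.map_cons, List.sum_cons]
    have hv : (b.value c)⁻¹ = (B ++ L).prod := by
      simp only [List.map_cons, List.prod_cons] at hrel
      rw [List.prod_append, inv_eq_iff_mul_eq_one, ← hB] at *
      have := congrArg (fun x => L.prod⁻¹ * x * L.prod) hrel
      simpa [mul_assoc] using this
    have hv' : ψ (b.value c) = -ψ (B ++ L).prod := by rw [← hv, h.map_inv, neg_neg]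
    have hlen : (B ++ L).length = bs.length + S.handles.length := by simp [hB, hL]
    have hcons : (b :: bs).length = bs.length + 1 := rfl
    rcases hBL : B ++ L with _ | ⟨x, xs⟩
    · rw [hBL] at hv' hlen
      have : bs = [] := by
        apply List.eq_nil_of_length_eq_zero
        simp at hlen; omega
      subst this
      simp only [List.prod_nil, h.map_one] at hv'
      simp [hv']
      positivity
    · have h1 := h.abs_map_prod_sub_le x xs
      rw [← hBL] at h1
      rw [List.map_append, List.sum_append] at h1
      rw [hBL] at hlen
      have h2 : ((2 * S.handles.length + (b :: bs).length - 2 : ℕ) : ℝ)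
          = S.handles.length + xs.length := by
        rw [hcons]
        simp only [List.length_cons] at hlen
        have : 2 * S.handles.length + (bs.length + 1) - 2 = S.handles.length + xs.length := by
          omega
        rw [this]; push_cast; ring
      rw [h2, hv']
      rw [abs_le] at *
      constructor <;> linarith

theorem sum_boundary_eq (h : IsHomogeneousQuasimorphism ψ D) (S : SurfaceComponent c) :
    ((S.boundary.map fun b => b.value c).map ψ).sum = ∑ j, S.windingAt j * ψ (c j) := by
  unfold SurfaceComponent.windingAt
  induction S.boundary with
  | nil => simp
  | cons b l ih =>
    simp only [List.map_cons, List.sum_cons, ih, Int.cast_add, add_mul, Finset.sum_add_distrib]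
    congr 1
    simp [BoundaryCircle.value, h.map_conj, h.map_zpow]

/-- The easy direction of Bavard duality for chains. -/
theorem le_scl (h : IsHomogeneousQuasimorphism ψ D) (hD : 0 < D) {x : ℝ}
    (hx : x ≤ ∑ j, ψ (c j)) : ENNReal.ofReal (x / (2 * D)) ≤ scl c := by
  refine le_iInf fun S => ?_
  have hdeg : (0 : ℝ) < S.degree := by exact_mod_cast S.degree_pos
  have key : S.degree * ∑ j, ψ (c j) ≤ S.negChi * D := by
    have h1 : ∀ L : List (SurfaceComponent c),
        ∑ j, ((L.map fun K => K.windingAt j).sum : ℤ) * ψ (c j)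
          ≤ ((L.map fun K => K.negChi).sum : ℕ) * D := by
      intro L
      induction L with
      | nil => simp
      | cons K L ih =>
        have h2 := h.abs_sum_boundary_le K
        rw [h.sum_boundary_eq, abs_le] at h2
        simp only [List.map_cons, List.sum_cons]
        push_cast at ih ⊢
        simp only [add_mul, Finset.sum_add_distrib]
        linarith [h2.2]
    have h2 := h1 S.components
    simp only [S.winding_eq] at h2
    rw [Finset.mul_sum]
    simpa [AdmissibleSurface.negChi] using h2
  have h2 : x / (2 * D) ≤ S.negChi / (2 * S.degree) := by
    rw [div_le_div_iff₀ (by positivity) (by positivity)]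
    nlinarith
  calc ENNReal.ofReal (x / (2 * D)) ≤ ENNReal.ofReal (S.negChi / (2 * S.degree)) :=
        ENNReal.ofReal_le_ofReal h2
    _ = _ := by
        rw [ENNReal.ofReal_div_of_pos (by positivity), ENNReal.ofReal_mul (by norm_num)]
        simp

end IsHomogeneousQuasimorphism

/-! ### Stable commutator length and homomorphisms -/

section Map

variable {G K : Type*} [Group G] [Group K] {k : ℕ} {c : Fin k → G}

/-- Composition of a surface component with a homomorphism. -/
def SurfaceComponent.map (f : G →* K) (S : SurfaceComponent c) : SurfaceComponent (f ∘ c) where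
  handles := S.handles.map fun h => (f h.1, f h.2)
  boundary := S.boundary.map fun b => ⟨b.index, b.winding, f b.conj⟩
  relation := by
    have h := congrArg f S.relation
    rw [map_mul, map_one, map_list_prod, map_list_prod] at h
    simpa [List.map_map, Function.comp_def, map_commutatorElement, BoundaryCircle.value] using h

theorem SurfaceComponent.negChi_map (f : G →* K) (S : SurfaceComponent c) :
    (S.map f).negChi = S.negChi := by
  simp [SurfaceComponent.negChi, SurfaceComponent.map]

theorem SurfaceComponent.windingAt_map (f : G →* K) (S : SurfaceComponent c) (j : Fin k) :
    (S.map f).windingAt j = S.windingAt j := by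
  simp [SurfaceComponent.windingAt, SurfaceComponent.map, Function.comp_def]

theorem scl_map_le (f : G →* K) (c : Fin k → G) : scl (f ∘ c) ≤ scl c := by
  refine le_iInf fun S => ?_
  refine (iInf_le _ (⟨S.components.map fun K => K.map f, S.degree, S.degree_pos, ?_⟩ :
    AdmissibleSurface (f ∘ c))).trans (le_of_eq ?_)
  · intro j
    rw [← S.winding_eq j, List.map_map]
    simp [Function.comp_def, SurfaceComponent.windingAt_map]
  · simp [AdmissibleSurface.negChi, Function.comp_def, SurfaceComponent.negChi_map]

theorem scl_map_eq_of_leftInverse (f : G →* K) (r : K →* G) (h : ∀ g, r (f g) = g)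
    (c : Fin k → G) : scl (f ∘ c) = scl c := by
  refine le_antisymm (scl_map_le f c) ?_
  calc scl c = scl (r ∘ f ∘ c) := by congr 1; funext j; simp [h]
    _ ≤ _ := scl_map_le r _

/-- The bound given by a connected admissible surface. -/
theorem scl_le_of_component (S : SurfaceComponent c) (n : ℕ) (hn : 0 < n)
    (hw : ∀ j, S.windingAt j = n) : scl c ≤ (S.negChi : ℝ≥0∞) / (2 * (n : ℝ≥0∞)) := by
  refine (iInf_le _ (⟨[S], n, hn, by simpa using hw⟩ : AdmissibleSurface c)).trans ?_
  simp [AdmissibleSurface.negChi]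

end Map

/-! ### Products of boundedly many commutators -/

/-- `x` is a product of at most `B` commutators. -/
def IsCommutatorProduct {G : Type*} [Group G] (B : ℕ) (x : G) : Prop :=
  ∃ l : List (G × G), l.length ≤ B ∧ (l.map fun h => ⁅h.1, h.2⁆).prod = x

namespace IsCommutatorProduct

variable {G : Type*} [Group G] {B B' : ℕ} {x y : G}

theorem one : IsCommutatorProduct B (1 : G) := ⟨[], by simp, by simp⟩

theorem commutator (x y : G) : IsCommutatorProduct 1 ⁅x, y⁆ := ⟨[(x, y)], by simp, by simp⟩

theorem mul (hx : IsCommutatorProduct B x) (hy : IsCommutatorProduct B' y) :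
    IsCommutatorProduct (B + B') (x * y) := by
  obtain ⟨l, hl, rfl⟩ := hx
  obtain ⟨l', hl', rfl⟩ := hy
  exact ⟨l ++ l', by simp; omega, by simp⟩

theorem map {K : Type*} [Group K] (f : G →* K) (hx : IsCommutatorProduct B x) :
    IsCommutatorProduct B (f x) := by
  obtain ⟨l, hl, rfl⟩ := hx
  refine ⟨l.map fun h => (f h.1, f h.2), by simpa using hl, ?_⟩
  simp [map_list_prod, Function.comp_def, map_commutatorElement]

theorem conj (hx : IsCommutatorProduct B x) (g : G) : IsCommutatorProduct B (g * x * g⁻¹) :=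
  hx.map (MulAut.conj g).toMonoidHom

theorem inv (hx : IsCommutatorProduct B x) : IsCommutatorProduct B x⁻¹ := by
  obtain ⟨l, hl, rfl⟩ := hx
  refine ⟨(l.map fun h => (h.2, h.1)).reverse, by simpa using hl, ?_⟩
  simp [List.prod_inv_reverse, Function.comp_def]

theorem pow (hx : IsCommutatorProduct B x) (n : ℕ) : IsCommutatorProduct (n * B) (x ^ n) := by
  induction n with
  | zero => simpa using one
  | succ n ih => rw [pow_succ, Nat.succ_mul]; exact ih.mul hx

theorem exists_mul_pow_eq (x y : G) (n : ℕ) :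
    ∃ c, IsCommutatorProduct n c ∧ (x * y) ^ n = x ^ n * y ^ n * c := by
  induction n with
  | zero => exact ⟨1, one, by simp⟩
  | succ n ih =>
    obtain ⟨c, hc, h⟩ := ih
    refine ⟨((y ^ (n + 1))⁻¹ * ⁅(x ^ n)⁻¹, y⁆ * (y ^ (n + 1))⁻¹⁻¹) * c, ?_, ?_⟩
    · rw [add_comm]
      exact ((commutator _ _).conj _).mul hc
    · rw [pow_succ' (x * y), h, commutatorElement_def, pow_succ' y, pow_succ' x]
      group

theorem exists_prod_map_pow_eq (l : List G) (n : ℕ) :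
    ∃ c, IsCommutatorProduct (l.length * n) c ∧ (l.map (· ^ n)).prod = c * l.prod ^ n := by
  induction l with
  | nil => exact ⟨1, one, by simp⟩
  | cons a l ih =>
    obtain ⟨c, hc, h⟩ := ih
    obtain ⟨d, hd, h'⟩ := exists_mul_pow_eq a l.prod n
    refine ⟨(a ^ n * c * (a ^ n)⁻¹) * ((a ^ n * l.prod ^ n) * d⁻¹ * (a ^ n * l.prod ^ n)⁻¹), ?_, ?_⟩
    · rw [List.length_cons, Nat.succ_mul]
      exact (hc.conj _).mul (hd.inv.conj _)
    · simp only [List.map_cons, List.prod_cons, h, h']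
      group

end IsCommutatorProduct

/-! ### Chains up to stable commutator length zero -/

/-- The sequences in `G` which, after taking a fixed power, are products of boundedly many
commutators.  The power makes the quotient torsion free. -/
def boundedSequences (G : Type*) [Group G] : Subgroup (ℕ → G) where
  carrier := {x | ∃ K > 0, ∃ B, ∀ n, IsCommutatorProduct B (x n ^ K)}
  one_mem' := ⟨1, one_pos, 0, fun n => by simpa using .one⟩
  inv_mem' := by
    rintro x ⟨K, hK, B, h⟩
    exact ⟨K, hK, B, fun n => by simpa using (h n).inv⟩
  mul_mem' := by
    rintro x y ⟨K, hK, B, h⟩ ⟨K', hK', B', h'⟩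
    refine ⟨K * K', Nat.mul_pos hK hK', K' * B + K * B' + K * K', fun n => ?_⟩
    obtain ⟨c, hc, e⟩ := IsCommutatorProduct.exists_mul_pow_eq (x n) (y n) (K * K')
    rw [Pi.mul_apply, e]
    refine IsCommutatorProduct.mul (IsCommutatorProduct.mul ?_ ?_) hc
    · rw [pow_mul]; exact (h n).pow K'
    · rw [mul_comm K K', pow_mul]; exact (h' n).pow K

instance boundedSequences_normal (G : Type*) [Group G] : (boundedSequences G).Normal where
  conj_mem := by
    rintro x ⟨K, hK, B, h⟩ g
    exact ⟨K, hK, B, fun n => by simpa [conj_pow] using (h n).conj (g n)⟩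

/-- The group in which integral chains are compared: a chain is zero in it if and only if its
multiples bound surfaces of bounded Euler characteristic. -/
abbrev ChainClass (G : Type*) [Group G] := Additive ((ℕ → G) ⧸ boundedSequences G)

instance chainClassAddCommGroup (G : Type*) [Group G] : AddCommGroup (ChainClass G) :=
  { (inferInstance : AddGroup (ChainClass G)) with
    add_comm := by
      intro a b
      induction a using Additive.rec with | _ a
      induction b using Additive.rec with | _ b
      induction a using QuotientGroup.induction_on with | _ a
      induction b using QuotientGroup.induction_on with | _ b
      change Additive.ofMul _ = Additive.ofMul _
      congr 1
      change (((a * b : ℕ → G) : (ℕ → G) ⧸ boundedSequences G)) = ((b * a : ℕ → G) : _)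
      rw [QuotientGroup.eq]
      refine ⟨1, one_pos, 1, fun n => ?_⟩
      have := IsCommutatorProduct.commutator (b n)⁻¹ (a n)⁻¹
      simpa [commutatorElement_def, mul_assoc] using this }

/-- The class of the chain that consists of the element `g`, represented by the sequence
`n ↦ g ^ n`. -/
def chainClass {G : Type*} [Group G] (g : G) : ChainClass G :=
  Additive.ofMul ((fun n => g ^ n : ℕ → G) : (ℕ → G) ⧸ boundedSequences G)

section ChainClass

variable {G : Type*} [Group G]

theorem ofMul_mk_eq_zero_iff (x : ℕ → G) :
    (Additive.ofMul (x : (ℕ → G) ⧸ boundedSequences G) : ChainClass G) = 0 ↔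
      ∃ K > 0, ∃ B, ∀ n, IsCommutatorProduct B (x n ^ K) := by
  change Additive.ofMul _ = Additive.ofMul 1 ↔ _
  rw [Additive.ofMul.apply_eq_iff_eq, QuotientGroup.eq_one_iff]
  rfl

theorem chainClass_eq_zero_of_nsmul {a : ChainClass G} {k : ℕ} (hk : 0 < k) (h : k • a = 0) :
    a = 0 := by
  induction a using Additive.rec with | _ a
  induction a using QuotientGroup.induction_on with | _ a
  have h' : (Additive.ofMul ((a ^ k : ℕ → G) : (ℕ → G) ⧸ boundedSequences G) : ChainClass G) = 0 :=
    h
  rw [ofMul_mk_eq_zero_iff] at h'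
  obtain ⟨K, hK, B, h'⟩ := h'
  refine (ofMul_mk_eq_zero_iff _).2 ⟨k * K, Nat.mul_pos hk hK, B, fun n => ?_⟩
  rw [pow_mul]
  exact h' n

theorem chainClass_mul {g h : G} (hc : Commute g h) :
    chainClass (g * h) = chainClass g + chainClass h := by
  unfold chainClass
  rw [← ofMul_mul, ← QuotientGroup.mk_mul]
  congr 2
  funext n
  exact hc.mul_pow n

theorem chainClass_conj (g k : G) : chainClass (k * g * k⁻¹) = chainClass g := by
  unfold chainClass
  congr 1
  rw [QuotientGroup.eq]
  refine ⟨1, one_pos, 1, fun n => ?_⟩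
  have := IsCommutatorProduct.commutator k (g ^ n)⁻¹
  rw [pow_one]
  change IsCommutatorProduct 1 (((k * g * k⁻¹) ^ n)⁻¹ * g ^ n)
  rw [conj_pow]
  simpa [commutatorElement_def, mul_assoc] using this

@[simp] theorem chainClass_one : chainClass (1 : G) = 0 := by
  have := chainClass_mul (Commute.one_left (1 : G))
  simpa using this

theorem chainClass_inv (g : G) : chainClass g⁻¹ = -chainClass g := by
  have := chainClass_mul (Commute.inv_right (Commute.refl g))
  rw [mul_inv_cancel, chainClass_one] at this
  exact (neg_eq_of_add_eq_zero_right this.symm).symm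

theorem chainClass_pow (g : G) (n : ℕ) : chainClass (g ^ n) = n • chainClass g := by
  induction n with
  | zero => simp
  | succ n ih => rw [pow_succ, chainClass_mul (Commute.pow_left (Commute.refl g) n), ih, succ_nsmul]

theorem chainClass_eq_of_isConj {g h : G} (hc : IsConj g h) : chainClass g = chainClass h := by
  obtain ⟨k, rfl⟩ := isConj_iff.1 hc
  exact (chainClass_conj g k).symm

theorem sum_chainClass_eq (l : List G) :
    (l.map chainClass).sum = Additive.ofMul
      ((fun n => (l.map (· ^ n)).prod : ℕ → G) : (ℕ → G) ⧸ boundedSequences G) := by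
  induction l with
  | nil => rfl
  | cons a l ih => rw [List.map_cons, List.sum_cons, ih]; rfl

theorem sum_chainClass_eq_zero_iff (l : List G) :
    (l.map chainClass).sum = 0 ↔
      ∃ K > 0, ∃ B, ∀ n, IsCommutatorProduct B ((l.map (· ^ n)).prod ^ K) := by
  rw [sum_chainClass_eq, ofMul_mk_eq_zero_iff]

theorem sum_chainClass_map_eq_zero {K : Type*} [Group K] (f : G →* K) {l : List G}
    (h : (l.map chainClass).sum = 0) : ((l.map f).map chainClass).sum = 0 := by
  rw [sum_chainClass_eq_zero_iff] at h ⊢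
  obtain ⟨K, hK, B, h⟩ := h
  refine ⟨K, hK, B, fun n => ?_⟩
  have := (h n).map f
  simpa [map_list_prod, Function.comp_def] using this

theorem sum_map_chainClass_inv (l : List G) :
    ((l.map (·⁻¹)).map chainClass).sum = -(l.map chainClass).sum := by
  induction l with
  | nil => simp
  | cons a l ih =>
    rw [List.map_cons, List.map_cons, List.sum_cons, ih, List.map_cons, List.sum_cons,
      chainClass_inv, neg_add]

/-- Homomorphisms respect equality of chain classes. -/
theorem sum_chainClass_map_congr {K : Type*} [Group K] (f : G →* K) {l l' : List G}
    (h : (l.map chainClass).sum = (l'.map chainClass).sum) :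
    ((l.map f).map chainClass).sum = ((l'.map f).map chainClass).sum := by
  have h1 : ((l ++ l'.map (·⁻¹)).map chainClass).sum = 0 := by
    rw [List.map_append, List.sum_append, sum_map_chainClass_inv, h, add_neg_cancel]
  have h2 := sum_chainClass_map_eq_zero f h1
  rw [List.map_append, List.map_append, List.sum_append] at h2
  have h3 : (l'.map (·⁻¹)).map f = (l'.map f).map (·⁻¹) := by simp
  rw [h3, sum_map_chainClass_inv] at h2
  exact eq_of_add_neg_eq_zero h2

theorem IsHomogeneousQuasimorphism.abs_map_le_of_isCommutatorProduct {ψ : G → ℝ} {D : ℝ}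
    (h : IsHomogeneousQuasimorphism ψ D) {B : ℕ} {x : G} (hx : IsCommutatorProduct B x) :
    |ψ x| ≤ 2 * B * D := by
  obtain ⟨l, hl, rfl⟩ := hx
  have h1 := h.abs_sum_map_commutator_le l
  have h2 := h.abs_map_prod_sub_le' (l.map fun h => ⁅h.1, h.2⁆)
  rw [List.length_map] at h2
  have h3 : (l.length : ℝ) * D ≤ B * D :=
    mul_le_mul_of_nonneg_right (by exact_mod_cast hl) h.nonneg
  rw [abs_le] at *
  constructor <;> linarith

/-- The value on an `n`-th multiple grows linearly in `n`, but it is bounded on products of boundedly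
many commutators. -/
theorem IsHomogeneousQuasimorphism.sum_eq_zero {ψ : G → ℝ} {D : ℝ}
    (h : IsHomogeneousQuasimorphism ψ D) {l : List G} (hl : (l.map chainClass).sum = 0) :
    (l.map ψ).sum = 0 := by
  obtain ⟨K, hK, B, hB⟩ := (sum_chainClass_eq_zero_iff l).1 hl
  refine eq_zero_of_forall_nat_mul_abs_le (C := l.length * D + 2 * B * D) fun n => ?_
  have h1 := h.abs_map_le_of_isCommutatorProduct (hB n)
  rw [h.map_pow, abs_mul, Nat.abs_cast] at h1
  have h2 := h.abs_map_prod_sub_le' (l.map (· ^ n))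
  have h3 : ((l.map (· ^ n)).map ψ).sum = n * (l.map ψ).sum := by
    rw [List.map_map, ← List.sum_map_mul_left]
    simp [Function.comp_def, h.map_pow]
  rw [h3, List.length_map] at h2
  have hK' : (1 : ℝ) ≤ K := by exact_mod_cast hK
  have h4 : |ψ (l.map (· ^ n)).prod| ≤ 2 * B * D := by
    have := abs_nonneg (ψ (l.map (· ^ n)).prod)
    nlinarith
  rw [← Nat.abs_cast n, ← abs_mul]
  rw [abs_le] at *
  constructor <;> linarith

theorem IsHomogeneousQuasimorphism.sum_congr {ψ : G → ℝ} {D : ℝ}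
    (h : IsHomogeneousQuasimorphism ψ D) {l l' : List G}
    (hl : (l.map chainClass).sum = (l'.map chainClass).sum) :
    (l.map ψ).sum = (l'.map ψ).sum := by
  have h1 : ((l ++ l'.map (·⁻¹)).map chainClass).sum = 0 := by
    rw [List.map_append, List.sum_append, sum_map_chainClass_inv, hl, add_neg_cancel]
  have h2 := h.sum_eq_zero h1
  have h3 : ((l'.map (·⁻¹)).map ψ).sum = -(l'.map ψ).sum := by
    clear h2 h1 hl
    induction l' with
    | nil => simp
    | cons a l ih => simp only [List.map_cons, List.sum_cons, ih, h.map_inv]; ring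
  rw [List.map_append, List.sum_append, h3] at h2
  linarith

/-- A chain with trivial class bounds, with multiplicity `K n`, a connected surface whose Euler
characteristic is bounded independently of `n`. -/
theorem scl_eq_zero_of_sum_chainClass {k : ℕ} {c : Fin k → G}
    (h : ((List.ofFn c).map chainClass).sum = 0) : scl c = 0 := by
  obtain ⟨K, hK, B, hB⟩ := (sum_chainClass_eq_zero_iff _).1 h
  set C : ℕ := 2 * (k * K + B) + k with hC
  have key : ∀ n : ℕ, 0 < n → scl c ≤ (C : ℝ≥0∞) / (2 * ((K * n : ℕ) : ℝ≥0∞)) := by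
    intro n hn
    obtain ⟨d, hd, e⟩ :=
      IsCommutatorProduct.exists_prod_map_pow_eq ((List.ofFn c).map (· ^ n)) K
    obtain ⟨l, hl, hl'⟩ := (hd.mul (hB n)).inv
    rw [← e] at hl'
    have hlen : l.length ≤ k * K + B := by simpa using hl
    let S : SurfaceComponent c :=
      { handles := l
        boundary := (List.finRange k).map fun j => ⟨j, (K * n : ℕ), 1⟩
        relation := by
          rw [hl', inv_mul_eq_one]
          simp only [List.ofFn_eq_map, List.map_map, Function.comp_def, BoundaryCircle.value,
            ← pow_mul, mul_comm n K, zpow_natCast, one_mul, inv_one, mul_one] }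
    refine (scl_le_of_component S (K * n) (Nat.mul_pos hK hn) fun j => ?_).trans ?_
    · simp only [S, SurfaceComponent.windingAt, List.map_map, Function.comp_def]
      rw [← List.ofFn_eq_map, List.sum_ofFn]
      simp
    · gcongr
      simp only [S, SurfaceComponent.negChi, List.length_map, List.length_finRange]
      omega
  refine le_antisymm (ENNReal.le_of_forall_pos_le_add fun ε hε _ => ?_) zero_le
  obtain ⟨n, hn⟩ := exists_nat_gt ((C : ℝ) / ε)
  have hε' : (0 : ℝ) < ε := hε
  have hn0 : 0 < n := by
    have : (0 : ℝ) < n := lt_of_le_of_lt (by positivity) hn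
    exact_mod_cast this
  rw [zero_add]
  refine (key n hn0).trans ?_
  refine ENNReal.div_le_of_le_mul ?_
  rw [div_lt_iff₀ hε'] at hn
  have h1 : (C : ℝ≥0∞) ≤ (n : ℝ≥0∞) * ε := by
    have : (C : NNReal) ≤ n * ε := by
      rw [← NNReal.coe_le_coe]; push_cast; exact hn.le
    exact_mod_cast this
  calc (C : ℝ≥0∞) ≤ ε * n := by rw [mul_comm]; exact h1
    _ ≤ ε * (2 * ((K * n : ℕ) : ℝ≥0∞)) := by
      gcongr
      have : n ≤ 2 * (K * n) := by nlinarith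
      exact_mod_cast this

end ChainClass

/-! ### Homogenization -/

theorem le_of_forall_nat_mul_le {x y C : ℝ} (h : ∀ n : ℕ, n * x ≤ n * y + C) : x ≤ y := by
  by_contra hlt
  push Not at hlt
  obtain ⟨n, hn⟩ := exists_nat_gt (C / (x - y))
  have := h n
  rw [div_lt_iff₀ (sub_pos.2 hlt)] at hn
  linarith

section Homogenization

open Filter Topology

variable {G : Type*} [Group G] {φ : G → ℝ} {D : ℝ}

theorem abs_map_pow_sub_le (hφ : ∀ g h, |φ (g * h) - φ g - φ h| ≤ D) (h1 : φ 1 = 0)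
    (g : G) (n : ℕ) : |φ (g ^ n) - n * φ g| ≤ n * D := by
  induction n with
  | zero => simp [h1]
  | succ n ih =>
    have := hφ (g ^ n) g
    rw [← pow_succ] at this
    push_cast
    rw [abs_le] at *
    constructor <;> linarith

/-- The homogenization of an antisymmetric quasimorphism of defect at most `D` has defect at most
`2 D`.  With `c = (a b)⁻¹`, the ideal triangles with vertices `(a^∞, b^∞, c^∞)` and
`(a^∞, c^∞, a b^∞)` tile the universal cover of a pair of pants; summing the defect inequality over
them along a spiral telescopes, and each power of `a`, `b`, `c` costs two triangles. -/
theorem exists_homogenization (hφ : ∀ g h, |φ (g * h) - φ g - φ h| ≤ D)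
    (hinv : ∀ g, φ g⁻¹ = -φ g) :
    ∃ ψ : G → ℝ, IsHomogeneousQuasimorphism ψ (2 * D) ∧
      ∀ g, Tendsto (fun n : ℕ => φ (g ^ n) / n) atTop (𝓝 (ψ g)) := by
  have hD : 0 ≤ D := (abs_nonneg _).trans (hφ 1 1)
  have h1 : φ 1 = 0 := by
    have := hinv 1
    rw [inv_one] at this
    linarith
  have hpow := abs_map_pow_sub_le hφ h1
  have hlim : ∀ g, ∃ x, Tendsto (fun n : ℕ => φ (g ^ n) / n) atTop (𝓝 x) := by
    intro g
    have hsub : Subadditive fun n : ℕ => φ (g ^ n) + D := by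
      intro m n
      have := hφ (g ^ m) (g ^ n)
      rw [← pow_add, abs_le] at this
      dsimp only
      linarith
    have hbdd : BddBelow (Set.range fun n : ℕ => (φ (g ^ n) + D) / n) := by
      refine ⟨-|φ g| - D, ?_⟩
      rintro _ ⟨n, rfl⟩
      dsimp only
      rcases Nat.eq_zero_or_pos n with rfl | hn
      · have := abs_nonneg (φ g)
        simp; linarith
      have hn' : (0 : ℝ) < n := by exact_mod_cast hn
      rw [le_div_iff₀ hn']
      have h2 := abs_le.1 (hpow g n)
      have h3 := neg_abs_le (φ g)
      nlinarith
    refine ⟨hsub.lim, ?_⟩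
    have h2 := hsub.tendsto_lim hbdd
    have h3 : Tendsto (fun n : ℕ => D / (n : ℝ)) atTop (𝓝 0) := tendsto_const_div_atTop_nhds_zero_nat D
    have h4 := h2.sub h3
    rw [sub_zero] at h4
    refine h4.congr fun n => ?_
    ring
  choose ψ hψ using hlim
  have hψpow : ∀ g (m : ℕ), ψ (g ^ m) = m * ψ g := by
    intro g m
    rcases Nat.eq_zero_or_pos m with rfl | hm
    · refine tendsto_nhds_unique (hψ _) ?_
      simp [h1]
    refine tendsto_nhds_unique (hψ _) ?_
    have h2 : Tendsto (fun n : ℕ => m * n) atTop atTop :=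
      tendsto_id.const_mul_atTop' hm
    have h3 := ((hψ g).comp h2).const_mul (m : ℝ)
    refine h3.congr fun n => ?_
    have : (m : ℝ) ≠ 0 := by positivity
    simp only [Function.comp_apply, ← pow_mul, Nat.cast_mul]
    field_simp
  have hψinv : ∀ g, ψ g⁻¹ = -ψ g := by
    intro g
    refine tendsto_nhds_unique (hψ _) ((hψ g).neg.congr fun n => ?_)
    rw [inv_pow, hinv, neg_div]
  have hclose : ∀ g, |φ g - ψ g| ≤ D := by
    intro g
    have h2 : Tendsto (fun n : ℕ => |φ g - φ (g ^ n) / n|) atTop (𝓝 |φ g - ψ g|) :=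
      (tendsto_const_nhds.sub (hψ g)).abs
    refine le_of_tendsto h2 ?_
    filter_upwards [eventually_gt_atTop 0] with n hn
    have hn' : (0 : ℝ) < n := by exact_mod_cast hn
    have h3 := hpow g n
    have h4 : φ g - φ (g ^ n) / n = -(φ (g ^ n) - n * φ g) / n := by field_simp; ring
    rw [h4, abs_div, abs_neg, Nat.abs_cast, div_le_iff₀ hn']
    linarith
  have tri : ∀ x y z, |φ (x⁻¹ * y) + φ (y⁻¹ * z) + φ (z⁻¹ * x)| ≤ D := by
    intro x y z
    have h2 := hφ (x⁻¹ * y) (y⁻¹ * z)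
    have h3 := hinv (x⁻¹ * z)
    rw [mul_inv_rev, inv_inv] at h3
    rw [show x⁻¹ * y * (y⁻¹ * z) = x⁻¹ * z by group] at h2
    rw [h3]
    rw [abs_le] at *
    constructor <;> linarith
  refine ⟨ψ, ⟨fun a b => ?_, hψpow⟩, hψ⟩
  set c := (a * b)⁻¹ with hc
  have hψc : ψ c = -ψ (a * b) := hψinv _
  let α : ℕ → ℝ := fun N => φ ((a ^ N)⁻¹ * (b ^ (N / 2))⁻¹)
  let β : ℕ → ℝ := fun N => φ (b ^ (N / 2) * c ^ N)
  have hstep : ∀ N, |(α (N + 1) - β (N + 2)) - (α N - β (N + 1))| ≤ 2 * D := by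
    intro N
    have t1 := tri (a ^ (N + 1)) (b ^ ((N + 1) / 2))⁻¹ (c ^ (N + 1))
    have t2 := tri (a ^ (N + 1)) (c ^ (N + 1)) (a * (b ^ (N / 2))⁻¹)
    have e1 : φ ((a ^ (N + 1))⁻¹ * c ^ (N + 1)) = -φ ((c ^ (N + 1))⁻¹ * a ^ (N + 1)) := by
      rw [← hinv]; congr 1; group
    have e2 : φ ((c ^ (N + 1))⁻¹ * (a * (b ^ (N / 2))⁻¹)) = -β (N + 2) := by
      simp only [β]
      rw [← hinv, show (N + 2) / 2 = N / 2 + 1 by omega]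
      have h2 : ∀ c' : G, a = c'⁻¹ * b⁻¹ → (c' ^ (N + 1))⁻¹ * (a * (b ^ (N / 2))⁻¹) =
          (b ^ (N / 2 + 1) * c' ^ (N + 2))⁻¹ := by
        rintro c' h
        rw [h]
        group
      rw [h2 c (by rw [hc]; group)]
    have e3 : φ ((a * (b ^ (N / 2))⁻¹)⁻¹ * a ^ (N + 1)) = -α N := by
      simp only [α]
      rw [← hinv]
      congr 1
      rw [pow_succ']
      group
    rw [inv_inv] at t1
    rw [e1, e2, e3] at t2
    change |α (N + 1) + β (N + 1) + _| ≤ D at t1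
    rw [abs_le] at *
    constructor <;> linarith
  have hN : ∀ N, |(α N - β (N + 1)) - (α 0 - β 1)| ≤ N * (2 * D) := by
    intro N
    induction N with
    | zero => simp
    | succ N ih =>
      have := hstep N
      push_cast
      rw [abs_le] at *
      constructor <;> linarith
  have hα : ∀ N : ℕ, |α N + (N * ψ a + (N / 2 : ℕ) * ψ b)| ≤ 3 * D := by
    intro N
    have h2 := hφ (a ^ N)⁻¹ (b ^ (N / 2))⁻¹
    have h3 := hclose (a ^ N)⁻¹
    have h4 := hclose (b ^ (N / 2))⁻¹
    rw [hψinv, hψpow] at h3 h4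
    simp only [α]
    rw [abs_le] at *
    constructor <;> linarith
  have hβ : ∀ N : ℕ, |β N - ((N / 2 : ℕ) * ψ b + N * ψ c)| ≤ 3 * D := by
    intro N
    have h2 := hφ (b ^ (N / 2)) (c ^ N)
    have h3 := hclose (c ^ N)
    have h4 := hclose (b ^ (N / 2))
    rw [hψpow] at h3 h4
    simp only [β]
    rw [abs_le] at *
    constructor <;> linarith
  have hfin : ∀ N : ℕ, N * |ψ (a * b) - ψ a - ψ b| ≤
      N * (2 * D) + (6 * D + |α 0 - β 1| + |ψ c|) := by
    intro N
    have h2 := hN N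
    have h3 := hα N
    have h4 := hβ (N + 1)
    have h5 : ((N / 2 : ℕ) : ℝ) + ((N + 1) / 2 : ℕ) = N := by
      have : N / 2 + (N + 1) / 2 = N := by omega
      exact_mod_cast this
    have h6 := le_abs_self (α 0 - β 1)
    have h7 := neg_abs_le (α 0 - β 1)
    have h8 := le_abs_self (ψ c)
    have h9 := neg_abs_le (ψ c)
    have h10 : ((N / 2 : ℕ) : ℝ) * ψ b + ((N + 1) / 2 : ℕ) * ψ b = N * ψ b := by
      rw [← add_mul, h5]
    rw [← Nat.abs_cast N, ← abs_mul, Nat.abs_cast]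
    push_cast at h4
    rw [abs_le] at h2 h3 h4 ⊢
    constructor <;> nlinarith
  exact le_of_forall_nat_mul_le hfin

end Homogenization

/-! ### Counting disjoint subwords -/

section Count

variable {α : Type*}

/-- `l` contains `n` disjoint subwords satisfying `M`. -/
def HasDisjointSubwords (M : List α → Prop) : ℕ → List α → Prop
  | 0, _ => True
  | n + 1, l => ∃ x u y, l = x ++ (u ++ y) ∧ M u ∧ HasDisjointSubwords M n y

variable {M : List α → Prop}

theorem HasDisjointSubwords.append_left {n : ℕ} {y : List α} (x : List α)
    (h : HasDisjointSubwords M n y) : HasDisjointSubwords M n (x ++ y) := by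
  cases n with
  | zero => trivial
  | succ n =>
    obtain ⟨x', u, y', rfl, hu, h⟩ := h
    exact ⟨x ++ x', u, y', by simp, hu, h⟩

theorem HasDisjointSubwords.append {m n : ℕ} {x y : List α} (hx : HasDisjointSubwords M m x)
    (hy : HasDisjointSubwords M n y) : HasDisjointSubwords M (m + n) (x ++ y) := by
  induction m generalizing x with
  | zero => simpa using hy.append_left x
  | succ m ih =>
    obtain ⟨x', u, y', rfl, hu, h⟩ := hx
    rw [Nat.succ_add]
    exact ⟨x', u, y' ++ y, by simp, hu, ih h⟩

/-- Cutting a word destroys at most one of the subwords: the one that contains the cut. -/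
theorem HasDisjointSubwords.split {n : ℕ} {x y : List α}
    (h : HasDisjointSubwords M n (x ++ y)) :
    ∃ i j, HasDisjointSubwords M i x ∧ HasDisjointSubwords M j y ∧ n ≤ i + j + 1 := by
  induction n generalizing x with
  | zero => exact ⟨0, 0, trivial, trivial, by omega⟩
  | succ n ih =>
    obtain ⟨a, u, b, hab, hu, h⟩ := h
    rw [← List.append_assoc] at hab
    rcases List.append_eq_append_iff.1 hab with ⟨t, h1, rfl⟩ | ⟨t, rfl, rfl⟩
    · exact ⟨0, n, trivial, h.append_left t, by omega⟩
    · obtain ⟨i, j, hi, hj, hij⟩ := ih h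
      exact ⟨i + 1, j, ⟨a, u, t, by simp, hu, hi⟩, hj, by omega⟩

theorem HasDisjointSubwords.le_length (hM : ∀ u, M u → u ≠ []) {n : ℕ} {l : List α}
    (h : HasDisjointSubwords M n l) : n ≤ l.length := by
  induction n generalizing l with
  | zero => omega
  | succ n ih =>
    obtain ⟨x, u, y, rfl, hu, h⟩ := h
    have := ih h
    have := List.length_pos_iff.2 (hM u hu)
    simp only [List.length_append]
    omega

/-- The largest number of disjoint subwords of `l` that satisfy `M`. -/
noncomputable def countDisjoint (M : List α → Prop) (l : List α) : ℕ :=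
  sSup {n | HasDisjointSubwords M n l}

theorem HasDisjointSubwords.le_count (hM : ∀ u, M u → u ≠ []) {n : ℕ} {l : List α}
    (h : HasDisjointSubwords M n l) : n ≤ countDisjoint M l :=
  le_csSup ⟨l.length, fun _ h => h.le_length hM⟩ h

theorem hasDisjointSubwords_count (hM : ∀ u, M u → u ≠ []) (l : List α) :
    HasDisjointSubwords M (countDisjoint M l) l :=
  Nat.sSup_mem (s := {n | HasDisjointSubwords M n l}) ⟨0, (trivial : HasDisjointSubwords M 0 l)⟩
    ⟨l.length, fun _ (h : HasDisjointSubwords M _ l) => h.le_length hM⟩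

theorem count_add_le (hM : ∀ u, M u → u ≠ []) (x y : List α) :
    countDisjoint M x + countDisjoint M y ≤ countDisjoint M (x ++ y) :=
  ((hasDisjointSubwords_count hM x).append (hasDisjointSubwords_count hM y)).le_count hM

theorem count_append_le (hM : ∀ u, M u → u ≠ []) (x y : List α) :
    countDisjoint M (x ++ y) ≤ countDisjoint M x + countDisjoint M y + 1 := by
  obtain ⟨i, j, hi, hj, h⟩ := (hasDisjointSubwords_count hM (x ++ y)).split
  have := hi.le_count hM
  have := hj.le_count hM
  omega

theorem count_eq_zero (hM : ∀ u, M u → u ≠ []) {l : List α}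
    (h : ¬ ∃ x u y, l = x ++ (u ++ y) ∧ M u) : countDisjoint M l = 0 := by
  by_contra h0
  obtain ⟨n, hn⟩ := Nat.exists_eq_succ_of_ne_zero h0
  have := hasDisjointSubwords_count hM l
  rw [hn] at this
  obtain ⟨x, u, y, e, hu, -⟩ := this
  exact h ⟨x, u, y, e, hu⟩

theorem HasDisjointSubwords.map {f : α → α} (hf : ∀ u, M u → M (u.map f)) {n : ℕ} {l : List α}
    (h : HasDisjointSubwords M n l) : HasDisjointSubwords M n (l.map f) := by
  induction n generalizing l with
  | zero => trivial
  | succ n ih =>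
    obtain ⟨x, u, y, rfl, hu, h⟩ := h
    exact ⟨x.map f, u.map f, y.map f, by simp, hf u hu, ih h⟩

variable {G : Type*} [Group G] {M : List G → Prop}

/-- The formal inverse of a word. -/
def invWord (l : List G) : List G := (l.map (·⁻¹)).reverse

@[simp] theorem invWord_nil : invWord ([] : List G) = [] := rfl

@[simp] theorem invWord_invWord (l : List G) : invWord (invWord l) = l := by
  simp [invWord, List.map_reverse]

@[simp] theorem invWord_append (x y : List G) : invWord (x ++ y) = invWord y ++ invWord x := by
  simp [invWord]

@[simp] theorem length_invWord (l : List G) : (invWord l).length = l.length := by simp [invWord]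

theorem invWord_cons (a : G) (l : List G) : invWord (a :: l) = invWord l ++ [a⁻¹] := by
  simp [invWord]

@[simp] theorem prod_invWord (l : List G) : (invWord l).prod = l.prod⁻¹ := by
  rw [invWord, List.prod_inv_reverse]

theorem invWord_map {K : Type*} [Group K] (f : G →* K) (l : List G) :
    invWord (l.map f) = (invWord l).map f := by
  simp [invWord, List.map_reverse, Function.comp_def]

theorem invWord_ne_nil {l : List G} (h : l ≠ []) : invWord l ≠ [] := by
  simpa [invWord] using h

theorem HasDisjointSubwords.invWord {n : ℕ} {l : List G} (h : HasDisjointSubwords M n l) :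
    HasDisjointSubwords (fun u => M (invWord u)) n (invWord l) := by
  induction n generalizing l with
  | zero => trivial
  | succ n ih =>
    obtain ⟨x, u, y, rfl, hu, h⟩ := h
    rw [invWord_append, invWord_append, List.append_assoc]
    refine (ih h).append (m := n) (n := 1) ?_
    exact ⟨[], _, _, rfl, by simpa using hu, trivial⟩

theorem count_invWord (hM : ∀ u, M u → u ≠ []) (l : List G) :
    countDisjoint (fun u => M (invWord u)) (invWord l) = countDisjoint M l := by
  have hM' : ∀ u, M (invWord u) → u ≠ [] := by
    rintro u hu rfl
    exact hM _ hu rfl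
  refine le_antisymm ?_ ((hasDisjointSubwords_count hM l).invWord.le_count hM')
  have := (hasDisjointSubwords_count hM' (invWord l)).invWord
  simp only [invWord_invWord] at this
  exact this.le_count hM

/-- The signed number of disjoint subwords that satisfy `M`; the words whose inverse satisfies `M`
count negatively. -/
noncomputable def signedCount (M : List G → Prop) (l : List G) : ℝ :=
  countDisjoint M l - countDisjoint (fun u => M (invWord u)) l

theorem signedCount_invWord (hM : ∀ u, M u → u ≠ []) (l : List G) :
    signedCount M (invWord l) = -signedCount M l := by
  have h1 := count_invWord hM l
  have hM' : ∀ u, M (invWord u) → u ≠ [] := by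
    rintro u hu rfl
    exact hM _ hu rfl
  have h2 := count_invWord hM' l
  simp only [invWord_invWord] at h2
  rw [signedCount, signedCount, h1, h2]
  ring

theorem abs_signedCount_append_le (hM : ∀ u, M u → u ≠ []) (x y : List G) :
    |signedCount M (x ++ y) - signedCount M x - signedCount M y| ≤ 1 := by
  have hM' : ∀ u, M (invWord u) → u ≠ [] := by
    rintro u hu rfl
    exact hM _ hu rfl
  have h1 := count_add_le hM x y
  have h2 := count_append_le hM x y
  have h3 := count_add_le hM' x y
  have h4 := count_append_le hM' x y
  rw [signedCount, signedCount, signedCount, abs_le]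
  have h1' : (countDisjoint M x : ℝ) + countDisjoint M y ≤ countDisjoint M (x ++ y) := by
    exact_mod_cast h1
  have h2' : (countDisjoint M (x ++ y) : ℝ) ≤ countDisjoint M x + countDisjoint M y + 1 := by
    exact_mod_cast h2
  have h3' : (countDisjoint (fun u => M (invWord u)) x : ℝ) +
      countDisjoint (fun u => M (invWord u)) y ≤
      countDisjoint (fun u => M (invWord u)) (x ++ y) := by exact_mod_cast h3
  have h4' : (countDisjoint (fun u => M (invWord u)) (x ++ y) : ℝ) ≤
      countDisjoint (fun u => M (invWord u)) x + countDisjoint (fun u => M (invWord u)) y + 1 := by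
    exact_mod_cast h4
  constructor <;> linarith

/-- A cancellation changes the signed count by at most `3`. -/
theorem abs_signedCount_cancel_le (hM : ∀ u, M u → u ≠ []) (a b c : List G) :
    |signedCount M (a ++ c) - signedCount M (a ++ b) - signedCount M (invWord b ++ c)| ≤ 3 := by
  have h1 := abs_signedCount_append_le hM a c
  have h2 := abs_signedCount_append_le hM a b
  have h3 := abs_signedCount_append_le hM (invWord b) c
  rw [signedCount_invWord hM b] at h3
  rw [abs_le] at *
  constructor <;> linarith

theorem signedCount_map (hM : ∀ u, M u → u ≠ []) (f : G ≃* G) (hf : ∀ u, M u → M (u.map f))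
    (hf' : ∀ u, M u → M (u.map f.symm)) (l : List G) :
    signedCount M (l.map f) = signedCount M l := by
  have key : ∀ {M : List G → Prop}, (∀ u, M u → u ≠ []) → ∀ f : G ≃* G, (∀ u, M u → M (u.map f)) →
      ∀ l, countDisjoint M l ≤ countDisjoint M (l.map f) := fun hM f hf l =>
    ((hasDisjointSubwords_count hM l).map hf).le_count hM
  have key2 : ∀ {M : List G → Prop}, (∀ u, M u → u ≠ []) → (∀ u, M u → M (u.map f)) →
      (∀ u, M u → M (u.map f.symm)) → countDisjoint M (l.map f) = countDisjoint M l := by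
    intro M hM hf hf'
    refine le_antisymm ?_ (key hM f hf l)
    have := key hM f.symm hf' (l.map f)
    simpa [Function.comp_def] using this
  have hM' : ∀ u, M (invWord u) → u ≠ [] := by
    rintro u hu rfl
    exact hM _ hu rfl
  rw [signedCount, signedCount, key2 hM hf hf', key2 hM' ?_ ?_]
  · intro u hu
    have : M (invWord (u.map f.toMonoidHom)) := by rw [invWord_map]; exact hf _ hu
    exact this
  · intro u hu
    have : M (invWord (u.map f.symm.toMonoidHom)) := by rw [invWord_map]; exact hf' _ hu
    exact this

end Count

/-! ### Graph products of cyclic groups of order two and infinity -/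

/-- The relators of the group generated by the vertices of `Γ` in which adjacent vertices commute
and the vertices in `Q` have order two.  It is the right-angled Artin group for `Q = ∅` and the
right-angled Coxeter group for `Q = univ`. -/
def graphRels {V : Type*} (Γ : SimpleGraph V) (Q : Set V) : Set (FreeGroup V) :=
  commutationRels Γ ∪ {r | ∃ v ∈ Q, r = FreeGroup.of v ^ 2}

/-- The group presented by `graphRels Γ Q`. -/
abbrev GraphGroup {V : Type*} (Γ : SimpleGraph V) (Q : Set V) : Type _ :=
  PresentedGroup (graphRels Γ Q)

theorem graphRels_empty {V : Type*} (Γ : SimpleGraph V) : graphRels Γ ∅ = commutationRels Γ := by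
  simp [graphRels]

theorem graphRels_univ {V : Type*} (Γ : SimpleGraph V) :
    graphRels Γ Set.univ = commutationRels Γ ∪ squareRels V := by
  simp [graphRels, squareRels]

namespace GraphGroup

variable {V : Type*} {Γ : SimpleGraph V} {Q : Set V}

/-- The generator of a vertex. -/
def gen (v : V) : GraphGroup Γ Q := PresentedGroup.of v

theorem commute_gen {v w : V} (h : Γ.Adj v w) : Commute (gen v : GraphGroup Γ Q) (gen w) := by
  have h1 : PresentedGroup.mk (graphRels Γ Q) ⁅FreeGroup.of v, FreeGroup.of w⁆ = 1 :=
    PresentedGroup.one_of_mem (Or.inl ⟨v, w, h, rfl⟩)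
  rw [map_commutatorElement] at h1
  exact commutatorElement_eq_one_iff_commute.1 h1

theorem gen_sq {v : V} (h : v ∈ Q) : (gen v : GraphGroup Γ Q) ^ 2 = 1 := by
  have h1 : PresentedGroup.mk (graphRels Γ Q) (FreeGroup.of v ^ 2) = 1 :=
    PresentedGroup.one_of_mem (Or.inr ⟨v, h, rfl⟩)
  rw [map_pow] at h1
  exact h1

/-- The universal property of a graph group. -/
def lift {K : Type*} [Group K] (f : V → K) (hc : ∀ v w, Γ.Adj v w → Commute (f v) (f w))
    (hs : ∀ v ∈ Q, f v ^ 2 = 1) : GraphGroup Γ Q →* K :=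
  PresentedGroup.toGroup (f := f) (by
    rintro r (⟨v, w, h, rfl⟩ | ⟨v, h, rfl⟩)
    · rw [map_commutatorElement, FreeGroup.lift_apply_of, FreeGroup.lift_apply_of]
      exact commutatorElement_eq_one_iff_commute.2 (hc v w h)
    · rw [map_pow, FreeGroup.lift_apply_of]
      exact hs v h)

@[simp] theorem lift_gen {K : Type*} [Group K] (f : V → K)
    (hc : ∀ v w, Γ.Adj v w → Commute (f v) (f w)) (hs : ∀ v ∈ Q, f v ^ 2 = 1) (v : V) :
    (lift f hc hs : GraphGroup Γ Q →* K) (gen v) = f v :=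
  PresentedGroup.toGroup.of _

theorem hom_ext {K : Type*} [Group K] {f g : GraphGroup Γ Q →* K}
    (h : ∀ v, f (gen v) = g (gen v)) : f = g :=
  PresentedGroup.ext h

theorem mem_of_gen_mem (H : Subgroup (GraphGroup Γ Q)) (h : ∀ v, gen v ∈ H) (x : GraphGroup Γ Q) :
    x ∈ H :=
  PresentedGroup.generated_by _ H h x

open Classical in
/-- The retraction that kills the vertices outside `Λ`. -/
noncomputable def retr (Λ : Set V) : GraphGroup Γ Q →* GraphGroup Γ Q :=
  lift (fun v => if v ∈ Λ then gen v else 1)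
    (fun v w h => by
      split_ifs
      · exact commute_gen h
      · exact Commute.one_right _
      · exact Commute.one_left _
      · exact Commute.one_left _)
    (fun v h => by
      split_ifs
      · exact gen_sq h
      · simp)

theorem retr_gen_of_mem {Λ : Set V} {v : V} (h : v ∈ Λ) :
    retr Λ (gen v : GraphGroup Γ Q) = gen v := by
  simp [retr, h]

theorem retr_gen_of_notMem {Λ : Set V} {v : V} (h : v ∉ Λ) :
    retr Λ (gen v : GraphGroup Γ Q) = 1 := by
  simp [retr, h]

theorem retr_retr (Λ Λ' : Set V) (x : GraphGroup Γ Q) :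
    retr Λ (retr Λ' x) = retr (Λ ∩ Λ') x := by
  have : (retr Λ).comp (retr Λ') = (retr (Λ ∩ Λ') : GraphGroup Γ Q →* _) := by
    refine hom_ext fun v => ?_
    by_cases h : v ∈ Λ <;> by_cases h' : v ∈ Λ' <;>
      simp [retr_gen_of_mem, retr_gen_of_notMem, h, h']
  exact DFunLike.congr_fun this x

/-- The standard parabolic subgroup generated by the vertices in `Λ`, as the fixed points of the
retraction onto it. -/
noncomputable def par (Λ : Set V) : Subgroup (GraphGroup Γ Q) :=
  (retr Λ).eqLocus (MonoidHom.id _)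

theorem mem_par {Λ : Set V} {x : GraphGroup Γ Q} : x ∈ par Λ ↔ retr Λ x = x := Iff.rfl

theorem retr_mem_par (Λ : Set V) (x : GraphGroup Γ Q) : retr Λ x ∈ par Λ := by
  rw [mem_par, retr_retr, Set.inter_self]

theorem gen_mem_par {Λ : Set V} {v : V} (h : v ∈ Λ) : (gen v : GraphGroup Γ Q) ∈ par Λ :=
  retr_gen_of_mem h

theorem retr_mem_par_inter {Λ Λ' : Set V} {x : GraphGroup Γ Q} (h : x ∈ par Λ) :
    retr Λ' x ∈ par (Λ' ∩ Λ) := by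
  rw [← mem_par.1 h, retr_retr]
  exact retr_mem_par _ _

theorem par_mono {Λ Λ' : Set V} (h : Λ ⊆ Λ') :
    (par Λ : Subgroup (GraphGroup Γ Q)) ≤ par Λ' := by
  intro x hx
  have := retr_mem_par_inter (Λ' := Λ') hx
  rw [mem_par] at hx ⊢
  conv_lhs => rw [← hx]
  rw [retr_retr, Set.inter_eq_right.2 h, hx]

/-- The subgroup `par Λ` is generated by the vertices in `Λ`. -/
theorem par_le {Λ : Set V} (H : Subgroup (GraphGroup Γ Q)) (h : ∀ v ∈ Λ, gen v ∈ H) :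
    par Λ ≤ H := by
  intro x hx
  rw [← mem_par.1 hx]
  refine mem_of_gen_mem (H.comap (retr Λ)) (fun v => ?_) x
  rw [Subgroup.mem_comap]
  by_cases hv : v ∈ Λ
  · rw [retr_gen_of_mem hv]; exact h v hv
  · rw [retr_gen_of_notMem hv]; exact H.one_mem

theorem exists_finset_mem_par (x : GraphGroup Γ Q) : ∃ S : Finset V, x ∈ par (S : Set V) := by
  classical
  let H : Subgroup (GraphGroup Γ Q) :=
    { carrier := {x | ∃ S : Finset V, x ∈ par (S : Set V)}
      one_mem' := ⟨∅, Subgroup.one_mem _⟩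
      inv_mem' := by
        rintro x ⟨S, h⟩
        exact ⟨S, Subgroup.inv_mem _ h⟩
      mul_mem' := by
        rintro x y ⟨S, h⟩ ⟨T, h'⟩
        refine ⟨S ∪ T, Subgroup.mul_mem _ (par_mono ?_ h) (par_mono ?_ h')⟩ <;>
        simp }
  exact mem_of_gen_mem H (fun v => ⟨{v}, gen_mem_par (by simp)⟩) x

/-- The intersection of two parabolic subgroups lies in a conjugate of the standard parabolic
subgroup of the common vertices: apply the retraction onto one of them. -/
theorem exists_conj_mem_par_inter (Λ Λ' : Set V) (a b : GraphGroup Γ Q) :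
    ∃ c, ∀ x, a⁻¹ * x * a ∈ par Λ → b⁻¹ * x * b ∈ par Λ' → c⁻¹ * x * c ∈ par (Λ ∩ Λ') := by
  refine ⟨b * (retr Λ' (a⁻¹ * b))⁻¹, fun x hx hx' => ?_⟩
  have h1 : retr Λ' (a⁻¹ * x * a) ∈ par (Λ' ∩ Λ) := retr_mem_par_inter hx
  rw [Set.inter_comm]
  convert h1 using 1
  have h2 : a⁻¹ * x * a = (a⁻¹ * b) * (b⁻¹ * x * b) * (a⁻¹ * b)⁻¹ := by group
  have h3 : ∀ d, retr Λ' (d * (b⁻¹ * x * b) * d⁻¹) =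
      retr Λ' d * (b⁻¹ * x * b) * (retr Λ' d)⁻¹ := fun d => by
    rw [map_mul, map_mul, map_inv, mem_par.1 hx']
  rw [h2, h3]
  group

/-- Elements of `P = par {v}ᶜ` that commute with `v` lie in the subgroup of the link of `v`:
let `G` act on two copies of `G ⧸ par (link v)`, with `v` exchanging the two base points. -/
theorem mem_par_neighborSet_of_commute {v : V} {x : GraphGroup Γ Q} (hx : x ∈ par {v}ᶜ)
    (hc : Commute x (gen v)) : x ∈ par (Γ.neighborSet v) := by
  classical
  let H : Subgroup (GraphGroup Γ Q) := par (Γ.neighborSet v)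
  let Y := (GraphGroup Γ Q ⧸ H) × Bool
  let base : Bool → Y := fun b => (((1 : GraphGroup Γ Q) : GraphGroup Γ Q ⧸ H), b)
  let left : GraphGroup Γ Q →* Equiv.Perm Y :=
    { toFun := fun g => Equiv.prodCongr (MulAction.toPermHom _ (GraphGroup Γ Q ⧸ H) g) (Equiv.refl _)
      map_one' := by ext y <;> simp
      map_mul' := fun g h => by ext y <;> simp [mul_smul] }
  have hleft : ∀ g b, left g (base b) = ((g : GraphGroup Γ Q ⧸ H), b) := by
    intro g b
    refine Prod.ext ?_ rfl
    change ((g * 1 : GraphGroup Γ Q) : GraphGroup Γ Q ⧸ H) = _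
    rw [mul_one]
  let σ : Equiv.Perm Y := Equiv.swap (base true) (base false)
  have hcomm : ∀ w, Γ.Adj v w → Commute (left (gen w)) σ := by
    intro w hw
    have h1 : ∀ b, left (gen w) (base b) = base b := by
      intro b
      rw [hleft]
      refine Prod.ext ?_ rfl
      change ((gen w : GraphGroup Γ Q) : GraphGroup Γ Q ⧸ H) = ((1 : GraphGroup Γ Q) : _)
      rw [QuotientGroup.eq]
      simpa using (gen_mem_par (Q := Q) (Γ := Γ) (show w ∈ Γ.neighborSet v from hw))
    have := Equiv.swap_apply_apply (left (gen w)) (base true) (base false)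
    rw [h1, h1] at this
    change left (gen w) * σ = σ * left (gen w)
    exact (eq_mul_inv_iff_mul_eq.1 this).symm
  let ρ : GraphGroup Γ Q →* Equiv.Perm Y := lift (fun w => if w = v then σ else left (gen w))
    (by
      intro u w h
      split_ifs with h1 h2 h2
      · exact Commute.refl _
      · subst h1; exact (hcomm w h).symm
      · subst h2; exact hcomm u h.symm
      · exact (commute_gen h).map left)
    (by
      intro w hw
      split_ifs
      · ext y : 1
        simp [σ, pow_two]
      · rw [← map_pow, gen_sq hw, map_one])
  have hρ : ∀ y : GraphGroup Γ Q, ρ (retr {v}ᶜ y) = left (retr {v}ᶜ y) := by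
    intro y
    have : ρ.comp (retr {v}ᶜ) = left.comp (retr {v}ᶜ) := by
      refine hom_ext fun w => ?_
      by_cases hw : w = v
      · simp [retr_gen_of_notMem, hw]
      · simp [retr_gen_of_mem, hw, ρ]
    exact DFunLike.congr_fun this y
  have h1 := hc.map ρ
  have h2 : ρ x = left x := by rw [← mem_par.1 hx]; exact hρ x
  have h3 : ρ (gen v) = σ := by simp [ρ]
  rw [h2, h3] at h1
  have h4 := DFunLike.congr_fun h1.eq (base true)
  simp only [Equiv.Perm.mul_apply] at h4
  rw [show σ (base true) = base false from Equiv.swap_apply_left _ _, hleft, hleft] at h4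
  by_contra hne
  have h5 : ∀ b, (((x : GraphGroup Γ Q ⧸ H), true) : Y) ≠ base b := by
    intro b hb
    apply hne
    have := congrArg Prod.fst hb
    simp only [base] at this
    rw [eq_comm, QuotientGroup.eq] at this
    simpa using this
  rw [show σ ((x : GraphGroup Γ Q ⧸ H), true) = _ from
    Equiv.swap_apply_of_ne_of_ne (h5 true) (h5 false)] at h4
  simpa using congrArg Prod.snd h4

end GraphGroup

/-! ### Reduced words -/

section ReducedWord

variable {G : Type*} [Group G]

/-- A word is reduced if no two consecutive letters are inverse to each other. -/
def IsReducedWord (l : List G) : Prop := l.IsChain fun a b => a * b ≠ 1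

theorem IsReducedWord.map {K : Type*} [Group K] {l : List G} (h : IsReducedWord l) {f : G →* K}
    (hf : Function.Injective f) : IsReducedWord (l.map f) := by
  refine List.isChain_map_of_isChain f (fun a b hab => ?_) h
  rw [← map_mul]
  rwa [Ne, map_eq_one_iff f hf]

theorem IsReducedWord.invWord {l : List G} (h : IsReducedWord l) : IsReducedWord (invWord l) := by
  unfold IsReducedWord at h ⊢
  rw [_root_.invWord, List.isChain_reverse, List.isChain_map]
  refine h.imp fun a b hab h1 => hab ?_
  rw [← mul_inv_rev, inv_eq_one] at h1
  exact h1

variable (G) in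
/-- The reduced words, which are the vertices of the tree. -/
abbrev ReducedWord := {l : List G // IsReducedWord l}

/-- The word obtained from `l` by multiplication with the letter `a` on the left. -/
noncomputable def consCancel (a : G) : List G → List G
  | [] => [a]
  | b :: l => open Classical in if a * b = 1 then l else a :: b :: l

theorem IsReducedWord.consCancel {l : List G} (a : G) (h : IsReducedWord l) :
    IsReducedWord (consCancel a l) := by
  cases l with
  | nil => exact List.isChain_singleton _
  | cons b l =>
    simp only [_root_.consCancel]
    split_ifs with hab
    · exact List.IsChain.tail h
    · exact List.IsChain.cons_cons hab h

theorem consCancel_inv_consCancel (a : G) {l : List G} (h : IsReducedWord l) :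
    consCancel a⁻¹ (consCancel a l) = l := by
  cases l with
  | nil => simp [consCancel]
  | cons b l =>
    simp only [consCancel]
    split_ifs with hab
    · obtain rfl : b = a⁻¹ := (inv_eq_of_mul_eq_one_right hab).symm
      cases l with
      | nil => rfl
      | cons c l =>
        have : a⁻¹ * c ≠ 1 := (List.isChain_cons_cons.1 h).1
        simp [this]
    · simp

theorem prod_consCancel (a : G) (l : List G) : (consCancel a l).prod = a * l.prod := by
  cases l with
  | nil => simp [consCancel]
  | cons b l =>
    simp only [consCancel]
    split_ifs with h
    · rw [List.prod_cons, ← mul_assoc, h, one_mul]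
    · simp

/-- Multiplication with a letter, as a permutation of the reduced words. -/
noncomputable def letterPerm (a : G) : Equiv.Perm (ReducedWord G) where
  toFun l := ⟨consCancel a l.1, l.2.consCancel a⟩
  invFun l := ⟨consCancel a⁻¹ l.1, l.2.consCancel a⁻¹⟩
  left_inv l := Subtype.ext (consCancel_inv_consCancel a l.2)
  right_inv l := Subtype.ext (by simpa using consCancel_inv_consCancel a⁻¹ l.2)

theorem letterPerm_inv (a : G) : letterPerm a⁻¹ = (letterPerm a)⁻¹ := by
  ext l : 1
  rfl

/-- The word obtained by conjugating all letters. -/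
def conjWord (x : G) (l : List G) : List G := l.map (MulAut.conj x)

@[simp] theorem conjWord_nil (x : G) : conjWord x [] = [] := rfl

@[simp] theorem conjWord_cons (x a : G) (l : List G) :
    conjWord x (a :: l) = (x * a * x⁻¹) :: conjWord x l := rfl

@[simp] theorem conjWord_append (x : G) (l l' : List G) :
    conjWord x (l ++ l') = conjWord x l ++ conjWord x l' := by simp [conjWord]

@[simp] theorem length_conjWord (x : G) (l : List G) : (conjWord x l).length = l.length := by
  simp [conjWord]

@[simp] theorem conjWord_one (l : List G) : conjWord 1 l = l := by simp [conjWord]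

theorem conjWord_conjWord (x y : G) (l : List G) :
    conjWord x (conjWord y l) = conjWord (x * y) l := by
  simp [conjWord, Function.comp_def]

theorem prod_conjWord (x : G) (l : List G) : (conjWord x l).prod = x * l.prod * x⁻¹ := by
  rw [conjWord, ← map_list_prod, MulAut.conj_apply]

theorem invWord_conjWord (x : G) (l : List G) :
    invWord (conjWord x l) = conjWord x (invWord l) :=
  invWord_map (MulAut.conj x).toMonoidHom l

theorem take_conjWord (x : G) (l : List G) (i : ℕ) :
    (conjWord x l).take i = conjWord x (l.take i) := by simp [conjWord]

theorem IsReducedWord.conjWord {l : List G} (h : IsReducedWord l) (x : G) :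
    IsReducedWord (conjWord x l) :=
  h.map (f := (MulAut.conj x).toMonoidHom) (MulAut.conj x).injective

/-- Conjugation of the letters, as a permutation of the reduced words. -/
def conjPerm : G →* Equiv.Perm (ReducedWord G) where
  toFun x :=
    { toFun := fun l => ⟨conjWord x l.1, l.2.conjWord x⟩
      invFun := fun l => ⟨conjWord x⁻¹ l.1, l.2.conjWord x⁻¹⟩
      left_inv := fun l => Subtype.ext (by simp [conjWord_conjWord])
      right_inv := fun l => Subtype.ext (by simp [conjWord_conjWord]) }
  map_one' := by ext l : 2; simp
  map_mul' x y := by ext l : 2; simp [conjWord_conjWord]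

theorem conjPerm_apply (x : G) (l : ReducedWord G) : (conjPerm x l).1 = conjWord x l.1 := rfl

theorem conjWord_consCancel (x a : G) (l : List G) :
    conjWord x (consCancel a l) = consCancel (x * a * x⁻¹) (conjWord x l) := by
  cases l with
  | nil => rfl
  | cons b l =>
    have h : x * a * x⁻¹ * (x * b * x⁻¹) = 1 ↔ a * b = 1 := by
      rw [show x * a * x⁻¹ * (x * b * x⁻¹) = x * (a * b) * x⁻¹ by group]
      exact conj_eq_one_iff
    by_cases hab : a * b = 1
    · simp [consCancel, hab, h.2 hab]
    · simp [consCancel, hab]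

theorem conjPerm_mul_letterPerm (x a : G) :
    conjPerm x * letterPerm a = letterPerm (x * a * x⁻¹) * conjPerm x := by
  ext l : 2
  exact conjWord_consCancel x a l.1

end ReducedWord

/-! ### The tree dual to a vertex -/

namespace GraphGroup

variable {V : Type*} {Γ : SimpleGraph V} {Q : Set V}

open Classical in
/-- The action on the reduced words dual to the vertex `v`: the generator `v` multiplies words by
the letter `v`, and the other generators conjugate the letters.  It is the action on the
Bass–Serre tree of the splitting dual to `v`; the empty word has stabilizer `par {v}ᶜ`. -/
noncomputable def treeAction (v : V) :
    GraphGroup Γ Q →* Equiv.Perm (ReducedWord (GraphGroup Γ Q)) :=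
  have key : ∀ u, Γ.Adj v u → Commute (letterPerm (gen v : GraphGroup Γ Q)) (conjPerm (gen u)) := by
    intro u h
    have h1 := conjPerm_mul_letterPerm (gen u : GraphGroup Γ Q) (gen v)
    rw [← (commute_gen h).eq, mul_inv_cancel_right] at h1
    exact h1.symm
  lift (fun u => if u = v then letterPerm (gen v) else conjPerm (gen u))
    (by
      intro u w h
      split_ifs with h1 h2 h2
      · exact Commute.refl _
      · subst h1; exact key w h
      · subst h2; exact (key u h.symm).symm
      · exact (commute_gen h).map conjPerm)
    (by
      intro u hu
      split_ifs with h
      · subst h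
        have h1 : (gen u : GraphGroup Γ Q)⁻¹ = gen u := by
          rw [inv_eq_iff_mul_eq_one, ← pow_two, gen_sq hu]
        have h2 := letterPerm_inv (gen u : GraphGroup Γ Q)
        rw [h1] at h2
        rw [pow_two]
        nth_rw 1 [h2]
        exact inv_mul_cancel _
      · rw [← map_pow, gen_sq hu, map_one])

theorem treeAction_gen_self (v : V) :
    treeAction v (gen v : GraphGroup Γ Q) = letterPerm (gen v) := by
  simp [treeAction]

theorem treeAction_gen_of_ne {u v : V} (h : u ≠ v) :
    treeAction v (gen u : GraphGroup Γ Q) = conjPerm (gen u) := by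
  simp [treeAction, h]

theorem treeAction_of_mem_par {v : V} {x : GraphGroup Γ Q} (hx : x ∈ par {v}ᶜ) :
    treeAction v x = conjPerm x := by
  have : (treeAction v).comp (retr {v}ᶜ) = conjPerm.comp (retr {v}ᶜ : GraphGroup Γ Q →* _) := by
    refine hom_ext fun w => ?_
    by_cases hw : w = v
    · simp [retr_gen_of_notMem, hw]
    · simp [retr_gen_of_mem, hw, treeAction_gen_of_ne]
  rw [← mem_par.1 hx]
  exact DFunLike.congr_fun this x

/-- The product of the letters is equivariant up to the vertex group `par {v}ᶜ`, so that words represent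
left cosets of it. -/
theorem prod_treeAction_mul (v : V) (g : GraphGroup Γ Q) (l : ReducedWord (GraphGroup Γ Q)) :
    (treeAction v g l).1.prod * retr {v}ᶜ g = g * l.1.prod := by
  let H : Subgroup (GraphGroup Γ Q) :=
    { carrier := {g | ∀ l : ReducedWord (GraphGroup Γ Q),
        (treeAction v g l).1.prod * retr {v}ᶜ g = g * l.1.prod}
      one_mem' := by simp
      mul_mem' := by
        intro a b ha hb l
        rw [map_mul, map_mul, Equiv.Perm.mul_apply, ← mul_assoc, ha, mul_assoc, hb, mul_assoc]
      inv_mem' := by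
        intro a ha l
        have h := ha (treeAction v a⁻¹ l)
        rw [← Equiv.Perm.mul_apply, ← map_mul, mul_inv_cancel, map_one, Equiv.Perm.one_apply] at h
        rw [map_inv (retr _), mul_inv_eq_iff_eq_mul, mul_assoc, h, inv_mul_cancel_left] }
  refine mem_of_gen_mem H (fun u l => ?_) g l
  by_cases hu : u = v
  · subst hu
    rw [treeAction_gen_self, retr_gen_of_notMem (by simp), mul_one]
    exact prod_consCancel _ _
  · rw [treeAction_gen_of_ne hu, retr_gen_of_mem (by simpa using hu), conjPerm_apply,
      prod_conjWord]
    group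

/-- The letters of the words that represent vertices of the tree dual to `v`: the conjugates of
`v` and `v⁻¹` by elements of `par {v}ᶜ`. -/
def IsLetter (v : V) (a : GraphGroup Γ Q) : Prop :=
  ∃ y ∈ par {v}ᶜ, a = y * gen v * y⁻¹ ∨ a = y * (gen v)⁻¹ * y⁻¹

theorem isLetter_gen (v : V) : IsLetter v (gen v : GraphGroup Γ Q) :=
  ⟨1, Subgroup.one_mem _, Or.inl (by simp)⟩

theorem IsLetter.inv {v : V} {a : GraphGroup Γ Q} (h : IsLetter v a) : IsLetter v a⁻¹ := by
  obtain ⟨y, hy, rfl | rfl⟩ := h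
  · exact ⟨y, hy, Or.inr (by group)⟩
  · exact ⟨y, hy, Or.inl (by group)⟩

theorem IsLetter.conj {v : V} {a x : GraphGroup Γ Q} (h : IsLetter v a) (hx : x ∈ par {v}ᶜ) :
    IsLetter v (x * a * x⁻¹) := by
  obtain ⟨y, hy, rfl | rfl⟩ := h
  · exact ⟨x * y, Subgroup.mul_mem _ hx hy, Or.inl (by group)⟩
  · exact ⟨x * y, Subgroup.mul_mem _ hx hy, Or.inr (by group)⟩

theorem treeAction_of_isLetter {v : V} {a : GraphGroup Γ Q} (h : IsLetter v a) :
    treeAction v a = letterPerm a := by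
  obtain ⟨y, hy, rfl | rfl⟩ := h
  · rw [map_mul, map_mul, map_inv, treeAction_of_mem_par hy, treeAction_gen_self,
      conjPerm_mul_letterPerm, mul_inv_cancel_right]
  · rw [map_mul, map_mul, map_inv, map_inv, treeAction_of_mem_par hy, treeAction_gen_self,
      ← letterPerm_inv, conjPerm_mul_letterPerm, mul_inv_cancel_right]

theorem isLetter_of_mem_consCancel {v : V} {a : GraphGroup Γ Q} (ha : IsLetter v a)
    {l : List (GraphGroup Γ Q)} (hl : ∀ b ∈ l, IsLetter v b) :
    ∀ b ∈ consCancel a l, IsLetter v b := by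
  cases l with
  | nil => simpa [consCancel] using ha
  | cons c l =>
    simp only [consCancel]
    split_ifs
    · exact fun b hb => hl b (List.mem_cons_of_mem _ hb)
    · intro b hb
      rcases List.mem_cons.1 hb with rfl | hb
      exacts [ha, hl b hb]

theorem isLetter_of_mem_conjWord {v : V} {x : GraphGroup Γ Q} (hx : x ∈ par {v}ᶜ)
    {l : List (GraphGroup Γ Q)} (hl : ∀ b ∈ l, IsLetter v b) :
    ∀ b ∈ conjWord x l, IsLetter v b := by
  intro b hb
  obtain ⟨a, ha, rfl⟩ := List.mem_map.1 hb
  exact (hl a ha).conj hx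

theorem isLetter_of_mem_treeAction (v : V) (g : GraphGroup Γ Q)
    (l : ReducedWord (GraphGroup Γ Q)) :
    (∀ b ∈ l.1, IsLetter v b) ↔ ∀ b ∈ (treeAction v g l).1, IsLetter v b := by
  let H : Subgroup (GraphGroup Γ Q) :=
    { carrier := {g | ∀ l : ReducedWord (GraphGroup Γ Q),
        (∀ b ∈ l.1, IsLetter v b) ↔ ∀ b ∈ (treeAction v g l).1, IsLetter v b}
      one_mem' := by simp
      mul_mem' := by
        intro a b ha hb l
        rw [map_mul, Equiv.Perm.mul_apply, hb, ha]
      inv_mem' := by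
        intro a ha l
        rw [ha (treeAction v a⁻¹ l), ← Equiv.Perm.mul_apply, ← map_mul, mul_inv_cancel, map_one,
          Equiv.Perm.one_apply] }
  refine mem_of_gen_mem H (fun u l => ?_) g l
  by_cases hu : u = v
  · subst hu
    rw [treeAction_gen_self]
    refine ⟨isLetter_of_mem_consCancel (isLetter_gen _), fun h => ?_⟩
    have := isLetter_of_mem_consCancel (isLetter_gen u).inv h
    change ∀ b ∈ consCancel _ (consCancel _ l.1), _ at this
    rwa [consCancel_inv_consCancel _ l.2] at this
  · have hu' : (gen u : GraphGroup Γ Q) ∈ par {v}ᶜ := gen_mem_par (by simpa using hu)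
    rw [treeAction_gen_of_ne hu]
    refine ⟨isLetter_of_mem_conjWord hu', fun h => ?_⟩
    have := isLetter_of_mem_conjWord (Subgroup.inv_mem _ hu') h
    rw [conjPerm_apply, conjWord_conjWord] at this
    simpa using this

/-- The empty word, the base point of the tree. -/
def rootWord {G : Type*} [Group G] : ReducedWord G := ⟨[], List.IsChain.nil⟩

/-- The image of the base point of the tree dual to `v` under `g`, as a reduced word. -/
noncomputable def word (v : V) (g : GraphGroup Γ Q) : List (GraphGroup Γ Q) :=
  (treeAction v g rootWord).1

theorem isReducedWord_word (v : V) (g : GraphGroup Γ Q) : IsReducedWord (word v g) :=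
  (treeAction v g rootWord).2

theorem prod_word_mul (v : V) (g : GraphGroup Γ Q) : (word v g).prod * retr {v}ᶜ g = g := by
  have h := prod_treeAction_mul v g rootWord
  rwa [show (rootWord : ReducedWord (GraphGroup Γ Q)).1.prod = 1 from rfl, mul_one] at h

theorem isLetter_of_mem_word {v : V} {g a : GraphGroup Γ Q} (h : a ∈ word v g) : IsLetter v a :=
  (isLetter_of_mem_treeAction v g rootWord).1 (by simp [rootWord]) a h

/-- The action of a product of letters cancels inverse letters. -/
theorem exists_treeAction_prod_eq {v : V} {l : List (GraphGroup Γ Q)}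
    (hl : ∀ b ∈ l, IsLetter v b) (hr : IsReducedWord l) (u : ReducedWord (GraphGroup Γ Q)) :
    ∃ a b c, l = a ++ b ∧ u.1 = invWord b ++ c ∧ (treeAction v l.prod u).1 = a ++ c := by
  induction l with
  | nil => exact ⟨[], [], u.1, by simp, by simp, by simp⟩
  | cons x l ih =>
    obtain ⟨a, b, c, rfl, h2, h3⟩ := ih (fun b hb => hl b (List.mem_cons_of_mem _ hb)) hr.tail
    have h4 : (treeAction v (x :: (a ++ b)).prod u).1 = consCancel x (a ++ c) := by
      rw [List.prod_cons, map_mul, Equiv.Perm.mul_apply, treeAction_of_isLetter (hl x (by simp))]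
      change consCancel x _ = _
      rw [h3]
    rw [h4]
    rcases a with _ | ⟨y, a⟩
    · rcases c with _ | ⟨z, c⟩
      · exact ⟨[x], b, [], rfl, h2, rfl⟩
      · by_cases hxz : x * z = 1
        · refine ⟨[], x :: b, c, rfl, ?_, by simp [consCancel, hxz]⟩
          rw [h2, invWord_cons, List.append_assoc, inv_eq_of_mul_eq_one_right hxz]
          rfl
        · exact ⟨[x], b, z :: c, rfl, h2, by simp [consCancel, hxz]⟩
    · have : x * y ≠ 1 := (List.isChain_cons_cons.1 hr).1
      exact ⟨x :: y :: a, b, c, rfl, h2, by simp [consCancel, this]⟩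

/-- Every reduced word of letters is the word of a vertex of the tree. -/
theorem word_prod_mul {v : V} {l : List (GraphGroup Γ Q)} (hl : ∀ b ∈ l, IsLetter v b)
    (hr : IsReducedWord l) {p : GraphGroup Γ Q} (hp : p ∈ par {v}ᶜ) :
    word v (l.prod * p) = l := by
  unfold word
  rw [map_mul, Equiv.Perm.mul_apply, treeAction_of_mem_par hp]
  have h1 : conjPerm p (rootWord : ReducedWord (GraphGroup Γ Q)) = rootWord := rfl
  rw [h1]
  obtain ⟨a, b, c, h2, h3, h4⟩ := exists_treeAction_prod_eq hl hr rootWord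
  have h5 := (List.append_eq_nil_iff.1 h3.symm)
  have h6 : b = [] := by
    by_contra hb
    exact invWord_ne_nil hb h5.1
  rw [h4, h5.2, h2, h6]

/-- The word of a product is obtained from the words of the factors by cancellation. -/
theorem exists_word_mul (v : V) (g h : GraphGroup Γ Q) :
    ∃ a b c, word v g = a ++ b ∧ conjWord (retr {v}ᶜ g) (word v h) = invWord b ++ c ∧
      word v (g * h) = a ++ c := by
  obtain ⟨a, b, c, h1, h2, h3⟩ := exists_treeAction_prod_eq
    (fun _ => isLetter_of_mem_word) (isReducedWord_word v g)
    (conjPerm (retr {v}ᶜ g) (treeAction v h rootWord))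
  refine ⟨a, b, c, h1, h2, ?_⟩
  rw [← h3, ← treeAction_of_mem_par (retr_mem_par _ _), ← Equiv.Perm.mul_apply, ← map_mul,
    prod_word_mul, ← Equiv.Perm.mul_apply, ← map_mul]
  rfl

theorem word_eq_nil_iff {v : V} {g : GraphGroup Γ Q} : word v g = [] ↔ g ∈ par {v}ᶜ := by
  constructor
  · intro h
    have := prod_word_mul v g
    rw [h, List.prod_nil, one_mul] at this
    exact this
  · intro h
    simpa using word_prod_mul (l := []) (by simp) List.IsChain.nil h

theorem word_inv (v : V) (g : GraphGroup Γ Q) :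
    word v g⁻¹ = conjWord (retr {v}ᶜ g)⁻¹ (invWord (word v g)) := by
  have hp : (retr {v}ᶜ g)⁻¹ ∈ (par {v}ᶜ : Subgroup (GraphGroup Γ Q)) :=
    Subgroup.inv_mem _ (retr_mem_par _ _)
  have h1 : g⁻¹ = (conjWord (retr {v}ᶜ g)⁻¹ (invWord (word v g))).prod * (retr {v}ᶜ g)⁻¹ := by
    rw [prod_conjWord, prod_invWord]
    conv_lhs => rw [← prod_word_mul v g]
    group
  have h2 : ∀ b ∈ conjWord (retr {v}ᶜ g)⁻¹ (invWord (word v g)), IsLetter v b := by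
    refine isLetter_of_mem_conjWord hp fun b hb => ?_
    simp only [invWord, List.mem_reverse, List.mem_map] at hb
    obtain ⟨a, ha, rfl⟩ := hb
    exact (isLetter_of_mem_word ha).inv
  have h3 := word_prod_mul h2 ((isReducedWord_word v g).invWord.conjWord _) hp
  rwa [← h1] at h3

theorem length_word_mul_le (v : V) (g h : GraphGroup Γ Q) :
    (word v (g * h)).length ≤ (word v g).length + (word v h).length := by
  obtain ⟨a, b, c, h1, h2, h3⟩ := exists_word_mul v g h
  have h4 := congrArg List.length h2
  rw [h1, h3]
  simp only [length_conjWord, List.length_append] at h4 ⊢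
  omega

theorem length_word_prod_le {v : V} (l : List (GraphGroup Γ Q))
    (hl : ∀ a ∈ l, IsLetter v a) : (word v l.prod).length ≤ l.length := by
  induction l with
  | nil => simp [word_eq_nil_iff.2 (Subgroup.one_mem _)]
  | cons a l ih =>
    have h1 := ih fun b hb => hl b (List.mem_cons_of_mem _ hb)
    have h2 := length_word_mul_le v a l.prod
    have h3 : word v a = [a] := by
      simpa using word_prod_mul (l := [a]) (by simpa using hl a (by simp))
        (List.isChain_singleton _) (Subgroup.one_mem _)
    rw [h3] at h2
    simp only [List.prod_cons, List.length_cons, List.length_nil] at *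
    omega

/-- Retractions that do not kill `v` do not increase the length in the tree dual to `v`. -/
theorem length_word_retr_le {v : V} {S : Set V} (hv : v ∈ S) (g : GraphGroup Γ Q) :
    (word v (retr S g)).length ≤ (word v g).length := by
  have hS : ∀ y : GraphGroup Γ Q, y ∈ par {v}ᶜ → retr S y ∈ par {v}ᶜ := fun y hy =>
    par_mono Set.inter_subset_right (retr_mem_par_inter (Λ' := S) hy)
  have h1 : retr S g = ((word v g).map (retr S)).prod * retr S (retr {v}ᶜ g) := by
    rw [← map_list_prod, ← map_mul, prod_word_mul]
  have h2 : ∀ a ∈ (word v g).map (retr S), IsLetter v a := by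
    intro a ha
    obtain ⟨b, hb, rfl⟩ := List.mem_map.1 ha
    obtain ⟨y, hy, rfl | rfl⟩ := isLetter_of_mem_word hb
    · exact ⟨_, hS y hy, Or.inl (by simp [retr_gen_of_mem hv])⟩
    · exact ⟨_, hS y hy, Or.inr (by simp [retr_gen_of_mem hv])⟩
  have h3 := length_word_mul_le v ((word v g).map (retr S)).prod (retr S (retr {v}ᶜ g))
  rw [← h1, word_eq_nil_iff.2 (hS _ (retr_mem_par _ _))] at h3
  have h4 := length_word_prod_le _ h2
  simp at h3 h4
  omega

/-- Elements of `P = par {v}ᶜ` act on words by conjugation of the letters. -/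
theorem word_mul_of_mem_left {v : V} {x : GraphGroup Γ Q} (hx : x ∈ par {v}ᶜ)
    (g : GraphGroup Γ Q) : word v (x * g) = conjWord x (word v g) := by
  unfold word
  rw [map_mul, Equiv.Perm.mul_apply, treeAction_of_mem_par hx]
  rfl

theorem word_mul_of_mem_right {v : V} {x : GraphGroup Γ Q} (hx : x ∈ par {v}ᶜ)
    (g : GraphGroup Γ Q) : word v (g * x) = word v g := by
  unfold word
  rw [map_mul, Equiv.Perm.mul_apply, treeAction_of_mem_par hx]
  rfl

/-- An element of `P = par {v}ᶜ` that fixes the vertex `g P` of the tree commutes with the letters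
on the path to that vertex. -/
theorem commute_of_mem_word {v : V} {x g a : GraphGroup Γ Q} (hx : x ∈ par {v}ᶜ)
    (hxg : g⁻¹ * x * g ∈ par {v}ᶜ) (ha : a ∈ word v g) : Commute x a := by
  have h1 : conjWord x (word v g) = word v g := by
    rw [← word_mul_of_mem_left hx, show x * g = g * (g⁻¹ * x * g) by group,
      word_mul_of_mem_right hxg]
  have h2 : x * a * x⁻¹ = a := by
    have := List.map_inj_left.1 (h1.trans (List.map_id _).symm) a ha
    simpa using this
  exact mul_inv_eq_iff_eq_mul.1 h2

/-- Elements that fix both the base point and another vertex fix the first edge between them. -/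
theorem exists_conj_mem_par_neighborSet {v : V} {g : GraphGroup Γ Q} (hg : g ∉ par {v}ᶜ) :
    ∃ y, ∀ x, x ∈ par {v}ᶜ → g⁻¹ * x * g ∈ par {v}ᶜ →
      y⁻¹ * x * y ∈ par (Γ.neighborSet v) := by
  obtain ⟨a, l, h⟩ := List.exists_cons_of_ne_nil (mt word_eq_nil_iff.1 hg)
  have ha : a ∈ word v g := by rw [h]; simp
  obtain ⟨y, hy, hay⟩ := isLetter_of_mem_word ha
  refine ⟨y, fun x hx hxg => ?_⟩
  have hc := commute_of_mem_word hx hxg ha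
  refine mem_par_neighborSet_of_commute
    (Subgroup.mul_mem _ (Subgroup.mul_mem _ (Subgroup.inv_mem _ hy) hx) hy) ?_
  have h1 : Commute x (y * gen v * y⁻¹) := by
    rcases hay with rfl | rfl
    · exact hc
    · have := hc.inv_right
      rwa [show (y * (gen v)⁻¹ * y⁻¹)⁻¹ = y * gen v * y⁻¹ by group] at this
  have h2 := h1.eq
  change y⁻¹ * x * y * gen v = gen v * (y⁻¹ * x * y)
  calc y⁻¹ * x * y * gen v = y⁻¹ * (x * (y * gen v * y⁻¹)) * y := by group
    _ = y⁻¹ * ((y * gen v * y⁻¹) * x) * y := by rw [h2]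
    _ = _ := by group

end GraphGroup

/-! ### Layers of the complement graph -/

section Layer

variable {V : Type*} (Γ : SimpleGraph V) (S : Set V) (v : V)

/-- The vertices at distance more than `k` from `v` in the complement graph, where only paths with
interior in `S` are considered. -/
def layer : ℕ → Set V
  | 0 => {v}ᶜ
  | k + 1 => {u ∈ layer k | ∀ s ∈ S, s ∉ layer k → Γ.Adj s u}

theorem layer_antitone : Antitone (layer Γ S v) :=
  antitone_nat_of_succ_le fun _ _ h => h.1

variable {Γ S v}

/-- A vertex that drops out of the layers at step `k` is the end of a path of length `k` in the
complement graph whose `i`-th vertex drops out at step `i`. -/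
theorem exists_path_of_notMem_layer {k : ℕ} {u : V} (hu : u ∉ layer Γ S v k)
    (hu' : ∀ j < k, u ∈ layer Γ S v j) :
    ∃ f : ℕ → V, f k = u ∧ (∀ i ≤ k, f i ∉ layer Γ S v i) ∧
      (∀ i ≤ k, ∀ j < i, f i ∈ layer Γ S v j) ∧
      ∀ i < k, f i ∈ S ∧ ¬ Γ.Adj (f i) (f (i + 1)) := by
  induction k generalizing u with
  | zero => exact ⟨fun _ => u, rfl, fun i hi => by obtain rfl := Nat.le_zero.1 hi; exact hu,
      fun i hi j hj => by omega, fun i hi => by omega⟩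
  | succ k ih =>
    have h1 : ∃ s ∈ S, s ∉ layer Γ S v k ∧ ¬ Γ.Adj s u := by
      by_contra! h
      exact hu ⟨hu' k k.lt_succ_self, h⟩
    obtain ⟨s, hsS, hs, hsu⟩ := h1
    have h2 : ∀ j < k, s ∈ layer Γ S v j := by
      intro j hj
      by_contra h
      exact hsu ((hu' (j + 1) (by omega)).2 s hsS h)
    obtain ⟨f, hfk, hf1, hf2, hf3⟩ := ih hs h2
    refine ⟨fun i => if i = k + 1 then u else f i, by simp, fun i hi => ?_, fun i hi j hj => ?_,
      fun i hi => ?_⟩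
    · dsimp only
      split_ifs with h
      · exact h ▸ hu
      · exact hf1 i (by omega)
    · dsimp only
      split_ifs with h
      · exact hu' j (by omega)
      · exact hf2 i (by omega) j hj
    · dsimp only
      rw [if_neg (by omega)]
      split_ifs with h
      · obtain rfl : i = k := by omega
        rw [hfk]
        exact ⟨hsS, hsu⟩
      · exact hf3 i (by omega)

/-- A shortest path in the complement graph is an induced opposite path. -/
theorem nonempty_embedding_of_notMem_layer {k : ℕ} {u : V}
    (hu : u ∉ layer Γ S v k) (hu' : ∀ j < k, u ∈ layer Γ S v j) :
    Nonempty (oppositePath k ↪g Γ) := by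
  obtain ⟨f, -, hf1, hf2, hf3⟩ := exists_path_of_notMem_layer hu hu'
  have hinj : ∀ i j : ℕ, i < j → j ≤ k → f i ≠ f j := fun i j hij hj h =>
    hf1 i (by omega) (h ▸ hf2 j hj i hij)
  have hadj : ∀ i j : ℕ, i < j → j ≤ k → (Γ.Adj (f i) (f j) ↔ i + 2 ≤ j) := by
    intro i j hij hj
    constructor
    · intro h
      by_contra h2
      obtain rfl : j = i + 1 := by omega
      exact (hf3 i (by omega)).2 h
    · intro h
      exact (hf2 j hj (i + 1) (by omega)).2 (f i) (hf3 i (by omega)).1 (hf1 i (by omega))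
  refine ⟨⟨⟨fun i => f i, fun i j h => ?_⟩, fun {i j} => ?_⟩⟩
  · by_contra hne
    rcases lt_or_gt_of_ne (fun h => hne (Fin.ext h) : (i : ℕ) ≠ j) with hlt | hlt
    · exact hinj i j hlt (by omega) h
    · exact hinj j i hlt (by omega) h.symm
  · change Γ.Adj (f i) (f j) ↔ (i : ℕ) + 2 ≤ j ∨ (j : ℕ) + 2 ≤ i
    rcases lt_trichotomy (i : ℕ) j with hlt | heq | hlt
    · rw [hadj i j hlt (by omega)]; omega
    · rw [heq]; simp
    · rw [SimpleGraph.adj_comm, hadj j i hlt (by omega)]; omega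

theorem le_oppositePathLength {k : ℕ} (hk : 1 ≤ k) (h : Nonempty (oppositePath k ↪g Γ)) :
    (k : ℕ∞) ≤ oppositePathLength Γ :=
  le_iSup_of_le k (le_iSup_of_le hk (le_iSup_of_le h le_rfl))

theorem oppositePathLength_le_card [Finite V] (Γ : SimpleGraph V) :
    oppositePathLength Γ ≤ (Nat.card V - 1 : ℕ) := by
  refine iSup_le fun m => iSup_le fun _ => iSup_le fun ⟨f⟩ => ?_
  have h1 := Nat.card_le_card_of_injective f f.injective
  rw [Nat.card_fin] at h1
  exact_mod_cast (by omega : m ≤ Nat.card V - 1)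

theorem layer_succ_eq {Δ : ℕ} (hΔ : oppositePathLength Γ ≤ Δ) :
    layer Γ S v (Δ + 1) = layer Γ S v Δ := by
  refine Set.Subset.antisymm (fun u hu => hu.1) fun u hu => ?_
  by_contra h
  have h1 := nonempty_embedding_of_notMem_layer h
    fun j hj => layer_antitone Γ S v (by omega : j ≤ Δ) hu
  have h2 := (le_oppositePathLength (by omega) h1).trans hΔ
  have h3 : Δ + 1 ≤ Δ := by exact_mod_cast h2
  omega

end Layer

/-! ### Fixed points of long segments -/

namespace GraphGroup

variable {V : Type*} {Γ : SimpleGraph V} {Q : Set V} {S : Set V} {v : V} {g : GraphGroup Γ Q}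

/-- An element that fixes `k + 1` consecutive translates by `g` of the base point of the tree dual
to `v` is conjugate to an element supported on `layer Γ S v k`. -/
theorem exists_conj_mem_par_layer (hS : S.Finite)
    (hg : ∀ s ∈ S, ∀ κ, κ⁻¹ * g * κ ∉ par {s}ᶜ) (k : ℕ) :
    ∃ a, ∀ x, (∀ i ≤ k, (g ^ i)⁻¹ * x * g ^ i ∈ par {v}ᶜ) →
      a⁻¹ * x * a ∈ par (layer Γ S v k) := by
  classical
  induction k with
  | zero => exact ⟨1, fun x hx => by simpa [layer] using hx 0 le_rfl⟩
  | succ k ih =>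
    obtain ⟨a, ha⟩ := ih
    set B := layer Γ S v k with hB
    have key : ∀ T : Finset V, (∀ s ∈ T, s ∈ S ∧ s ∉ B) → ∃ b, ∀ x,
        (∀ i ≤ k + 1, (g ^ i)⁻¹ * x * g ^ i ∈ par {v}ᶜ) →
        b⁻¹ * x * b ∈ par {u ∈ B | ∀ s ∈ T, Γ.Adj s u} := by
      intro T
      induction T using Finset.induction_on with
      | empty => exact fun _ => ⟨a, fun x hx => by simpa using ha x fun i hi => hx i (by omega)⟩
      | insert s T _ ihT =>
        intro hT
        obtain ⟨b, hb⟩ := ihT fun t ht => hT t (Finset.mem_insert_of_mem ht)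
        obtain ⟨hsS, hsB⟩ := hT s (Finset.mem_insert_self s T)
        obtain ⟨y, hy⟩ := exists_conj_mem_par_neighborSet (hg s hsS a)
        obtain ⟨c, hc⟩ := exists_conj_mem_par_inter {u ∈ B | ∀ s ∈ T, Γ.Adj s u}
          (Γ.neighborSet s) b (a * y)
        refine ⟨c, fun x hx => ?_⟩
        have hle : (par B : Subgroup (GraphGroup Γ Q)) ≤ par {s}ᶜ :=
          par_mono fun u hu => by rintro rfl; exact hsB hu
        have h1 := ha x fun i hi => hx i (by omega)
        have h2 := ha (g⁻¹ * x * g) fun i hi => by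
          have := hx (i + 1) (by omega)
          rw [pow_succ'] at this
          rwa [show (g ^ i)⁻¹ * (g⁻¹ * x * g) * g ^ i = (g * g ^ i)⁻¹ * x * (g * g ^ i) by group]
        have h3 := hy (a⁻¹ * x * a) (hle h1) (by
          rw [show (a⁻¹ * g * a)⁻¹ * (a⁻¹ * x * a) * (a⁻¹ * g * a) =
            a⁻¹ * (g⁻¹ * x * g) * a by group]
          exact hle h2)
        have h4 := hc x (hb x hx) (by
          rwa [show (a * y)⁻¹ * x * (a * y) = y⁻¹ * (a⁻¹ * x * a) * y by group])
        refine par_mono ?_ h4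
        rintro u ⟨⟨hu1, hu2⟩, hu3⟩
        refine ⟨hu1, fun t ht => ?_⟩
        rcases Finset.mem_insert.1 ht with rfl | ht
        exacts [hu3, hu2 t ht]
    obtain ⟨b, hb⟩ := key (hS.subset (Set.sep_subset S (· ∉ B))).toFinset (fun s hs => by
      simpa using hs)
    refine ⟨b, fun x hx => par_mono ?_ (hb x hx)⟩
    rintro u ⟨hu1, hu2⟩
    exact ⟨hu1, fun s hs hsB => hu2 s (by simpa using ⟨hs, hsB⟩)⟩

/-- If every vertex of `S` outside `Λ` is adjacent to all of `Λ`, then `par S` normalizes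
`par Λ`. -/
theorem conj_mem_par_of_adj {Λ : Set V} (hΛ : ∀ u ∈ Λ, ∀ s ∈ S, s ∉ Λ → Γ.Adj s u)
    {h x : GraphGroup Γ Q} (hh : h ∈ par S) (hx : x ∈ par Λ) : h * x * h⁻¹ ∈ par Λ := by
  have h1 : par S ≤ Subgroup.normalizer ((par Λ : Subgroup (GraphGroup Γ Q)) : Set (GraphGroup Γ Q)) := by
    refine par_le _ fun s hs => ?_
    by_cases hsΛ : s ∈ Λ
    · exact Subgroup.le_normalizer (gen_mem_par hsΛ)
    · have h2 : par Λ ≤ Subgroup.centralizer {(gen s : GraphGroup Γ Q)} :=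
        par_le _ fun u hu => Subgroup.mem_centralizer_singleton_iff.2
          (commute_gen (hΛ u hu s hs hsΛ)).symm.eq
      have h3 : ∀ y ∈ par Λ, gen s * y * (gen s)⁻¹ = y := fun y hy => by
        rw [← Subgroup.mem_centralizer_singleton_iff.1 (h2 hy), mul_inv_cancel_right]
      have h4 : ∀ y ∈ par Λ, (gen s)⁻¹ * y * gen s = y := fun y hy => by
        rw [mul_assoc, Subgroup.mem_centralizer_singleton_iff.1 (h2 hy), inv_mul_cancel_left]
      rw [Subgroup.mem_normalizer_iff]
      refine fun y => ⟨fun hy => by rwa [h3 y hy], fun hy => ?_⟩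
      have h5 := h4 _ hy
      rw [show (gen s)⁻¹ * (gen s * y * (gen s)⁻¹) * gen s = y by group] at h5
      exact h5 ▸ hy
  exact (Subgroup.mem_normalizer_iff.1 (h1 hh) x).1 hx

/-- If `g` cannot be conjugated into a smaller standard parabolic subgroup than `par S`, then the
elements that fix `Δ + 1` consecutive translates of the base point form a standard parabolic
subgroup that is normalized by `par S`. -/
theorem exists_par_eq_fixer (hS : S.Finite) (hgS : g ∈ par S)
    (hg : ∀ s ∈ S, ∀ κ, κ⁻¹ * g * κ ∉ par {s}ᶜ) {Δ : ℕ} (hΔ : oppositePathLength Γ ≤ Δ) :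
    ∃ Λ : Set V, v ∉ Λ ∧ (∀ u ∈ Λ, ∀ s ∈ S, s ∉ Λ → Γ.Adj s u) ∧
      ∀ x, (∀ i ≤ Δ, (g ^ i)⁻¹ * x * g ^ i ∈ par {v}ᶜ) → x ∈ par Λ := by
  obtain ⟨a, ha⟩ := exists_conj_mem_par_layer (v := v) hS hg Δ
  set Λ := layer Γ S v Δ with hΛdef
  have hΛ : ∀ u ∈ Λ, ∀ s ∈ S, s ∉ Λ → Γ.Adj s u := by
    intro u hu
    have := layer_succ_eq (S := S) (v := v) hΔ
    rw [hΛdef, ← this] at hu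
    exact hu.2
  have hvΛ : Λ ⊆ {v}ᶜ := layer_antitone Γ S v (Nat.zero_le Δ)
  refine ⟨Λ, fun h => hvΛ h rfl, hΛ, fun x hx => ?_⟩
  have h1 : ∀ z ∈ par Λ, a⁻¹ * z * a ∈ par Λ := fun z hz => ha z fun i _ => by
    refine par_mono hvΛ ?_
    have := conj_mem_par_of_adj hΛ (Subgroup.inv_mem _ (Subgroup.pow_mem _ hgS i)) hz
    rwa [inv_inv] at this
  have h2 : ∀ z ∈ par Λ, a⁻¹ * z * a = (retr Λ a)⁻¹ * z * retr Λ a := fun z hz => by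
    conv_lhs => rw [← mem_par.1 (h1 z hz)]
    rw [map_mul, map_mul, map_inv, mem_par.1 hz]
  have hy := ha x hx
  have hz : retr Λ a * (a⁻¹ * x * a) * (retr Λ a)⁻¹ ∈ par Λ :=
    Subgroup.mul_mem _ (Subgroup.mul_mem _ (retr_mem_par _ _) hy)
      (Subgroup.inv_mem _ (retr_mem_par _ _))
  have h3 := h2 _ hz
  have h4 : retr Λ a * (a⁻¹ * x * a) * (retr Λ a)⁻¹ = x := by
    have h5 : (retr Λ a)⁻¹ * (retr Λ a * (a⁻¹ * x * a) * (retr Λ a)⁻¹) * retr Λ a =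
      a⁻¹ * x * a := by group
    rw [h5] at h3
    exact mul_left_cancel (mul_right_cancel h3)
  rwa [h4] at hz

end GraphGroup

/-! ### Cyclically reduced elements -/

namespace GraphGroup

open Filter Topology

variable {V : Type*} {Γ : SimpleGraph V} {Q : Set V} {v : V} {g : GraphGroup Γ Q}

theorem word_mul_of_isReducedWord {h : GraphGroup Γ Q}
    (hr : IsReducedWord (word v g ++ conjWord (retr {v}ᶜ g) (word v h))) :
    word v (g * h) = word v g ++ conjWord (retr {v}ᶜ g) (word v h) := by
  have h1 : g * h = (word v g ++ conjWord (retr {v}ᶜ g) (word v h)).prod *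
      (retr {v}ᶜ g * retr {v}ᶜ h) := by
    rw [List.prod_append, prod_conjWord]
    conv_lhs => rw [← prod_word_mul v g, ← prod_word_mul v h]
    group
  rw [h1]
  refine word_prod_mul (fun b hb => ?_) hr
    (Subgroup.mul_mem _ (retr_mem_par _ _) (retr_mem_par _ _))
  rcases List.mem_append.1 hb with hb | hb
  · exact isLetter_of_mem_word hb
  · exact isLetter_of_mem_conjWord (retr_mem_par _ _) (fun _ => isLetter_of_mem_word) _ hb

/-- `g` is cyclically reduced with respect to the tree dual to `v`: there is no cancellation in
`g * g`. -/
def IsCyclicallyReduced (v : V) (g : GraphGroup Γ Q) : Prop :=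
  IsReducedWord (word v g ++ conjWord (retr {v}ᶜ g) (word v g))

namespace IsCyclicallyReduced

theorem word_pow_succ (hg : IsCyclicallyReduced v g) (n : ℕ) :
    word v (g ^ (n + 1)) = word v g ++ conjWord (retr {v}ᶜ g) (word v (g ^ n)) := by
  induction n with
  | zero => simp [word_eq_nil_iff.2 (Subgroup.one_mem _)]
  | succ n ih =>
    rw [pow_succ' g (n + 1)]
    refine word_mul_of_isReducedWord ?_
    have h1 := isReducedWord_word v (g ^ (n + 1))
    have h2 := List.isChain_append.1 hg
    refine List.isChain_append.2 ⟨h2.1, h1.conjWord _, ?_⟩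
    rcases hw : word v g with _ | ⟨a, l⟩
    · simp
    · rw [hw] at h2 ih
      rw [ih]
      exact h2.2.2

theorem word_pow_add (hg : IsCyclicallyReduced v g) (m n : ℕ) :
    word v (g ^ (m + n)) = word v (g ^ m) ++ conjWord (retr {v}ᶜ g ^ m) (word v (g ^ n)) := by
  induction m with
  | zero => simp [word_eq_nil_iff.2 (Subgroup.one_mem _)]
  | succ m ih =>
    rw [add_right_comm, hg.word_pow_succ, ih, hg.word_pow_succ, conjWord_append, conjWord_conjWord,
      pow_succ', List.append_assoc]

theorem length_word_pow (hg : IsCyclicallyReduced v g) (n : ℕ) :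
    (word v (g ^ n)).length = n * (word v g).length := by
  induction n with
  | zero => simp [word_eq_nil_iff.2 (Subgroup.one_mem _)]
  | succ n ih => rw [hg.word_pow_succ, List.length_append, length_conjWord, ih]; ring

/-- `g` translates the path towards `g ^ n` along itself. -/
theorem mul_prod_take (hg : IsCyclicallyReduced v g) {n j : ℕ}
    (hj : j + (word v g).length ≤ n * (word v g).length) :
    g * ((word v (g ^ n)).take j).prod =
      ((word v (g ^ n)).take (j + (word v g).length)).prod * retr {v}ᶜ g := by
  rcases n with _ | n
  · have h1 : j = 0 := by omega
    have h2 : word v g = [] := List.length_eq_zero_iff.1 (by omega)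
    have h3 := prod_word_mul v g
    rw [h2] at h3
    simp only [h1, h2, List.take_zero, List.prod_nil, List.length_nil] at h3 ⊢
    simpa using h3.symm
  · have hl := hg.length_word_pow n
    have h1 : (word v (g ^ (n + 1))).take j = (word v (g ^ n)).take j := by
      rw [hg.word_pow_add n 1, List.take_append_of_le_length]
      rw [hl]
      linarith
    have h2 : (word v (g ^ (n + 1))).take (j + (word v g).length) =
        word v g ++ conjWord (retr {v}ᶜ g) ((word v (g ^ n)).take j) := by
      rw [hg.word_pow_succ, add_comm j, List.take_length_add_append, take_conjWord]
    rw [h1, h2, List.prod_append, prod_conjWord]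
    conv_lhs => arg 1; rw [← prod_word_mul v g]
    group

theorem hasDisjointSubwords (hg : IsCyclicallyReduced v g) (N k : ℕ) :
    HasDisjointSubwords (fun u => ∃ p ∈ (par {v}ᶜ : Subgroup (GraphGroup Γ Q)),
      u = conjWord p (word v (g ^ N))) k (word v (g ^ (N * k))) := by
  induction k with
  | zero => trivial
  | succ k ih =>
    rw [Nat.mul_succ, add_comm (N * k), hg.word_pow_add]
    refine ⟨[], _, _, rfl, ⟨1, Subgroup.one_mem _, by simp⟩, ?_⟩
    refine ih.map fun u => ?_
    rintro ⟨p, hp, rfl⟩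
    exact ⟨_, Subgroup.mul_mem _ (Subgroup.pow_mem _ (retr_mem_par _ _) N) hp,
      conjWord_conjWord _ _ _⟩

end IsCyclicallyReduced

/-- An element that is not cyclically reduced can be shortened without changing its class: either
by a conjugation, or, if it inverts an edge of the tree, because its square is elliptic. -/
theorem exists_length_word_lt (hg : ¬ IsCyclicallyReduced v g) :
    ∃ h, chainClass h = chainClass g ∧ (word v h).length < (word v g).length := by
  set r := retr {v}ᶜ g with hr
  have hgr := prod_word_mul v g
  have h1 : ∃ a ∈ (word v g).getLast?, ∃ b ∈ (word v g).head?, a * (r * b * r⁻¹) = 1 := by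
    by_contra! h
    refine hg (List.isChain_append.2 ⟨isReducedWord_word v g, (isReducedWord_word v g).conjWord _,
      fun a ha b hb => ?_⟩)
    rw [conjWord, List.head?_map] at hb
    obtain ⟨b, hb', rfl⟩ := Option.map_eq_some_iff.1 hb
    exact h a ha b hb'
  obtain ⟨a, ha, b, hb, hab⟩ := h1
  obtain ⟨l, hl⟩ := List.getLast?_eq_some_iff.1 ha
  rcases l with _ | ⟨b', l⟩
  · have : a = b := by simpa [hl] using hb
    subst this
    refine ⟨r, ?_, by rw [word_eq_nil_iff.2 (retr_mem_par _ _), hl]; simp⟩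
    have h2 : g ^ 2 = r ^ 2 := by
      rw [hl] at hgr
      simp only [List.nil_append, List.prod_singleton] at hgr
      rw [← hr] at hgr
      rw [pow_two, pow_two, ← hgr, show a * r * (a * r) = a * (r * a * r⁻¹) * (r * r) by group, hab,
        one_mul]
    have h3 := congrArg chainClass h2
    rw [chainClass_pow, chainClass_pow] at h3
    refine sub_eq_zero.1 (chainClass_eq_zero_of_nsmul two_pos ?_)
    rw [smul_sub, h3, sub_self]
  · have : b' = b := by simpa [hl] using hb
    subst this
    refine ⟨b'⁻¹ * g * b', ?_, ?_⟩
    · have := chainClass_conj g b'⁻¹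
      rwa [inv_inv] at this
    · have h2 : b'⁻¹ * g * b' = l.prod * r := by
        conv_lhs => rw [← hgr, hl]
        rw [← hr, List.cons_append, List.prod_cons, List.prod_append, List.prod_singleton,
          show b'⁻¹ * (b' * (l.prod * a) * r) * b' = l.prod * (a * (r * b' * r⁻¹)) * r by group,
          hab, mul_one]
      rw [h2, word_mul_of_mem_right (retr_mem_par _ _), hl]
      refine (length_word_prod_le l fun c hc => isLetter_of_mem_word (g := g) ?_).trans_lt ?_
      · rw [hl]; simp [hc]
      · simp

/-! ### Counting quasimorphisms on the dual trees -/

/-- `l` contains a translate of `w` by an element of the vertex group `par {v}ᶜ`. -/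
def Occurs (v : V) (w l : List (GraphGroup Γ Q)) : Prop :=
  ∃ x y, ∃ p ∈ (par {v}ᶜ : Subgroup (GraphGroup Γ Q)), l = x ++ (conjWord p w ++ y)

/-- The homogenized count of translates of `w` along the axes in the tree dual to `v`. -/
theorem exists_count_quasimorphism (v : V) {w : List (GraphGroup Γ Q)} (hw : w ≠ []) :
    ∃ ψ : GraphGroup Γ Q → ℝ, IsHomogeneousQuasimorphism ψ 6 ∧
      (∀ g, (∀ n, ¬ Occurs v (invWord w) (word v (g ^ n))) → 0 ≤ ψ g) ∧
      (∀ g, (∀ n, ¬ Occurs v w (word v (g ^ n))) → ψ g ≤ 0) ∧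
      ∀ (g : GraphGroup Γ Q) (N : ℕ), 0 < N → IsCyclicallyReduced v g → w = word v (g ^ N) →
        (∀ n, ¬ Occurs v (invWord w) (word v (g ^ n))) → 1 / N ≤ ψ g := by
  set M : List (GraphGroup Γ Q) → Prop := fun u =>
    ∃ p ∈ (par {v}ᶜ : Subgroup (GraphGroup Γ Q)), u = conjWord p w with hMdef
  have hM : ∀ u, M u → u ≠ [] := by
    rintro _ ⟨p, -, rfl⟩ h
    exact hw (List.length_eq_zero_iff.1 (by simpa using congrArg List.length h))
  have hM' : ∀ u, M (invWord u) → u ≠ [] := by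
    rintro u hu rfl
    exact hM _ hu rfl
  have hmap : ∀ p ∈ (par {v}ᶜ : Subgroup (GraphGroup Γ Q)), ∀ l,
      signedCount M (conjWord p l) = signedCount M l := by
    intro p hp l
    refine signedCount_map hM (MulAut.conj p) ?_ ?_ l
    · rintro _ ⟨q, hq, rfl⟩
      exact ⟨p * q, Subgroup.mul_mem _ hp hq, conjWord_conjWord p q w⟩
    · rintro _ ⟨q, hq, rfl⟩
      refine ⟨p⁻¹ * q, Subgroup.mul_mem _ (Subgroup.inv_mem _ hp) hq, ?_⟩
      rw [← conjWord_conjWord]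
      simp [conjWord]
  obtain ⟨ψ, hψ, hlim⟩ := exists_homogenization (φ := fun g => signedCount M (word v g)) (D := 3)
    (fun g h => by
      obtain ⟨a, b, c, h1, h2, h3⟩ := exists_word_mul v g h
      rw [h3, h1, ← hmap _ (retr_mem_par _ g) (word v h), h2]
      exact abs_signedCount_cancel_le hM a b c)
    (fun g => by
      rw [word_inv, hmap _ (Subgroup.inv_mem _ (retr_mem_par _ g)), signedCount_invWord hM])
  norm_num at hψ
  have hneg : ∀ g : GraphGroup Γ Q, (∀ n, ¬ Occurs v (invWord w) (word v (g ^ n))) → ∀ n,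
      countDisjoint (fun u => M (invWord u)) (word v (g ^ n)) = 0 := by
    intro g hg n
    refine count_eq_zero hM' ?_
    rintro ⟨x, u, y, h, p, hp, hu⟩
    refine hg n ⟨x, y, p, hp, ?_⟩
    rw [h, ← invWord_conjWord, ← hu, invWord_invWord]
  refine ⟨ψ, hψ, fun g hg => ?_, fun g hg => ?_, fun g N hN hcr hgw hg => ?_⟩
  · refine ge_of_tendsto' (hlim g) fun n => div_nonneg ?_ n.cast_nonneg
    rw [signedCount, hneg g hg n]
    simp
  · refine le_of_tendsto' (hlim g) fun n => div_nonpos_of_nonpos_of_nonneg ?_ n.cast_nonneg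
    rw [signedCount, count_eq_zero hM]
    · simp
    · rintro ⟨x, u, y, h, p, hp, rfl⟩
      exact hg n ⟨x, y, p, hp, h⟩
  · have hsub : Tendsto (fun k : ℕ => N * k) atTop atTop :=
      tendsto_id.const_mul_atTop' hN
    refine ge_of_tendsto ((hlim g).comp hsub) ?_
    filter_upwards [eventually_gt_atTop 0] with k hk
    simp only [Function.comp_apply]
    rw [signedCount, hneg g hg]
    have h1 : (k : ℝ) ≤ countDisjoint M (word v (g ^ (N * k))) := by
      have := (hcr.hasDisjointSubwords N k).le_count (by rw [← hgw]; exact hM)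
      rw [← hgw] at this
      exact_mod_cast this
    have hk' : (0 : ℝ) < k := by exact_mod_cast hk
    have hN' : (0 : ℝ) < N := by exact_mod_cast hN
    rw [le_div_iff₀ (by positivity)]
    push_cast
    field_simp
    linarith

end GraphGroup

/-! ### Overlapping axes -/

namespace GraphGroup

variable {V : Type*} {Γ : SimpleGraph V} {Q : Set V} {S : Set V} {v : V} {g : GraphGroup Γ Q}

theorem smul_mk_eq_iff {G : Type*} [Group G] {P : Subgroup G} {x a b : G} :
    x • (a : G ⧸ P) = (b : G ⧸ P) ↔ b⁻¹ * x * a ∈ P := by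
  change ((x * a : G) : G ⧸ P) = _ ↔ _
  rw [eq_comm, QuotientGroup.eq, mul_assoc]

/-- If a translate of `w` occurs along the axis of `g`, then a conjugate of `g` translates the path
`w` along itself. -/
theorem IsCyclicallyReduced.exists_conj_of_occurs (hg : IsCyclicallyReduced v g)
    {w : List (GraphGroup Γ Q)} {n : ℕ} (h : Occurs v w (word v (g ^ n))) :
    ∃ κ, ∀ i, i + (word v g).length ≤ w.length →
      (κ⁻¹ * g * κ) • (((w.take i).prod : GraphGroup Γ Q) : GraphGroup Γ Q ⧸ par {v}ᶜ) =
        ((w.take (i + (word v g).length)).prod : GraphGroup Γ Q) := by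
  obtain ⟨x, y, p, hp, h⟩ := h
  have hlen := hg.length_word_pow n
  rw [h] at hlen
  simp only [List.length_append, length_conjWord] at hlen
  have hV : ∀ i ≤ w.length, ((word v (g ^ n)).take (x.length + i)).prod =
      x.prod * p * (w.take i).prod * p⁻¹ := by
    intro i hi
    rw [h, List.take_length_add_append, List.take_append_of_le_length (by simpa using hi),
      take_conjWord, List.prod_append, prod_conjWord]
    group
  refine ⟨x.prod * p, fun i hi => smul_mk_eq_iff.2 ?_⟩
  have h1 := hg.mul_prod_take (n := n) (j := x.length + i) (by omega)
  rw [add_assoc, hV i (by omega), hV _ hi] at h1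
  have h2 : (w.take (i + (word v g).length)).prod⁻¹ * ((x.prod * p)⁻¹ * g * (x.prod * p)) *
      (w.take i).prod = (x.prod * p * (w.take (i + (word v g).length)).prod)⁻¹ *
      (g * (x.prod * p * (w.take i).prod * p⁻¹)) * p := by group
  rw [h2, h1]
  have h3 : (x.prod * p * (w.take (i + (word v g).length)).prod)⁻¹ *
      (x.prod * p * (w.take (i + (word v g).length)).prod * p⁻¹ * retr {v}ᶜ g) * p =
      p⁻¹ * retr {v}ᶜ g * p := by group
  rw [h3]
  exact Subgroup.mul_mem _ (Subgroup.mul_mem _ (Subgroup.inv_mem _ hp) (retr_mem_par _ _)) hp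

/-- If a translate of the inverse of `w` occurs along the axis of `g`, then a conjugate of `g⁻¹`
translates the path `w` along itself. -/
theorem IsCyclicallyReduced.exists_conj_of_occurs_inv (hg : IsCyclicallyReduced v g)
    {w : List (GraphGroup Γ Q)} {n : ℕ} (h : Occurs v (invWord w) (word v (g ^ n))) :
    ∃ κ, ∀ i, i + (word v g).length ≤ w.length →
      (κ⁻¹ * g⁻¹ * κ) • (((w.take i).prod : GraphGroup Γ Q) : GraphGroup Γ Q ⧸ par {v}ᶜ) =
        ((w.take (i + (word v g).length)).prod : GraphGroup Γ Q) := by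
  obtain ⟨κ, hκ⟩ := hg.exists_conj_of_occurs h
  have hU : ∀ j ≤ w.length, ((invWord w).take (w.length - j)).prod = w.prod⁻¹ * (w.take j).prod := by
    intro j hj
    have h1 : invWord w = invWord (w.drop j) ++ invWord (w.take j) := by
      rw [← invWord_append, List.take_append_drop]
    rw [h1, List.take_append_of_le_length (by simp), List.take_of_length_le (by simp),
      prod_invWord]
    conv_rhs => rw [← List.prod_take_mul_prod_drop w j]
    group
  refine ⟨κ * w.prod⁻¹, fun i hi => ?_⟩
  have h1 := smul_mk_eq_iff.1 (hκ (w.length - (i + (word v g).length)) (by simp; omega))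
  rw [show w.length - (i + (word v g).length) + (word v g).length = w.length - i by omega,
    hU i (by omega), hU _ hi] at h1
  refine smul_mk_eq_iff.2 ?_
  convert Subgroup.inv_mem _ h1 using 1
  group

/-- An element that normalizes `par Λ` is, up to its image in `par Λ`, an element of the
centralizer. -/
theorem commute_retr_inv_mul {Λ : Set V} (hg : ∀ y ∈ par Λ, g⁻¹ * y * g ∈ par Λ)
    {y : GraphGroup Γ Q} (hy : y ∈ par Λ) : Commute y ((retr Λ g)⁻¹ * g) := by
  have ha := retr_mem_par Λ g
  have h1 := mem_par.1 (hg (retr Λ g * y * (retr Λ g)⁻¹)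
    (Subgroup.mul_mem _ (Subgroup.mul_mem _ ha hy) (Subgroup.inv_mem _ ha)))
  simp only [map_mul, map_inv, mem_par.1 ha, mem_par.1 hy] at h1
  have h2 : (retr Λ g)⁻¹ * (retr Λ g * y * (retr Λ g)⁻¹) * retr Λ g = y := by group
  rw [h2] at h1
  change y * ((retr Λ g)⁻¹ * g) = (retr Λ g)⁻¹ * g * y
  conv_rhs => rw [h1]
  group

/-- If the commutator of `g` and `k` lies in `par Λ`, and both normalize this subgroup, then they
commute up to factors in `par Λ`. -/
theorem commute_retr_inv_mul_retr_inv_mul {k : GraphGroup Γ Q} {Λ : Set V}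
    (hg : ∀ y ∈ par Λ, g⁻¹ * y * g ∈ par Λ) (hk : ∀ y ∈ par Λ, k⁻¹ * y * k ∈ par Λ)
    (hz : g⁻¹ * k⁻¹ * g * k ∈ par Λ) : Commute ((retr Λ g)⁻¹ * g) ((retr Λ k)⁻¹ * k) := by
  set a := retr Λ g with ha
  set b := retr Λ k with hb
  have haΛ : a ∈ par Λ := retr_mem_par Λ g
  have hbΛ : b ∈ par Λ := retr_mem_par Λ k
  set g₂ := a⁻¹ * g with hg₂
  set k₂ := b⁻¹ * k with hk₂
  have hcg : ∀ y ∈ par Λ, Commute y g₂ := fun y hy => commute_retr_inv_mul hg hy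
  have hck : ∀ y ∈ par Λ, Commute y k₂ := fun y hy => commute_retr_inv_mul hk hy
  have h1 : g = g₂ * a := by rw [← (hcg a haΛ).eq, hg₂]; group
  have h2 : k = k₂ * b := by rw [← (hck b hbΛ).eq, hk₂]; group
  have h3 : g⁻¹ * k⁻¹ * g * k = (a⁻¹ * b⁻¹ * a * b) * (g₂⁻¹ * k₂⁻¹ * g₂ * k₂) := by
    have e2 := (hcg _ haΛ).eq
    calc g⁻¹ * k⁻¹ * g * k = a⁻¹ * g₂⁻¹ * (b⁻¹ * k₂⁻¹) * (g₂ * a) * (k₂ * b) := by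
          rw [h1, h2]; group
      _ = a⁻¹ * (g₂⁻¹ * b⁻¹) * k₂⁻¹ * (g₂ * a) * (k₂ * b) := by group
      _ = a⁻¹ * (b⁻¹ * g₂⁻¹) * k₂⁻¹ * (a * g₂) * (k₂ * b) := by
          rw [← e2, (hcg _ (Subgroup.inv_mem _ hbΛ)).inv_right.eq]
      _ = a⁻¹ * b⁻¹ * g₂⁻¹ * (k₂⁻¹ * a) * g₂ * (k₂ * b) := by group
      _ = a⁻¹ * b⁻¹ * (g₂⁻¹ * a) * k₂⁻¹ * g₂ * (k₂ * b) := by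
          rw [← (hck _ haΛ).inv_right.eq]; group
      _ = a⁻¹ * b⁻¹ * (a * g₂⁻¹) * k₂⁻¹ * g₂ * (b * k₂) := by
          rw [← (hcg _ haΛ).inv_right.eq, (hck _ hbΛ).eq]
      _ = a⁻¹ * b⁻¹ * a * g₂⁻¹ * k₂⁻¹ * (g₂ * b) * k₂ := by group
      _ = a⁻¹ * b⁻¹ * a * g₂⁻¹ * (k₂⁻¹ * b) * g₂ * k₂ := by
          rw [← (hcg _ hbΛ).eq]; group
      _ = a⁻¹ * b⁻¹ * a * (g₂⁻¹ * b) * k₂⁻¹ * g₂ * k₂ := by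
          rw [← (hck _ hbΛ).inv_right.eq]; group
      _ = _ := by rw [← (hcg _ hbΛ).inv_right.eq]; group
  have h4 : g₂⁻¹ * k₂⁻¹ * g₂ * k₂ ∈ par Λ := by
    have : g₂⁻¹ * k₂⁻¹ * g₂ * k₂ = (a⁻¹ * b⁻¹ * a * b)⁻¹ * (g⁻¹ * k⁻¹ * g * k) := by
      rw [h3]; group
    rw [this]
    exact Subgroup.mul_mem _ (Subgroup.inv_mem _ (Subgroup.mul_mem _ (Subgroup.mul_mem _
      (Subgroup.mul_mem _ (Subgroup.inv_mem _ haΛ) (Subgroup.inv_mem _ hbΛ)) haΛ) hbΛ)) hz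
  have h5 : retr Λ g₂ = 1 := by rw [hg₂, map_mul, map_inv, mem_par.1 haΛ, ← ha, inv_mul_cancel]
  have h6 := mem_par.1 h4
  simp only [map_mul, map_inv, h5] at h6
  have h7 : g₂⁻¹ * k₂⁻¹ * g₂ * k₂ = 1 := by rw [← h6]; group
  change g₂ * k₂ = k₂ * g₂
  calc g₂ * k₂ = k₂ * g₂ * (g₂⁻¹ * k₂⁻¹ * g₂ * k₂) := by group
    _ = _ := by rw [h7, mul_one]

section Overlap

variable {Δ : ℕ}

/-- The translates of the base point by powers of `g` lie on the path towards `g ^ N`. -/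
theorem mk_pow_eq (hcr : IsCyclicallyReduced v g) {N i : ℕ} (hi : i ≤ N) :
    ((g ^ i : GraphGroup Γ Q) : GraphGroup Γ Q ⧸ par {v}ᶜ) =
      (((word v (g ^ N)).take (i * (word v g).length)).prod : GraphGroup Γ Q) := by
  obtain ⟨j, rfl⟩ := Nat.exists_eq_add_of_le hi
  rw [hcr.word_pow_add, ← hcr.length_word_pow, List.take_left, eq_comm, QuotientGroup.eq]
  have : (word v (g ^ i)).prod⁻¹ * g ^ i = retr {v}ᶜ (g ^ i) := by
    rw [inv_mul_eq_iff_eq_mul, prod_word_mul]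
  rw [this]
  exact retr_mem_par _ _

theorem smul_mk_prod_take (hcr : IsCyclicallyReduced v g) {N j : ℕ}
    (hj : j + (word v g).length ≤ N * (word v g).length) :
    g • ((((word v (g ^ N)).take j).prod : GraphGroup Γ Q) : GraphGroup Γ Q ⧸ par {v}ᶜ) =
      (((word v (g ^ N)).take (j + (word v g).length)).prod : GraphGroup Γ Q) := by
  rw [smul_mk_eq_iff, mul_assoc, hcr.mul_prod_take hj, inv_mul_cancel_left]
  exact retr_mem_par _ _

/-- If `k` translates a segment of `Δ + 2` periods of the axis of `g` along itself by at most one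
period, then the class of `g` differs from the class of `k` by elliptic classes and the class of
an element that translates by the difference. -/
theorem exists_chainClass_sub_eq (hS : S.Finite) (hgS : g ∈ par S)
    (hmin : ∀ s ∈ S, ∀ κ, κ⁻¹ * g * κ ∉ par {s}ᶜ) (hΔ : oppositePathLength Γ ≤ Δ)
    (hcr : IsCyclicallyReduced v g) {k : GraphGroup Γ Q} {l : ℕ} (hl : l ≤ (word v g).length)
    (hk : ∀ i, i + l ≤ (Δ + 2) * (word v g).length →
      k • ((((word v (g ^ (Δ + 2))).take i).prod : GraphGroup Γ Q) : GraphGroup Γ Q ⧸ par {v}ᶜ) =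
        (((word v (g ^ (Δ + 2))).take (i + l)).prod : GraphGroup Γ Q)) :
    ∃ p q h : GraphGroup Γ Q, p ∈ par {v}ᶜ ∧ q ∈ par {v}ᶜ ∧ (word v h).length ≤ (word v g).length - l ∧
      chainClass g - chainClass k = chainClass p + chainClass q + chainClass h := by
  obtain ⟨Λ, hvΛ, hΛ, hfix⟩ := exists_par_eq_fixer (v := v) hS hgS hmin hΔ
  set L := (word v g).length with hL
  set U : ℕ → GraphGroup Γ Q := fun i => ((word v (g ^ (Δ + 2))).take i).prod with hU
  have hfix' : ∀ x : GraphGroup Γ Q, (∀ i ≤ Δ, x • ((U (i * L) : GraphGroup Γ Q) : GraphGroup Γ Q ⧸ par {v}ᶜ) =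
      (U (i * L) : GraphGroup Γ Q)) → x ∈ par Λ := by
    refine fun x hx => hfix x fun i hi =>
      (smul_mk_eq_iff (P := (par {v}ᶜ : Subgroup (GraphGroup Γ Q)))).1 ?_
    rw [mk_pow_eq hcr (by omega : i ≤ Δ + 2)]
    exact hx i hi
  have hle : (par Λ : Subgroup (GraphGroup Γ Q)) ≤ par {v}ᶜ :=
    par_mono fun u hu => by rintro rfl; exact hvΛ hu
  have hnorm : ∀ y ∈ par Λ, g⁻¹ * y * g ∈ par Λ := fun y hy => by
    have := conj_mem_par_of_adj hΛ (Subgroup.inv_mem _ hgS) hy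
    rwa [inv_inv] at this
  -- the elements of `par Λ` fix the whole segment
  have hUfix : ∀ y ∈ (par Λ : Subgroup (GraphGroup Γ Q)), ∀ i, y • ((U i : GraphGroup Γ Q) : GraphGroup Γ Q ⧸ par {v}ᶜ) =
      (U i : GraphGroup Γ Q) := by
    intro y hy i
    have h1 : (g ^ (Δ + 2))⁻¹ * y * g ^ (Δ + 2) ∈ par {v}ᶜ := by
      have := conj_mem_par_of_adj hΛ (Subgroup.inv_mem _ (Subgroup.pow_mem _ hgS (Δ + 2))) hy
      rw [inv_inv] at this
      exact hle this
    have h2 : Commute y (U i) := Commute.list_prod_right _ _ fun a ha =>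
      commute_of_mem_word (hle hy) h1 (List.mem_of_mem_take ha)
    rw [smul_mk_eq_iff, mul_assoc, h2.eq, inv_mul_cancel_left]
    exact hle hy
  have hbound : ∀ i ≤ Δ, i * L + L + L ≤ (Δ + 2) * L := fun i hi => by
    have := Nat.mul_le_mul_right L hi
    linarith
  have hg : ∀ i, i + L ≤ (Δ + 2) * L →
      g • ((U i : GraphGroup Γ Q) : GraphGroup Γ Q ⧸ par {v}ᶜ) = (U (i + L) : GraphGroup Γ Q) :=
    fun i hi => smul_mk_prod_take hcr hi
  have hknorm : ∀ y ∈ par Λ, k⁻¹ * y * k ∈ par Λ := by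
    refine fun y hy => hfix' _ fun i hi => ?_
    rw [mul_smul, mul_smul, hk _ (by have := hbound i hi; omega), hUfix y hy, inv_smul_eq_iff,
      hk _ (by have := hbound i hi; omega)]
  have hz : g⁻¹ * k⁻¹ * g * k ∈ par Λ := by
    refine hfix' _ fun i hi => ?_
    have hb := hbound i hi
    rw [mul_smul, mul_smul, mul_smul, inv_smul_eq_iff, inv_smul_eq_iff, hk _ (by omega),
      hg _ (by omega), hg _ (by omega), hk _ (by omega), add_right_comm]
  have hc := commute_retr_inv_mul_retr_inv_mul hnorm hknorm hz
  have hcg := commute_retr_inv_mul hnorm (retr_mem_par Λ g)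
  have hck := commute_retr_inv_mul hknorm (retr_mem_par Λ k)
  refine ⟨retr Λ g, (retr Λ k)⁻¹, ((retr Λ k)⁻¹ * k)⁻¹ * ((retr Λ g)⁻¹ * g),
    hle (retr_mem_par _ _), hle (Subgroup.inv_mem _ (retr_mem_par _ _)), ?_, ?_⟩
  · have h1 : ((retr Λ k)⁻¹ * k)⁻¹ * ((retr Λ g)⁻¹ * g) =
        retr Λ k * (k⁻¹ * g) * (retr Λ g)⁻¹ := by
      have e1 : (retr Λ k)⁻¹ * k = k * (retr Λ k)⁻¹ := by
        have := hck.eq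
        rw [mul_inv_cancel_left] at this
        exact eq_mul_inv_of_mul_eq this.symm
      have e2 : (retr Λ g)⁻¹ * g = g * (retr Λ g)⁻¹ := by
        have := hcg.eq
        rw [mul_inv_cancel_left] at this
        exact eq_mul_inv_of_mul_eq this.symm
      rw [e1, e2]
      group
    rw [h1, word_mul_of_mem_right (hle (Subgroup.inv_mem _ (retr_mem_par _ _))),
      word_mul_of_mem_left (hle (retr_mem_par _ _)), length_conjWord]
    have h2 : ((k⁻¹ * g : GraphGroup Γ Q) : GraphGroup Γ Q ⧸ par {v}ᶜ) =
        (U (L - l) : GraphGroup Γ Q) := by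
      have h3 := hk (L - l) (by have := hbound 0 (Nat.zero_le _); omega)
      have h4 := hg 0 (by have := hbound 0 (Nat.zero_le _); omega)
      rw [show L - l + l = 0 + L by omega] at h3
      have h5 := inv_smul_eq_iff.2 (h4.trans h3.symm)
      rw [← h5]
      change _ = k⁻¹ • g • ((1 : GraphGroup Γ Q) : GraphGroup Γ Q ⧸ par {v}ᶜ)
      rw [← mul_smul]
      change _ = ((k⁻¹ * g * 1 : GraphGroup Γ Q) : GraphGroup Γ Q ⧸ par {v}ᶜ)
      rw [mul_one]
    have h3 := QuotientGroup.eq.1 h2.symm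
    have h4 := word_mul_of_mem_right h3 (U (L - l))
    rw [mul_inv_cancel_left] at h4
    rw [h4]
    refine (length_word_prod_le _ fun a ha =>
      isLetter_of_mem_word (List.mem_of_mem_take ha)).trans ?_
    exact List.length_take_le _ _
  · have h1 := chainClass_mul hcg
    have h2 := chainClass_mul hck
    rw [mul_inv_cancel_left] at h1 h2
    rw [chainClass_mul hc.symm.inv_left, chainClass_inv, chainClass_inv, h1, h2]
    abel

end Overlap

end GraphGroup

/-! ### The lower bound for the spectral gap -/

namespace GraphGroup

variable {V : Type*} {Γ : SimpleGraph V} {Q : Set V} {Δ : ℕ}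

/-- Every element is conjugate into a smallest standard parabolic subgroup. -/
theorem exists_minimal_par (g : GraphGroup Γ Q) : ∃ S : Finset V,
    (∃ κ, κ⁻¹ * g * κ ∈ par (S : Set V)) ∧ ∀ s ∈ S, ∀ κ, κ⁻¹ * g * κ ∉ par {s}ᶜ := by
  classical
  have hex : ∃ n, ∃ S : Finset V, S.card = n ∧ ∃ κ, κ⁻¹ * g * κ ∈ par (S : Set V) := by
    obtain ⟨S, hS⟩ := exists_finset_mem_par g
    exact ⟨_, S, rfl, 1, by simpa using hS⟩
  obtain ⟨S, hcard, κ, hκ⟩ := Nat.find_spec hex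
  refine ⟨S, ⟨κ, hκ⟩, fun s hs κ' hκ' => ?_⟩
  obtain ⟨c, hc⟩ := exists_conj_mem_par_inter (S : Set V) {s}ᶜ κ κ'
  have hlt := Finset.card_erase_lt_of_mem hs
  refine Nat.find_min hex (m := (S.erase s).card) (by omega) ⟨_, rfl, c, ?_⟩
  convert hc g hκ hκ' using 2
  ext; simp [and_comm]

/-- An element with a conjugate in `par S` is conjugate to its own image under the retraction. -/
theorem isConj_retr {S : Set V} {g κ : GraphGroup Γ Q} (h : κ⁻¹ * g * κ ∈ par S) :
    IsConj g (retr S g) := by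
  have h1 : retr S g = retr S κ * (κ⁻¹ * g * κ) * (retr S κ)⁻¹ := by
    conv_rhs => rw [← mem_par.1 h]
    simp only [map_mul, map_inv]
    group
  refine isConj_iff.2 ⟨retr S κ * κ⁻¹, ?_⟩
  rw [h1]
  group

/-- A chain is either detected by a counting quasimorphism on the tree dual to `v`, or equivalent
to a chain in the vertex group `par {v}ᶜ`. -/
theorem exists_quasimorphism_or_exists_chain_par (hΔ : oppositePathLength Γ ≤ Δ) (v : V)
    (c : List (GraphGroup Γ Q)) :
    (∃ ψ : GraphGroup Γ Q → ℝ, IsHomogeneousQuasimorphism ψ 6 ∧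
      1 / ((Δ + 2 : ℕ) : ℝ) ≤ (c.map ψ).sum) ∨
    ∃ c' : List (GraphGroup Γ Q), (∀ g ∈ c', g ∈ par {v}ᶜ) ∧
      (c.map chainClass).sum = (c'.map chainClass).sum := by
  classical
  set len : GraphGroup Γ Q → ℕ := fun g => (word v g).length with hlen
  have hlen0 : ∀ g, len g = 0 ↔ g ∈ par {v}ᶜ := fun g => by
    rw [hlen, ← word_eq_nil_iff, List.length_eq_zero_iff]
  have hex : ∃ n, ∃ d : List (GraphGroup Γ Q),
      (c.map chainClass).sum = (d.map chainClass).sum ∧ (d.map len).sum = n := ⟨_, c, rfl, rfl⟩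
  obtain ⟨c₀, hc₀, hn⟩ := Nat.find_spec hex
  have hmin : ∀ d : List (GraphGroup Γ Q), (c₀.map chainClass).sum = (d.map chainClass).sum →
      (c₀.map len).sum ≤ (d.map len).sum := fun d hd => by
    rw [hn]
    exact Nat.find_min' hex ⟨d, hc₀.trans hd, rfl⟩
  by_cases hP : ∀ g ∈ c₀, g ∈ par {v}ᶜ
  · exact Or.inr ⟨c₀, hP, hc₀⟩
  left
  push Not at hP
  obtain ⟨g₀, hg₀, hg₀P⟩ := hP
  obtain ⟨g, hgc, hgmax⟩ := c₀.toFinset.exists_max_image len ⟨g₀, by simpa using hg₀⟩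
  rw [List.mem_toFinset] at hgc
  have hgmax : ∀ e ∈ c₀, len e ≤ len g := fun e he => hgmax e (by simpa using he)
  have hgpos : 0 < len g := by
    have := hgmax g₀ hg₀
    have h2 := mt (hlen0 g₀).1 hg₀P
    omega
  -- no term of the chain can be replaced by a shorter element
  have hterm : ∀ e ∈ c₀, ∀ e', chainClass e' = chainClass e → len e ≤ len e' := by
    intro e he e' hee
    have hperm := List.perm_cons_erase he
    have h1 := hmin (e' :: c₀.erase e) (by
      rw [(hperm.map _).sum_eq]
      simp [hee])
    rw [(hperm.map _).sum_eq] at h1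
    simpa using h1
  obtain ⟨S, ⟨κ, hκ⟩, hS⟩ := exists_minimal_par g
  have hconj := isConj_retr hκ
  set g₁ := retr (S : Set V) g with hg₁
  have hclass : chainClass g₁ = chainClass g := (chainClass_eq_of_isConj hconj).symm
  have hvS : v ∈ S := by
    by_contra hv
    have h1 : g₁ ∈ par {v}ᶜ :=
      par_mono (fun u hu => by rintro rfl; exact hv (by simpa using hu)) (retr_mem_par _ g)
    have h2 := hterm g hgc g₁ hclass
    rw [(hlen0 g₁).2 h1] at h2
    omega
  have hleng : len g₁ = len g :=
    le_antisymm (length_word_retr_le (by simpa using hvS) g) (hterm g hgc g₁ hclass)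
  have hS' : ∀ s ∈ (S : Set V), ∀ κ, κ⁻¹ * g₁ * κ ∉ par {s}ᶜ := by
    intro s hs κ' hκ'
    obtain ⟨a, ha⟩ := isConj_iff.1 hconj
    refine hS s (by simpa using hs) (a⁻¹ * κ') ?_
    rw [← ha] at hκ'
    convert hκ' using 1
    group
  set l := c₀.erase g with hl
  have hperm : c₀.Perm (g :: l) := List.perm_cons_erase hgc
  have hc₁ : (c.map chainClass).sum = ((g₁ :: l).map chainClass).sum := by
    rw [hc₀, (hperm.map _).sum_eq]
    simp [hclass]
  have hmem : ∀ e ∈ g₁ :: l, ∃ e' ∈ c₀, chainClass e = chainClass e' ∧ len e = len e' := by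
    intro e he
    rcases List.mem_cons.1 he with rfl | he
    · exact ⟨g, hgc, hclass, hleng⟩
    · exact ⟨e, List.mem_of_mem_erase he, rfl, rfl⟩
  have hcr : ∀ e ∈ g₁ :: l, IsCyclicallyReduced v e := by
    intro e he
    by_contra hne
    obtain ⟨e', he', h1, h2⟩ := hmem e he
    obtain ⟨h, h3, h4⟩ := exists_length_word_lt hne
    have h5 := hterm e' he' h (h3.trans h1)
    rw [← h2] at h5
    simp only [hlen] at h5
    omega
  have hcr₁ := hcr g₁ (by simp)
  set w := word v (g₁ ^ (Δ + 2)) with hw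
  have hwlen : w.length = (Δ + 2) * len g := by rw [hw, hcr₁.length_word_pow, ← hleng]
  have hwpos : 0 < w.length := by rw [hwlen]; positivity
  have hocc : ∀ e ∈ g₁ :: l, ∀ n, ¬ Occurs v (invWord w) (word v (e ^ n)) := by
    intro e he n ho
    have hepos : 0 < len e := by
      obtain ⟨x, y, p, -, h⟩ := ho
      have h1 := congrArg List.length h
      rw [(hcr e he).length_word_pow] at h1
      simp only [List.length_append, length_conjWord, length_invWord] at h1
      by_contra h0
      have : (word v e).length = 0 := by simp only [hlen] at h0; omega
      rw [this] at h1
      omega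
    have hele : len e ≤ len g₁ := by
      obtain ⟨e', he', -, h2⟩ := hmem e he
      rw [h2, hleng]
      exact hgmax e' he'
    obtain ⟨κ, hκ⟩ := (hcr e he).exists_conj_of_occurs_inv ho
    obtain ⟨p, q, h, hp, hq, hh, hsum⟩ := exists_chainClass_sub_eq S.finite_toSet
      (retr_mem_par _ g) hS' hΔ hcr₁ hele fun i hi => hκ i (by rw [hwlen, ← hleng]; exact hi)
    have hkcl : chainClass (κ⁻¹ * e⁻¹ * κ) = -chainClass e := by
      have := chainClass_conj e⁻¹ κ⁻¹
      rw [inv_inv, chainClass_inv] at this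
      exact this
    rw [hkcl, sub_neg_eq_add] at hsum
    change len h ≤ len g₁ - len e at hh
    rcases List.mem_cons.1 he with rfl | hel
    · -- the axis overlaps its own inverse: the class is elliptic
      have hhP : h ∈ par {v}ᶜ := (hlen0 h).1 (by omega)
      have h1 := sum_chainClass_map_congr (retr {v}ᶜ) (l := [g₁, g₁]) (l' := [p, q, h])
        (by simpa [add_assoc] using hsum)
      simp only [List.map_cons, List.map_nil, List.sum_cons, List.sum_nil, mem_par.1 hp,
        mem_par.1 hq, mem_par.1 hhP, add_zero] at h1
      have h2 : chainClass (retr {v}ᶜ g₁) = chainClass g := by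
        rw [← hclass]
        refine sub_eq_zero.1 (chainClass_eq_zero_of_nsmul two_pos ?_)
        rw [smul_sub, two_smul, two_smul, h1, hsum]
        abel
      have h3 := hterm g hgc _ h2
      rw [(hlen0 _).2 (retr_mem_par _ _)] at h3
      omega
    · have hperm₂ : c₀.Perm (g :: e :: l.erase e) :=
        hperm.trans ((List.perm_cons_erase hel).cons g)
      have h1 := hmin (p :: q :: h :: l.erase e) (by
        rw [(hperm₂.map _).sum_eq]
        simp only [List.map_cons, List.sum_cons]
        rw [← hclass, ← add_assoc, hsum]
        abel)
      rw [(hperm₂.map _).sum_eq] at h1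
      simp only [List.map_cons, List.sum_cons, (hlen0 p).2 hp, (hlen0 q).2 hq] at h1
      omega
  obtain ⟨ψ, hψ, hpos, -, hψg⟩ :=
    exists_count_quasimorphism v (List.length_pos_iff.1 hwpos)
  refine ⟨ψ, hψ, ?_⟩
  rw [hψ.sum_congr hc₁, List.map_cons, List.sum_cons]
  have h1 := hψg g₁ (Δ + 2) (by omega) hcr₁ rfl (hocc g₁ (by simp))
  have h2 : 0 ≤ (l.map ψ).sum := List.sum_nonneg fun x hx => by
    obtain ⟨e, he, rfl⟩ := List.mem_map.1 hx
    exact hpos e (hocc e (by simp [he]))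
  linarith

/-- Induction on a finite set of vertices that supports the chain. -/
theorem exists_quasimorphism_or_sum_chainClass_eq_zero (hΔ : oppositePathLength Γ ≤ Δ)
    (c : List (GraphGroup Γ Q)) :
    (∃ ψ : GraphGroup Γ Q → ℝ, IsHomogeneousQuasimorphism ψ 6 ∧
      1 / ((Δ + 2 : ℕ) : ℝ) ≤ (c.map ψ).sum) ∨ (c.map chainClass).sum = 0 := by
  classical
  have key : ∀ (T : Finset V) (d : List (GraphGroup Γ Q)), (∀ g ∈ d, g ∈ par (T : Set V)) →
      (∃ ψ : GraphGroup Γ Q → ℝ, IsHomogeneousQuasimorphism ψ 6 ∧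
        1 / ((Δ + 2 : ℕ) : ℝ) ≤ (d.map ψ).sum) ∨ (d.map chainClass).sum = 0 := by
    intro T
    induction T using Finset.induction_on with
    | empty =>
      refine fun d hd => Or.inr (List.sum_eq_zero fun x hx => ?_)
      obtain ⟨g, hg, rfl⟩ := List.mem_map.1 hx
      have h1 : g = 1 := by
        simpa using par_le (⊥ : Subgroup (GraphGroup Γ Q)) (Λ := ∅) (by simp)
          (by simpa using hd g hg)
      rw [h1, chainClass_one]
    | insert v T _ ih =>
      intro d hd
      rcases exists_quasimorphism_or_exists_chain_par hΔ v d with h | ⟨d', hd', h⟩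
      · exact Or.inl h
      have h1 := sum_chainClass_map_congr (retr ((insert v T : Finset V) : Set V)) h
      have h2 : d.map (retr ((insert v T : Finset V) : Set V)) = d :=
        (List.map_congr_left fun g hg => mem_par.1 (hd g hg)).trans (List.map_id d)
      rw [h2] at h1
      have hpar : ∀ g ∈ d'.map (retr ((insert v T : Finset V) : Set V)), g ∈ par (T : Set V) := by
        intro g hg
        obtain ⟨g', hg', rfl⟩ := List.mem_map.1 hg
        refine par_mono ?_ (retr_mem_par_inter (hd' g' hg'))
        rintro u ⟨hu, hu'⟩
        simpa [show u ≠ v from hu'] using hu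
      rcases ih _ hpar with ⟨ψ, hψ, hle⟩ | h0
      · exact Or.inl ⟨ψ, hψ, by rwa [hψ.sum_congr h1]⟩
      · exact Or.inr (h1.trans h0)
  obtain ⟨T, hT⟩ : ∃ T : Finset V, ∀ g ∈ c, g ∈ par (T : Set V) := by
    induction c with
    | nil => exact ⟨∅, by simp⟩
    | cons a l ih =>
      obtain ⟨T, hT⟩ := ih
      obtain ⟨T', hT'⟩ := exists_finset_mem_par a
      refine ⟨T ∪ T', fun g hg => ?_⟩
      rcases List.mem_cons.1 hg with rfl | hg
      · exact par_mono (by simp) hT'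
      · exact par_mono (by simp) (hT g hg)
  exact key T c hT

/-- The constant is `1 / (2 * 6 * (Δ + 2))`: quasimorphisms of defect `6` with value at least
`1 / (Δ + 2)`. -/
theorem hasChainGap (hΔ : oppositePathLength Γ ≤ Δ) :
    HasChainGap (GraphGroup Γ Q) (1 / (24 + 12 * (Δ : ℝ≥0∞))) := by
  rintro k c ⟨hpos, hlt⟩
  rcases exists_quasimorphism_or_sum_chainClass_eq_zero hΔ (List.ofFn c) with ⟨ψ, hψ, h⟩ | h
  · have h1 := hψ.le_scl (by norm_num) (c := c) (x := 1 / ((Δ + 2 : ℕ) : ℝ)) (by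
      rwa [List.map_ofFn, List.sum_ofFn] at h)
    refine absurd hlt (not_lt.2 (le_trans (le_of_eq ?_) h1))
    have h2 : (24 + 12 * (Δ : ℝ≥0∞)) = ENNReal.ofReal (24 + 12 * (Δ : ℝ)) := by
      rw [ENNReal.ofReal_add (by norm_num) (by positivity), ENNReal.ofReal_mul (by norm_num)]
      simp
    rw [h2, one_div, ← ENNReal.ofReal_inv_of_pos (by positivity)]
    congr 1
    push_cast
    field_simp
    ring
  · exact hpos.ne' (scl_eq_zero_of_sum_chainClass h)

theorem le_optimalChainGap (Γ : SimpleGraph V) (Q : Set V) :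
    1 / (24 + 12 * (oppositePathLength Γ : ℝ≥0∞)) ≤ optimalChainGap (GraphGroup Γ Q) := by
  rcases eq_or_ne (oppositePathLength Γ) ⊤ with h | h
  · simp [h]
  · lift oppositePathLength Γ to ℕ using h with Δ hΔ
    exact le_sSup (hasChainGap hΔ.ge)

end GraphGroup

/-! ### Planar surfaces with small Euler characteristic -/

section Planar

variable {G : Type*} [Group G]

/-- A sphere with four holes whose boundary wraps `n` times around each of four loops. -/
theorem scl_le_of_prod_pow_eq_one (c : Fin 4 → G) {n : ℕ} (hn : 0 < n)
    (h : c 0 ^ n * c 1 ^ n * c 2 ^ n * c 3 ^ n = 1) : scl c ≤ 1 / n := by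
  refine (scl_le_of_component (c := c) ⟨[], [⟨0, n, 1⟩, ⟨1, n, 1⟩, ⟨2, n, 1⟩, ⟨3, n, 1⟩], ?_⟩ n hn
    ?_).trans (le_of_eq ?_)
  · simpa [BoundaryCircle.value, mul_assoc] using h
  · intro j
    fin_cases j <;> simp [SurfaceComponent.windingAt]
  · have h1 := ENNReal.mul_div_mul_left 1 (n : ℝ≥0∞) two_ne_zero ENNReal.ofNat_ne_top
    simpa [SurfaceComponent.negChi] using h1

/-- A sphere with four holes obtained by gluing two copies of a pair of pants along the boundary
circle `g ^ n * h ^ n`, which is conjugate to its inverse. -/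
theorem scl_le_of_conj_eq_inv {g h k : G} {n : ℕ} (hn : 0 < n)
    (hk : k * (g ^ n * h ^ n) * k⁻¹ = (g ^ n * h ^ n)⁻¹) :
    scl ![g, h] ≤ 1 / ((2 * n : ℕ) : ℝ≥0∞) := by
  refine (scl_le_of_component (c := ![g, h])
    ⟨[], [⟨0, n, 1⟩, ⟨1, n, 1⟩, ⟨0, n, k⟩, ⟨1, n, k⟩], ?_⟩ (2 * n) (by omega) ?_).trans
    (le_of_eq ?_)
  · have h1 : (g ^ n * h ^ n) * (k * (g ^ n * h ^ n) * k⁻¹) = 1 := by rw [hk, mul_inv_cancel]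
    simp only [BoundaryCircle.value, List.map_nil, List.prod_nil, List.map_cons, List.prod_cons,
      Matrix.cons_val_zero, Matrix.cons_val_one, zpow_natCast, one_mul, mul_one, inv_one]
    rw [← h1]
    group
  · intro j
    fin_cases j <;> simp [SurfaceComponent.windingAt] <;> ring
  · have h1 := ENNReal.mul_div_mul_left 1 ((2 * n : ℕ) : ℝ≥0∞) two_ne_zero ENNReal.ofNat_ne_top
    rw [← h1]
    simp [SurfaceComponent.negChi]

/-- The square of `s * y` times the inverse square of `y` is the product of `s` and a conjugate of `s`,
which `s` inverts. -/
theorem scl_le_of_involution {s y : G} (hs : s * s = 1) : scl ![s * y, y⁻¹] ≤ 1 / 4 := by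
  have h := scl_le_of_conj_eq_inv (g := s * y) (h := y⁻¹) (k := s) (n := 2) two_pos ?_
  · simpa using h
  · have h1 : s⁻¹ = s := inv_eq_of_mul_eq_one_left hs
    have h2 : (s * y) ^ 2 * y⁻¹ ^ 2 = s * y * s * y⁻¹ := by
      simp only [pow_two]; group
    rw [h2]
    simp only [mul_inv_rev, inv_inv, h1]
    rw [show s * (s * y * s * y⁻¹) * s = (s * s) * y * s * y⁻¹ * s by group, hs]
    group

end Planar

/-! ### Words along a path of generators -/

section Path

variable {G : Type*} [Group G] {a : ℕ → G}

/-- The product `a n * ⋯ * a 1`. -/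
def descProd (a : ℕ → G) : ℕ → G
  | 0 => 1
  | n + 1 => a (n + 1) * descProd a n

/-- `(h * x) ^ n * x ^ (-n)` is the product of the first `n` conjugates of `h` by powers of `x`. -/
theorem mul_pow_mul_inv_pow_congr {h x y : G} {n : ℕ}
    (hxy : ∀ i < n, x ^ i * h * (x ^ i)⁻¹ = y ^ i * h * (y ^ i)⁻¹) :
    (h * x) ^ n * (x ^ n)⁻¹ = (h * y) ^ n * (y ^ n)⁻¹ := by
  induction n with
  | zero => simp
  | succ n ih =>
    have key : ∀ z : G, (h * z) ^ (n + 1) * (z ^ (n + 1))⁻¹ =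
        (h * z) ^ n * (z ^ n)⁻¹ * (z ^ n * h * (z ^ n)⁻¹) := fun z => by
      rw [pow_succ, pow_succ']
      simp only [mul_inv_rev]
      rw [show (h * z) ^ n * (h * z) * ((z ^ n)⁻¹ * z⁻¹) =
        (h * z) ^ n * h * (z * ((z ^ n)⁻¹ * z⁻¹)) by group,
        show z * ((z ^ n)⁻¹ * z⁻¹) = (z ^ n)⁻¹ by
          rw [← mul_inv_rev, ← pow_succ', pow_succ, mul_inv_rev, mul_inv_cancel_left]]
      group
    rw [key, key, ih fun i hi => hxy i (by omega), hxy n (by omega)]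

theorem commute_descProd (hcomm : ∀ i j, i + 2 ≤ j → Commute (a i) (a j))
    {n j : ℕ} (hj : n + 2 ≤ j) : Commute (descProd a n) (a j) := by
  induction n with
  | zero => exact Commute.one_left _
  | succ n ih => exact (hcomm _ _ (by omega)).mul_left (ih (by omega))

/-- Conjugation by `a n * ⋯ * a 1` lowers the indices of the generators that occur by at most one. -/
theorem descProd_conj_mem (hcomm : ∀ i j, i + 2 ≤ j → Commute (a i) (a j))
    {n j : ℕ} {u : G} (hu : u ∈ Subgroup.closure (a '' Set.Ici (j + 1))) :
    descProd a n * u * (descProd a n)⁻¹ ∈ Subgroup.closure (a '' Set.Ici j) := by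
  have hsub : Subgroup.closure (a '' Set.Ici (j + 1)) ≤ Subgroup.closure (a '' Set.Ici j) :=
    Subgroup.closure_mono (Set.image_mono (Set.Ici_subset_Ici.2 (by omega)))
  have hlt : ∀ n < j, descProd a n * u * (descProd a n)⁻¹ = u := by
    intro n hn
    have h1 : Subgroup.closure (a '' Set.Ici (j + 1)) ≤
        Subgroup.centralizer {descProd a n} := by
      rw [Subgroup.closure_le]
      rintro _ ⟨i, hi, rfl⟩
      have hi' : j + 1 ≤ i := hi
      exact Subgroup.mem_centralizer_singleton_iff.2
        (commute_descProd hcomm (by omega)).symm.eq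
    rw [← Subgroup.mem_centralizer_singleton_iff.1 (h1 hu), mul_inv_cancel_right]
  have hstep : ∀ n, j ≤ n + 1 → descProd a n * u * (descProd a n)⁻¹ ∈
      Subgroup.closure (a '' Set.Ici j) → descProd a (n + 1) * u * (descProd a (n + 1))⁻¹ ∈
      Subgroup.closure (a '' Set.Ici j) := by
    intro n hn h
    have ha : a (n + 1) ∈ Subgroup.closure (a '' Set.Ici j) :=
      Subgroup.subset_closure ⟨n + 1, hn, rfl⟩
    have h1 : descProd a (n + 1) * u * (descProd a (n + 1))⁻¹ =
        a (n + 1) * (descProd a n * u * (descProd a n)⁻¹) * (a (n + 1))⁻¹ := by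
      simp only [descProd]; group
    rw [h1]
    exact Subgroup.mul_mem _ (Subgroup.mul_mem _ ha h) (Subgroup.inv_mem _ ha)
  induction n with
  | zero => simpa [descProd] using hsub hu
  | succ n ih =>
    rcases Nat.lt_or_ge (n + 1) j with h | h
    · rw [hlt _ h]; exact hsub hu
    · exact hstep n h ih

/-- The element `t` is seen only by the last of the first `m` conjugates of `a m` by powers of
`a (m - 1) * ⋯ * a 1 * t`. -/
theorem descProd_mul_pow_eq (hcomm : ∀ i j, i + 2 ≤ j → Commute (a i) (a j))
    {t : G} (ht : ∀ i, 2 ≤ i → Commute t (a i)) (m : ℕ) :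
    (a (m + 1) * (descProd a m * t)) ^ (m + 1) * ((descProd a m * t) ^ (m + 1))⁻¹ =
      descProd a (m + 1) ^ (m + 1) * (descProd a m ^ (m + 1))⁻¹ := by
  set x := descProd a m with hx
  have hmem : ∀ i ≤ m, x ^ i * a (m + 1) * (x ^ i)⁻¹ ∈
      Subgroup.closure (a '' Set.Ici (m + 1 - i)) := by
    intro i hi
    induction i with
    | zero =>
      have : a (m + 1) ∈ Subgroup.closure (a '' Set.Ici (m + 1)) :=
        Subgroup.subset_closure ⟨m + 1, Set.mem_Ici.2 le_rfl, rfl⟩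
      simpa using this
    | succ i ih =>
      have h1 := ih (by omega)
      rw [show m + 1 - i = (m + 1 - (i + 1)) + 1 by omega] at h1
      have h2 := descProd_conj_mem hcomm (n := m) h1
      rw [← hx] at h2
      rw [pow_succ']
      convert h2 using 1
      group
  have hcent : Subgroup.closure (a '' Set.Ici 2) ≤ Subgroup.centralizer {t} := by
    rw [Subgroup.closure_le]
    rintro _ ⟨i, hi, rfl⟩
    exact Subgroup.mem_centralizer_singleton_iff.2 (ht i hi).symm.eq
  refine mul_pow_mul_inv_pow_congr fun i hi => ?_
  induction i with
  | zero => simp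
  | succ i ih =>
    have h1 := hmem i (by omega)
    have h2 : x ^ i * a (m + 1) * (x ^ i)⁻¹ ∈ Subgroup.centralizer {t} :=
      hcent (Subgroup.closure_mono (Set.image_mono (Set.Ici_subset_Ici.2 (by omega))) h1)
    have h3 := Subgroup.mem_centralizer_singleton_iff.1 h2
    calc (x * t) ^ (i + 1) * a (m + 1) * ((x * t) ^ (i + 1))⁻¹
        = x * (t * ((x * t) ^ i * a (m + 1) * ((x * t) ^ i)⁻¹)) * t⁻¹ * x⁻¹ := by
          rw [pow_succ']
          generalize (x * t) ^ i = w
          group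
      _ = x * (x ^ i * a (m + 1) * (x ^ i)⁻¹) * x⁻¹ := by
          rw [ih (by omega), ← h3]; group
      _ = _ := by rw [pow_succ' x i]; group

/-- If the generators are involutions, then `descProd a k` and `descProd a (k + 1)` are inverted by
the same element. -/
theorem exists_descProd_conj_eq_inv (hcomm : ∀ i j, i + 2 ≤ j → Commute (a i) (a j))
    (hsq : ∀ i, 1 ≤ i → a i * a i = 1) (k : ℕ) :
    ∃ s, (∀ j, k + 2 ≤ j → Commute s (a j)) ∧ s * descProd a k * s⁻¹ = (descProd a k)⁻¹ ∧
      s * descProd a (k + 1) * s⁻¹ = (descProd a (k + 1))⁻¹ := by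
  induction k with
  | zero =>
    refine ⟨1, fun j _ => Commute.one_left _, by simp [descProd], ?_⟩
    simpa [descProd] using (inv_eq_of_mul_eq_one_left (hsq 1 le_rfl)).symm
  | succ k ih =>
    obtain ⟨s, hs, -, h⟩ := ih
    set x := descProd a (k + 1) with hx
    refine ⟨x⁻¹ * s, fun j hj =>
      (commute_descProd hcomm (by omega)).inv_left.mul_left (hs j (by omega)), ?_, ?_⟩
    · calc x⁻¹ * s * x * (x⁻¹ * s)⁻¹ = x⁻¹ * (s * x * s⁻¹) * x := by group
        _ = _ := by rw [h]; group
    · have h1 := (hs (k + 2) (by omega)).eq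
      have h2 : (a (k + 2))⁻¹ = a (k + 2) :=
        inv_eq_of_mul_eq_one_left (hsq (k + 2) (by omega))
      change x⁻¹ * s * (a (k + 2) * x) * (x⁻¹ * s)⁻¹ = (a (k + 2) * x)⁻¹
      calc x⁻¹ * s * (a (k + 2) * x) * (x⁻¹ * s)⁻¹
          = x⁻¹ * (s * a (k + 2)) * x * s⁻¹ * x := by group
        _ = x⁻¹ * a (k + 2) * (s * x * s⁻¹) * x := by rw [h1]; group
        _ = _ := by rw [h, mul_inv_rev, h2]; group

theorem scl_descProd_artin (hcomm : ∀ i j, i + 2 ≤ j → Commute (a i) (a j))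
    {t : G} (ht : ∀ i, 2 ≤ i → Commute t (a i)) (m : ℕ) :
    scl ![a (m + 1) * (descProd a m * t), (descProd a m * t)⁻¹, descProd a m,
      (descProd a (m + 1))⁻¹] ≤ 1 / ((m + 1 : ℕ) : ℝ≥0∞) := by
  refine scl_le_of_prod_pow_eq_one _ (Nat.succ_pos m) ?_
  have h := descProd_mul_pow_eq hcomm ht m
  change (a (m + 1) * (descProd a m * t)) ^ (m + 1) * (descProd a m * t)⁻¹ ^ (m + 1) *
    descProd a m ^ (m + 1) * (descProd a (m + 1))⁻¹ ^ (m + 1) = 1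
  rw [inv_pow, inv_pow, h]
  group

theorem scl_descProd_coxeter (hcomm : ∀ i j, i + 2 ≤ j → Commute (a i) (a j))
    (hsq : ∀ i, 1 ≤ i → a i * a i = 1) {t : G}
    (ht : ∀ i, 2 ≤ i → Commute t (a i)) (m : ℕ) :
    scl ![a (m + 1) * (descProd a m * t), (descProd a m * t)⁻¹] ≤
      1 / ((2 * (m + 1) : ℕ) : ℝ≥0∞) := by
  obtain ⟨s, -, h1, h2⟩ := exists_descProd_conj_eq_inv hcomm hsq m
  refine scl_le_of_conj_eq_inv (k := descProd a m ^ (m + 1) * s) (Nat.succ_pos m) ?_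
  rw [inv_pow, descProd_mul_pow_eq hcomm ht m]
  set x := descProd a m
  set y := descProd a (m + 1)
  have h3 : s * (y ^ (m + 1) * (x ^ (m + 1))⁻¹) * s⁻¹ = (y ^ (m + 1))⁻¹ * x ^ (m + 1) := by
    have e1 := conj_pow (i := m + 1) (a := s) (b := y)
    have e2 := conj_pow (i := m + 1) (a := s) (b := x)
    rw [h1] at e2
    rw [h2] at e1
    calc s * (y ^ (m + 1) * (x ^ (m + 1))⁻¹) * s⁻¹
        = s * y ^ (m + 1) * s⁻¹ * (s * x ^ (m + 1) * s⁻¹)⁻¹ := by group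
      _ = _ := by rw [← e1, ← e2, inv_pow, inv_pow, inv_inv]
  calc x ^ (m + 1) * s * (y ^ (m + 1) * (x ^ (m + 1))⁻¹) * (x ^ (m + 1) * s)⁻¹
      = x ^ (m + 1) * (s * (y ^ (m + 1) * (x ^ (m + 1))⁻¹) * s⁻¹) * (x ^ (m + 1))⁻¹ := by group
    _ = _ := by rw [h3]; group

end Path

/-! ### Separating an element from its inverse and from other elements -/

namespace GraphGroup

variable {V : Type*} {Γ : SimpleGraph V} {Q : Set V} {v : V} {g : GraphGroup Γ Q}

/-- If the complement graph is connected and `g` has full support, then `g` is detected by a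
quasimorphism that separates it from the elements of the same length that are not conjugate to
it. -/
theorem exists_separating_quasimorphism [Finite V]
    (hconn : ∀ Λ : Set V, v ∉ Λ → (∀ u ∈ Λ, ∀ s ∉ Λ, Γ.Adj s u) → Λ = ∅)
    (hg : ∀ s κ, κ⁻¹ * g * κ ∉ par {s}ᶜ) (hcr : IsCyclicallyReduced v g)
    (hinv : ¬ IsConj g⁻¹ g) :
    ∃ ψ : GraphGroup Γ Q → ℝ, IsHomogeneousQuasimorphism ψ 6 ∧ 0 < ψ g ∧
      (∀ h, IsCyclicallyReduced v h → (word v h).length = (word v g).length → ¬ IsConj h g →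
        ψ h ≤ 0) ∧ ∀ p ∈ par {v}ᶜ, ψ p = 0 := by
  set Δ := Nat.card V - 1
  have hΔ : oppositePathLength Γ ≤ Δ := oppositePathLength_le_card Γ
  obtain ⟨Λ, hvΛ, hΛ, hfix⟩ := exists_par_eq_fixer (v := v) (g := g) Set.finite_univ
    (mem_of_gen_mem _ (fun u => gen_mem_par (Set.mem_univ u)) g) (fun s _ => hg s) hΔ
  obtain rfl := hconn Λ hvΛ fun u hu s hs => hΛ u hu s (Set.mem_univ s) hs
  set w := word v (g ^ (Δ + 2)) with hw
  have hwlen : w.length = (Δ + 2) * (word v g).length := hcr.length_word_pow _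
  have hgpos : 0 < (word v g).length := by
    refine List.length_pos_iff.2 fun h => hg v 1 ?_
    simpa using word_eq_nil_iff.1 h
  have hwpos : 0 < w.length := by rw [hwlen]; positivity
  -- an element that translates the axis like `g` is equal to `g`
  have hunique : ∀ k : GraphGroup Γ Q, (∀ i, i + (word v g).length ≤ w.length →
      k • (((w.take i).prod : GraphGroup Γ Q) : GraphGroup Γ Q ⧸ par {v}ᶜ) =
        ((w.take (i + (word v g).length)).prod : GraphGroup Γ Q)) → k = g := by
    intro k hk
    have h1 : k⁻¹ * g ∈ (par ∅ : Subgroup (GraphGroup Γ Q)) := by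
      refine hfix _ fun i hi => ?_
      refine (smul_mk_eq_iff (P := (par {v}ᶜ : Subgroup (GraphGroup Γ Q)))).1 ?_
      have hb : i * (word v g).length + (word v g).length ≤ (Δ + 2) * (word v g).length := by
        have := Nat.mul_le_mul_right (word v g).length (by omega : i + 1 ≤ Δ + 2)
        linarith
      rw [mk_pow_eq hcr (by omega : i ≤ Δ + 2), mul_smul, inv_smul_eq_iff,
        smul_mk_prod_take hcr hb, hk _ (by rw [hwlen]; exact hb)]
    have h2 : k⁻¹ * g = 1 := by
      simpa using par_le (⊥ : Subgroup (GraphGroup Γ Q)) (Λ := ∅) (by simp) h1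
    exact inv_mul_eq_one.1 h2
  obtain ⟨ψ, hψ, hpos, hneg, hψg⟩ := exists_count_quasimorphism v (List.length_pos_iff.1 hwpos)
  refine ⟨ψ, hψ, ?_, fun h hh hlen hhg => hneg h fun n ho => ?_, fun p hp => ?_⟩
  · refine lt_of_lt_of_le (by positivity)
      (hψg g (Δ + 2) (by omega) hcr rfl fun n ho => hinv ?_)
    obtain ⟨κ, hκ⟩ := hcr.exists_conj_of_occurs_inv ho
    refine isConj_iff.2 ⟨κ⁻¹, ?_⟩
    rw [inv_inv]
    exact hunique _ hκ
  · obtain ⟨κ, hκ⟩ := hh.exists_conj_of_occurs ho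
    rw [hlen] at hκ
    refine hhg (isConj_iff.2 ⟨κ⁻¹, ?_⟩)
    rw [inv_inv]
    exact hunique _ hκ
  · have h0 : ∀ n, word v (p ^ n) = [] := fun n => word_eq_nil_iff.2 (Subgroup.pow_mem _ hp n)
    refine le_antisymm (hneg p fun n => ?_) (hpos p fun n => ?_)
    all_goals
      rintro ⟨x, y, q, -, h⟩
      rw [h0] at h
      have := congrArg List.length h
      simp only [List.length_append, length_conjWord, length_invWord, List.length_nil] at this
      omega

/-! ### Induced subgraphs -/

/-- A chain of small positive stable commutator length in the group of an induced subgraph. -/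
theorem optimalChainGap_le_of_embedding {V₀ : Type*} {Γ₀ : SimpleGraph V₀} {Q₀ : Set V₀}
    (f : Γ₀ ↪g Γ) (hQ : ∀ i, f i ∈ Q ↔ i ∈ Q₀) {k : ℕ} {c : Fin k → GraphGroup Γ₀ Q₀}
    {D : ℝ≥0∞} (hc : 0 < scl c) (hD : scl c ≤ D) : optimalChainGap (GraphGroup Γ Q) ≤ D := by
  classical
  let ι : GraphGroup Γ₀ Q₀ →* GraphGroup Γ Q := lift (fun i => gen (f i))
    (fun i j h => commute_gen (f.map_adj_iff.2 h)) (fun i h => gen_sq ((hQ i).2 h))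
  let r : GraphGroup Γ Q →* GraphGroup Γ₀ Q₀ :=
    lift (fun u => if h : u ∈ Set.range f then gen h.choose else 1)
      (fun u w h => by
        by_cases hu : u ∈ Set.range f
        · by_cases hw : w ∈ Set.range f
          · rw [dif_pos hu, dif_pos hw]
            refine commute_gen (f.map_adj_iff.1 ?_)
            rwa [hu.choose_spec, hw.choose_spec]
          · rw [dif_neg hw]; exact Commute.one_right _
        · rw [dif_neg hu]; exact Commute.one_left _)
      (fun u h => by
        by_cases hu : u ∈ Set.range f
        · rw [dif_pos hu]
          refine gen_sq ((hQ _).1 ?_)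
          rwa [hu.choose_spec]
        · rw [dif_neg hu, one_pow])
  have hr : ∀ x, r (ι x) = x := by
    have : r.comp ι = MonoidHom.id _ := by
      refine hom_ext fun i => ?_
      have hi : f i ∈ Set.range f := ⟨i, rfl⟩
      have h1 : hi.choose = i := f.injective hi.choose_spec
      simp only [ι, r, MonoidHom.comp_apply, lift_gen, dif_pos hi, h1, MonoidHom.id_apply]
    exact fun x => DFunLike.congr_fun this x
  refine sSup_le fun C hC => ?_
  by_contra hlt
  refine hC k (ι ∘ c) ?_
  rw [scl_map_eq_of_leftInverse ι r hr]
  exact ⟨hc, hD.trans_lt (not_le.1 hlt)⟩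

/-! ### Exponent sums -/

open Classical in
/-- The exponent sum of the vertex `s`, with values in the multiples of an element `z` of an abelian
group; `z` has to have order two if `s` has. -/
noncomputable def exponent {A : Type*} [AddCommGroup A] (s : V) (z : A) (hz : z + z = 0 ∨ Q = ∅) :
    GraphGroup Γ Q →* Multiplicative A :=
  lift (fun u => if u = s then Multiplicative.ofAdd z else 1) (fun _ _ _ => Commute.all _ _)
    (fun u hu => by
      rcases hz with hz | hz
      · split_ifs
        · rw [pow_two, ← ofAdd_add, hz, ofAdd_zero]
        · exact one_pow 2
      · simp [hz] at hu)

variable {A : Type*} [AddCommGroup A] {s : V} {z : A} {hz : z + z = 0 ∨ Q = ∅}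

theorem exponent_gen_self : exponent s z hz (gen s : GraphGroup Γ Q) = Multiplicative.ofAdd z := by
  simp [exponent]

theorem exponent_of_mem_par {Λ : Set V} (hs : s ∉ Λ) {x : GraphGroup Γ Q} (hx : x ∈ par Λ) :
    exponent s z hz x = 1 := by
  refine par_le (exponent s z hz).ker (fun u hu => ?_) hx
  have : u ≠ s := by rintro rfl; exact hs hu
  simp [MonoidHom.mem_ker, exponent, this]

theorem exponent_conj (x κ : GraphGroup Γ Q) :
    exponent s z hz (κ * x * κ⁻¹) = exponent s z hz x := by
  rw [map_mul, map_mul, map_inv, mul_comm, ← mul_assoc, inv_mul_cancel, one_mul]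

theorem exponent_eq_of_isConj {x y : GraphGroup Γ Q} (h : IsConj x y) :
    exponent s z hz x = exponent s z hz y := by
  obtain ⟨κ, rfl⟩ := isConj_iff.1 h
  rw [exponent_conj]

theorem conj_notMem_par_of_exponent {x : GraphGroup Γ Q} (hx : exponent s z hz x ≠ 1)
    (κ : GraphGroup Γ Q) : κ⁻¹ * x * κ ∉ par {s}ᶜ := by
  intro h
  have h1 := exponent_of_mem_par (z := z) (hz := hz) (s := s) (by simp) h
  have h2 := exponent_conj (s := s) (z := z) (hz := hz) x κ⁻¹
  rw [inv_inv] at h2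
  exact hx (h2 ▸ h1)

theorem map_descProd_eq {G M : Type*} [Group G] [Group M] {a : ℕ → G} (φ : G →* M) {x : M} {j : ℕ}
    (h : ∀ i, φ (a i) = if i = j then x else 1) (n : ℕ) :
    φ (descProd a n) = if 1 ≤ j ∧ j ≤ n then x else 1 := by
  induction n with
  | zero => rw [if_neg (by omega)]; exact map_one φ
  | succ n ih =>
    rw [descProd, map_mul, ih, h]
    by_cases h1 : n + 1 = j
    · rw [if_pos h1, if_neg (by omega), if_pos (by omega), mul_one]
    · rw [if_neg h1, one_mul]
      congr 1
      exact propext (by omega)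

theorem descProd_mem {G : Type*} [Group G] {a : ℕ → G} {H : Subgroup G} {n : ℕ}
    (h : ∀ i, 1 ≤ i → i ≤ n → a i ∈ H) : descProd a n ∈ H := by
  induction n with
  | zero => exact H.one_mem
  | succ n ih => exact H.mul_mem (h _ (by omega) le_rfl) (ih fun i hi hi' => h i hi (by omega))

/-! ### Chains in the groups of opposite paths -/

/-- The complement graph of an opposite path is connected. -/
theorem oppositePath_eq_empty {m : ℕ} {v : Fin (m + 1)} {Λ : Set (Fin (m + 1))} (hv : v ∉ Λ)
    (hΛ : ∀ u ∈ Λ, ∀ s ∉ Λ, (oppositePath m).Adj s u) : Λ = ∅ := by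
  have hstep : ∀ i (hi : i + 1 < m + 1),
      (⟨i, by omega⟩ : Fin (m + 1)) ∈ Λ ↔ (⟨i + 1, hi⟩ : Fin (m + 1)) ∈ Λ := by
    intro i hi
    constructor
    · intro h
      by_contra h'
      have : i + 1 + 2 ≤ i ∨ i + 2 ≤ i + 1 := hΛ _ h _ h'
      omega
    · intro h
      by_contra h'
      have : i + 2 ≤ i + 1 ∨ i + 1 + 2 ≤ i := hΛ _ h _ h'
      omega
  have hall : ∀ i (hi : i < m + 1),
      (⟨i, hi⟩ : Fin (m + 1)) ∈ Λ ↔ (⟨0, by omega⟩ : Fin (m + 1)) ∈ Λ := by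
    intro i
    induction i with
    | zero => exact fun _ => Iff.rfl
    | succ i ih => exact fun hi => (hstep i hi).symm.trans (ih (by omega))
  ext u
  simp only [Set.mem_empty_iff_false, iff_false]
  exact fun hu => hv ((hall v v.2).2 ((hall u u.2).1 hu))

/-- The generator of the `i`-th vertex of the opposite path `Δ_m`, or `1` if `i > m`. -/
def pathGen (m : ℕ) (Q : Set (Fin (m + 1))) (i : ℕ) : GraphGroup (oppositePath m) Q :=
  if h : i < m + 1 then gen ⟨i, h⟩ else 1

section PathGen

variable {m : ℕ} {Q : Set (Fin (m + 1))}

theorem commute_pathGen (i j : ℕ) (h : i + 2 ≤ j) :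
    Commute (pathGen m Q i) (pathGen m Q j) := by
  unfold pathGen
  split_ifs
  · exact commute_gen (Or.inl h)
  all_goals simp

theorem pathGen_mul_self (i : ℕ) :
    pathGen m Set.univ i * pathGen m Set.univ i = 1 := by
  unfold pathGen
  split_ifs
  · rw [← pow_two, gen_sq (Set.mem_univ _)]
  · rw [one_mul]

theorem pathGen_mem_par {Λ : Set (Fin (m + 1))} {i : ℕ} (h : ∀ u : Fin (m + 1), u = i → u ∈ Λ) :
    pathGen m Q i ∈ par Λ := by
  unfold pathGen
  split_ifs
  · exact gen_mem_par (h _ rfl)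
  · exact Subgroup.one_mem _

theorem exponent_pathGen {A : Type*} [AddCommGroup A] {s : Fin (m + 1)} {z : A}
    {hz : z + z = 0 ∨ Q = ∅} (i : ℕ) :
    exponent s z hz (pathGen m Q i) = if i = s then Multiplicative.ofAdd z else 1 := by
  split_ifs with h
  · subst h
    rw [pathGen, dif_pos s.2, exponent_gen_self]
  · refine exponent_of_mem_par (Λ := {s}ᶜ) (by simp) (pathGen_mem_par fun u hu => ?_)
    rintro rfl
    exact h hu.symm

end PathGen

theorem word_gen_self (v : V) : word v (gen v : GraphGroup Γ Q) = [gen v] := by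
  simpa using word_prod_mul (l := [(gen v : GraphGroup Γ Q)]) (by simpa using isLetter_gen v)
    (List.isChain_singleton _) (Subgroup.one_mem _)

theorem retr_mul_gen_self {e : GraphGroup Γ Q} (he : e ∈ par {v}ᶜ) :
    retr {v}ᶜ (e * gen v) = e := by
  rw [map_mul, mem_par.1 he, retr_gen_of_notMem (by simp), mul_one]

theorem word_mul_gen_self {e : GraphGroup Γ Q} (he : e ∈ par {v}ᶜ) :
    word v (e * gen v) = [e * gen v * e⁻¹] := by
  rw [word_mul_of_mem_left he, word_gen_self]
  rfl

theorem isCyclicallyReduced_mul_gen_self {e : GraphGroup Γ ∅} (he : e ∈ par {v}ᶜ) :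
    IsCyclicallyReduced v (e * gen v) := by
  unfold IsCyclicallyReduced
  rw [word_mul_gen_self he, retr_mul_gen_self he]
  simp only [conjWord_cons, conjWord_nil, List.cons_append, List.nil_append]
  refine List.isChain_cons_cons.2 ⟨fun h => ?_, List.isChain_singleton _⟩
  have h1 := congrArg (exponent v (1 : ℤ) (Or.inr rfl)) h
  rw [map_mul, exponent_conj, exponent_conj, exponent_conj, exponent_gen_self, MonoidHom.map_one] at h1
  exact absurd (congrArg Multiplicative.toAdd h1) (by decide)

/-- The chain `[h * x * t] - [x * t] + [x] - [h * x]` with `t` the first vertex, `h` the last one, and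
`x` the product of the vertices between them.  The first term has full support, and the quasimorphism
of the tree dual to `t` vanishes on the last two. -/
theorem exists_chain_artin {m : ℕ} (hm : 1 ≤ m) :
    ∃ (k : ℕ) (c : Fin k → GraphGroup (oppositePath m) ∅), 0 < scl c ∧ scl c ≤ 1 / (m : ℝ≥0∞) := by
  obtain ⟨m, rfl⟩ := Nat.exists_eq_add_of_le' hm
  set a := pathGen (m + 1) ∅ with ha
  have hcomm : ∀ i j, i + 2 ≤ j → Commute (a i) (a j) := commute_pathGen
  have ha0 : a 0 = gen 0 := by simp [ha, pathGen]
  set x := descProd a m with hx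
  have hmem : ∀ i, 1 ≤ i → a i ∈ par {(0 : Fin (m + 1 + 1))}ᶜ := fun i hi =>
    pathGen_mem_par fun u hu => by
      rintro rfl
      simp only [Fin.val_zero] at hu
      omega
  have hxP : x ∈ par {(0 : Fin (m + 1 + 1))}ᶜ := descProd_mem fun i hi _ => hmem i hi
  have hyP : descProd a (m + 1) ∈ par {(0 : Fin (m + 1 + 1))}ᶜ := descProd_mem fun i hi _ => hmem i hi
  have hg : a (m + 1) * (x * a 0) = descProd a (m + 1) * gen 0 := by
    rw [ha0, ← mul_assoc]; rfl
  have hdesc : ∀ (s : Fin (m + 1 + 1)) (n : ℕ), exponent s (1 : ℤ) (Or.inr rfl) (descProd a n) =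
      if 1 ≤ (s : ℕ) ∧ (s : ℕ) ≤ n then Multiplicative.ofAdd 1 else 1 :=
    fun s n => map_descProd_eq (exponent s (1 : ℤ) (Or.inr rfl)) (fun i => exponent_pathGen i) n
  have hgen0 : ∀ s : Fin (m + 1 + 1), exponent s (1 : ℤ) (Or.inr rfl) (a 0) =
      if 0 = (s : ℕ) then Multiplicative.ofAdd 1 else 1 := fun s => exponent_pathGen 0
  have hexp : ∀ s, exponent s (1 : ℤ) (Or.inr rfl) (descProd a (m + 1) * gen 0) =
      Multiplicative.ofAdd 1 := by
    intro s
    rw [← ha0, map_mul, hdesc, hgen0]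
    rcases Nat.eq_zero_or_pos (s : ℕ) with h | h
    · rw [if_neg (by omega), if_pos h.symm, one_mul]
    · rw [if_pos (by omega), if_neg (by omega), mul_one]
  obtain ⟨ψ, hψ, hpos, hle, hzero⟩ := exists_separating_quasimorphism (v := 0)
    (fun Λ => oppositePath_eq_empty) (fun s κ => conj_notMem_par_of_exponent (by
      rw [hexp s]
      exact fun h => absurd (congrArg Multiplicative.toAdd h) (by simp)) κ)
    (isCyclicallyReduced_mul_gen_self hyP) (fun h => by
      have h1 := exponent_eq_of_isConj (s := 0) (z := (1 : ℤ)) (hz := Or.inr rfl) h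
      rw [map_inv, hexp] at h1
      exact absurd (congrArg Multiplicative.toAdd h1) (by decide))
  have h1 : ψ (x * a 0) ≤ 0 := by
    rw [ha0]
    refine hle _ (isCyclicallyReduced_mul_gen_self hxP)
      (by rw [word_mul_gen_self hxP, word_mul_gen_self hyP]; rfl) fun h => ?_
    have h1 := exponent_eq_of_isConj (s := Fin.last (m + 1)) (z := (1 : ℤ)) (hz := Or.inr rfl) h
    rw [hexp, ← ha0, map_mul, hdesc, hgen0,
      if_neg (by simp), if_neg (by simp)] at h1
    exact absurd (congrArg Multiplicative.toAdd h1) (by simp)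
  refine ⟨4, _, lt_of_lt_of_le ?_ (hψ.le_scl (by norm_num) le_rfl),
    scl_descProd_artin hcomm (fun i hi => hcomm 0 i (by omega)) m⟩
  rw [ENNReal.ofReal_pos]
  refine div_pos ?_ (by norm_num)
  rw [Fin.sum_univ_four]
  simp only [Matrix.cons_val]
  rw [← hx, hψ.map_inv, hψ.map_inv, hzero _ hxP, hzero _ hyP, hg]
  linarith

end GraphGroup

/-! ### Chains in right-angled Coxeter groups -/

/-- An involution in a monoid, as a unit. -/
def involutionUnit {M : Type*} [Monoid M] (x : M) (h : x * x = 1) : Mˣ := ⟨x, x, h, h⟩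

theorem involutionUnit_sq {M : Type*} [Monoid M] (x : M) (h : x * x = 1) :
    involutionUnit x h ^ 2 = 1 := by
  ext
  rw [pow_two]
  exact h

theorem trace_eq_of_isConj {n : ℕ} {x y : (Matrix (Fin n) (Fin n) ℤ)ˣ} (h : IsConj x y) :
    (x : Matrix (Fin n) (Fin n) ℤ).trace = (y : Matrix (Fin n) (Fin n) ℤ).trace := by
  obtain ⟨k, rfl⟩ := isConj_iff.1 h
  exact (Matrix.trace_units_conj k _).symm

namespace GraphGroup

section Rep

/-- The image of the first generator under `pathRep`. -/
def matA : (Matrix (Fin 4) (Fin 4) ℤ)ˣ :=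
  involutionUnit !![1, 0, 0, 0; 0, 1, 0, 0; 0, 0, -1, 0; 0, 0, 0, -1] (by decide)

/-- The image of the second generator under `pathRep`. -/
def matB : (Matrix (Fin 4) (Fin 4) ℤ)ˣ :=
  involutionUnit !![-1, -1, -1, -1; -1, 0, -1, 0; 1, 0, 1, 1; 0, 1, 1, 0] (by decide)

/-- The image of the third generator under `pathRep`. -/
def matC : (Matrix (Fin 4) (Fin 4) ℤ)ˣ :=
  involutionUnit !![1, 0, 0, 0; 0, -1, 0, 0; 0, 0, 1, 0; 0, 0, 0, -1] (by decide)

theorem commute_matA_matC : Commute matA matC := by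
  ext1
  simp [matA, matC, involutionUnit]

theorem trace_mat : ((matB * matA * matB * matC * matB * matA * matC :
    (Matrix (Fin 4) (Fin 4) ℤ)ˣ) : Matrix (Fin 4) (Fin 4) ℤ).trace = 8 := by
  simp [matA, matB, matC, involutionUnit, Matrix.trace, Fin.sum_univ_four]

variable {m : ℕ}

/-- The representation of the Coxeter group of an opposite path on the first three vertices that
kills the other vertices. -/
def pathRep (m : ℕ) : GraphGroup (oppositePath m) Set.univ →* (Matrix (Fin 4) (Fin 4) ℤ)ˣ :=
  lift (fun i => if (i : ℕ) = 0 then matA else if (i : ℕ) = 1 then matB else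
      if (i : ℕ) = 2 then matC else 1)
    (fun i j h => by
      change (i : ℕ) + 2 ≤ j ∨ (j : ℕ) + 2 ≤ i at h
      split_ifs <;> first
        | omega
        | exact Commute.refl _
        | exact Commute.one_left _
        | exact Commute.one_right _
        | exact commute_matA_matC
        | exact commute_matA_matC.symm)
    (fun i _ => by
      split_ifs
      · exact involutionUnit_sq _ _
      · exact involutionUnit_sq _ _
      · exact involutionUnit_sq _ _
      · exact one_pow 2)

theorem pathRep_pathGen (hm : 2 ≤ m) : pathRep m (pathGen m Set.univ 0) = matA ∧
    pathRep m (pathGen m Set.univ 1) = matB ∧ pathRep m (pathGen m Set.univ 2) = matC := by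
  refine ⟨?_, ?_, ?_⟩ <;> rw [pathGen, dif_pos (by omega)] <;> simp [pathRep]

theorem pathRep_of_mem_par {e : GraphGroup (oppositePath m) Set.univ}
    (he : e ∈ par {i : Fin (m + 1) | 3 ≤ (i : ℕ)}) : pathRep m e = 1 := by
  refine par_le (pathRep m).ker (fun u hu => ?_) he
  have hu' : 3 ≤ (u : ℕ) := hu
  rw [MonoidHom.mem_ker, pathRep, lift_gen, if_neg (by omega), if_neg (by omega),
    if_neg (by omega)]

/-- The word `b a b c b a c` in the first three generators `a`, `b`, `c`.  It is the product of `b`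
with an element that is conjugate to its inverse, but it is not conjugate to its own inverse. -/
def pathWord (m : ℕ) : GraphGroup (oppositePath m) Set.univ :=
  pathGen m _ 1 * pathGen m _ 0 * pathGen m _ 1 * pathGen m _ 2 * pathGen m _ 1 * pathGen m _ 0 *
    pathGen m _ 2

theorem word_mul_pathWord (hm : 2 ≤ m) {e : GraphGroup (oppositePath m) Set.univ}
    (he : e ∈ par {i : Fin (m + 1) | 3 ≤ (i : ℕ)}) :
    (word (⟨1, by omega⟩ : Fin (m + 1)) (e * pathWord m)).length = 3 ∧
      IsCyclicallyReduced (⟨1, by omega⟩ : Fin (m + 1)) (e * pathWord m) := by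
  obtain ⟨rA, rB, rC⟩ := pathRep_pathGen hm
  have re := pathRep_of_mem_par he
  set v : Fin (m + 1) := ⟨1, by omega⟩ with hv
  have hA : pathGen m Set.univ 0 ∈ par {v}ᶜ := pathGen_mem_par fun u hu => by
    rintro rfl
    simp [hv] at hu
  have hC : pathGen m Set.univ 2 ∈ par {v}ᶜ := pathGen_mem_par fun u hu => by
    rintro rfl
    simp [hv] at hu
  have hB : pathGen m Set.univ 1 = gen v := by rw [pathGen, dif_pos]
  have heP : e ∈ par {v}ᶜ := par_mono (fun u hu => by
    rintro rfl
    simp [hv] at hu) he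
  have hAC : pathGen m Set.univ 0 * pathGen m Set.univ 2 *
      (pathGen m Set.univ 0 * pathGen m Set.univ 2) = 1 := by
    have h1 := (commute_pathGen (m := m) (Q := Set.univ) 0 2 le_rfl).eq
    rw [mul_assoc, ← mul_assoc (pathGen m Set.univ 2), ← h1, mul_assoc (pathGen m Set.univ 0),
      pathGen_mul_self, mul_one, pathGen_mul_self]
  unfold pathWord
  set A := pathGen m Set.univ 0
  set B := pathGen m Set.univ 1
  set C := pathGen m Set.univ 2
  have hr : retr {v}ᶜ (e * (B * A * B * C * B * A * C)) = e := by
    simp only [map_mul, mem_par.1 heP, mem_par.1 hA, mem_par.1 hC]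
    rw [hB, retr_gen_of_notMem (by simp)]
    simp only [one_mul, mul_one]
    rw [show A * C * A * C = A * C * (A * C) by group, hAC, mul_one]
  have h01 : matB * (matA * matB * matA⁻¹) ≠ 1 := by
    intro h
    have := congrArg (fun u : (Matrix (Fin 4) (Fin 4) ℤ)ˣ => (u : Matrix (Fin 4) (Fin 4) ℤ) 0 0) h
    simp [matA, matB, involutionUnit] at this
  have h12 : matA * matB * matA⁻¹ * (matA * matC * matB * (matA * matC)⁻¹) ≠ 1 := by
    intro h
    have := congrArg (fun u : (Matrix (Fin 4) (Fin 4) ℤ)ˣ => (u : Matrix (Fin 4) (Fin 4) ℤ) 0 0) h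
    simp [matA, matB, matC, involutionUnit] at this
  have h20 : matA * matC * matB * (matA * matC)⁻¹ * matB ≠ 1 := by
    intro h
    have := congrArg (fun u : (Matrix (Fin 4) (Fin 4) ℤ)ˣ => (u : Matrix (Fin 4) (Fin 4) ℤ) 3 3) h
    simp [matA, matB, matC, involutionUnit] at this
  have hne : ∀ x y : GraphGroup (oppositePath m) Set.univ, pathRep m x * pathRep m y ≠ 1 →
      x * y ≠ 1 := by
    intro x y h h'
    rw [← map_mul, h', map_one] at h
    exact h rfl
  set l := [e * B * e⁻¹, e * A * B * (e * A)⁻¹, e * A * C * B * (e * A * C)⁻¹] with hl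
  have hletter : ∀ b ∈ l, IsLetter v b := by
    intro b hb
    rw [hB] at hl
    simp only [hl, List.mem_cons, List.not_mem_nil, or_false] at hb
    rcases hb with rfl | rfl | rfl
    · exact ⟨e, heP, Or.inl rfl⟩
    · exact ⟨e * A, Subgroup.mul_mem _ heP hA, Or.inl rfl⟩
    · exact ⟨e * A * C, Subgroup.mul_mem _ (Subgroup.mul_mem _ heP hA) hC, Or.inl rfl⟩
  have hlong : IsReducedWord (l ++ conjWord e l) := by
    simp only [hl, conjWord_cons, conjWord_nil, List.cons_append, List.nil_append]
    refine List.isChain_cons_cons.2 ⟨hne _ _ ?_, List.isChain_cons_cons.2 ⟨hne _ _ ?_,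
      List.isChain_cons_cons.2 ⟨hne _ _ ?_, List.isChain_cons_cons.2 ⟨hne _ _ ?_,
      List.isChain_cons_cons.2 ⟨hne _ _ ?_, List.isChain_singleton _⟩⟩⟩⟩⟩
    all_goals
      simp only [map_mul, map_inv, re, rA, rB, rC, one_mul, mul_one, inv_one]
      first
        | exact h01
        | exact h12
        | exact h20
  have hword : word v (e * (B * A * B * C * B * A * C)) = l := by
    have h1 : e * (B * A * B * C * B * A * C) = l.prod * e := by
      have h2 : C⁻¹ * A⁻¹ = A * C := by
        rw [← mul_inv_rev]; exact inv_eq_of_mul_eq_one_left hAC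
      have h3 : l.prod * e = e * B * A * B * C * B * (C⁻¹ * A⁻¹) := by
        simp only [hl, List.prod_cons, List.prod_nil]; group
      rw [h3, h2]
      group
    rw [h1]
    exact word_prod_mul hletter (List.isChain_append.1 hlong).1 heP
  refine ⟨by rw [hword]; rfl, ?_⟩
  unfold IsCyclicallyReduced
  rw [hword, hr]
  exact hlong

/-- `e * pathWord m` satisfies the hypotheses of `exists_separating_quasimorphism`: the support on the
first three vertices and the inverse are seen by the traces of `pathRep`, and the remaining support
by the exponents of `e`. -/
theorem exists_quasimorphism_pathWord (hm : 2 ≤ m) {e : GraphGroup (oppositePath m) Set.univ}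
    (he : e ∈ par {i : Fin (m + 1) | 3 ≤ (i : ℕ)})
    (hexp : ∀ s : Fin (m + 1), 3 ≤ (s : ℕ) → exponent s (1 : ZMod 2) (Or.inl (by decide)) e ≠ 1) :
    ∃ ψ : GraphGroup (oppositePath m) Set.univ → ℝ, IsHomogeneousQuasimorphism ψ 6 ∧
      0 < ψ (e * pathWord m) ∧ ∀ e' ∈ par {i : Fin (m + 1) | 3 ≤ (i : ℕ)},
        ¬ IsConj (e' * pathWord m) (e * pathWord m) → ψ (e' * pathWord m) ≤ 0 := by
  obtain ⟨rA, rB, rC⟩ := pathRep_pathGen hm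
  have re := pathRep_of_mem_par he
  have htr : ((pathRep m (e * pathWord m) : (Matrix (Fin 4) (Fin 4) ℤ)ˣ) :
      Matrix (Fin 4) (Fin 4) ℤ).trace = 8 := by
    rw [map_mul, re, one_mul, pathWord]
    simp only [map_mul, rA, rB, rC]
    exact trace_mat
  obtain ⟨hlen, hcr⟩ := word_mul_pathWord hm he
  have hgen : ∀ (s : Fin (m + 1)) (i : ℕ), exponent s (1 : ZMod 2) (Or.inl (by decide))
      (pathGen m Set.univ i) = if i = s then Multiplicative.ofAdd 1 else 1 :=
    fun s i => exponent_pathGen i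
  have hinv : ¬ IsConj (e * pathWord m)⁻¹ (e * pathWord m) := fun h => by
    have h1 := trace_eq_of_isConj ((pathRep m).map_isConj h)
    rw [htr, map_inv, map_mul, re, one_mul, pathWord] at h1
    simp only [map_mul, rA, rB, rC, mul_inv_rev] at h1
    simp [matA, matB, matC, involutionUnit, Matrix.trace, Fin.sum_univ_four] at h1
  have hfull : ∀ s κ, κ⁻¹ * (e * pathWord m) * κ ∉ par {s}ᶜ := by
    intro s κ
    have hretr : ∀ i : ℕ, i ≠ s → retr {s}ᶜ (pathGen m Set.univ i) = pathGen m Set.univ i :=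
      fun i hi => mem_par.1 (pathGen_mem_par fun u hu => by rintro rfl; exact hi hu.symm)
    have hretr' : retr {s}ᶜ (pathGen m Set.univ s) = 1 := by
      rw [pathGen, dif_pos s.2, retr_gen_of_notMem (by simp)]
    have hretre : (s : ℕ) < 3 → retr {s}ᶜ e = e := fun hs => mem_par.1 (par_mono (fun u hu => by
      rintro rfl
      have : 3 ≤ (u : ℕ) := hu
      omega) he)
    -- a conjugate in `par {s}ᶜ` has the same trace as the image under the retraction
    have hcontra : κ⁻¹ * (e * pathWord m) * κ ∈ par {s}ᶜ →
        ((pathRep m (retr {s}ᶜ (e * pathWord m)) : (Matrix (Fin 4) (Fin 4) ℤ)ˣ) :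
          Matrix (Fin 4) (Fin 4) ℤ).trace = 8 := fun h => by
      rw [← htr]
      exact (trace_eq_of_isConj ((pathRep m).map_isConj (isConj_retr h))).symm
    obtain hs | hs | hs | hs : (s : ℕ) = 0 ∨ (s : ℕ) = 1 ∨ (s : ℕ) = 2 ∨ 3 ≤ (s : ℕ) := by omega
    · intro h
      have h1 := hcontra h
      rw [hs] at hretr'
      simp only [map_mul, pathWord, hretre (by omega), hretr', hretr 1 (by omega),
        hretr 2 (by omega), re, rB, rC, one_mul, mul_one] at h1
      simp [matB, matC, involutionUnit, Matrix.trace, Fin.sum_univ_four] at h1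
    · refine conj_notMem_par_of_exponent (z := (1 : ZMod 2)) (hz := Or.inl (by decide)) ?_ κ
      have he1 : exponent s (1 : ZMod 2) (Or.inl (by decide)) e = 1 :=
        exponent_of_mem_par (by simp [hs]) he
      simp only [map_mul, pathWord, he1, hgen, hs]
      decide
    · intro h
      have h1 := hcontra h
      rw [hs] at hretr'
      simp only [map_mul, pathWord, hretre (by omega), hretr', hretr 0 (by omega),
        hretr 1 (by omega), re, rA, rB, one_mul, mul_one] at h1
      simp [matA, matB, involutionUnit, Matrix.trace, Fin.sum_univ_four] at h1
    · refine conj_notMem_par_of_exponent (z := (1 : ZMod 2)) (hz := Or.inl (by decide)) ?_ κ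
      rw [map_mul, pathWord]
      simp only [map_mul, hgen, if_neg (show ¬ (0 : ℕ) = s by omega),
        if_neg (show ¬ (1 : ℕ) = s by omega), if_neg (show ¬ (2 : ℕ) = s by omega), mul_one]
      exact hexp s hs
  obtain ⟨ψ, hψ, hpos, hle, -⟩ := exists_separating_quasimorphism
    (fun Λ => oppositePath_eq_empty) hfull hcr hinv
  exact ⟨ψ, hψ, hpos, fun e' he' h =>
      hle _ (word_mul_pathWord hm he').2 ((word_mul_pathWord hm he').1.trans hlen.symm) h⟩

end Rep

/-- For long opposite paths, the path word is attached to an alternating end of the path. -/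
theorem exists_chain_coxeter {m : ℕ} (hm : 4 ≤ m) :
    ∃ (k : ℕ) (c : Fin k → GraphGroup (oppositePath m) Set.univ),
      0 < scl c ∧ scl c ≤ 1 / (m : ℝ≥0∞) := by
  obtain ⟨n, rfl⟩ : ∃ n, m = n + 4 := ⟨m - 4, by omega⟩
  set a : ℕ → GraphGroup (oppositePath (n + 4)) Set.univ := fun i => pathGen (n + 4) _ (i + 2)
    with ha
  have hcomm : ∀ i j, i + 2 ≤ j → Commute (a i) (a j) := fun i j h =>
    commute_pathGen _ _ (by omega)
  have ht : ∀ i, 2 ≤ i → Commute (pathWord (n + 4)) (a i) := fun i hi =>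
    (((((((commute_pathGen 1 (i + 2) (by omega)).mul_left
      (commute_pathGen 0 (i + 2) (by omega))).mul_left
      (commute_pathGen 1 (i + 2) (by omega))).mul_left
      (commute_pathGen 2 (i + 2) (by omega))).mul_left
      (commute_pathGen 1 (i + 2) (by omega))).mul_left
      (commute_pathGen 0 (i + 2) (by omega))).mul_left
      (commute_pathGen 2 (i + 2) (by omega)))
  have hmem : ∀ k, descProd a k ∈ par {i : Fin (n + 4 + 1) | 3 ≤ (i : ℕ)} := fun k =>
    descProd_mem fun i hi _ => pathGen_mem_par fun u hu => by
      change 3 ≤ (u : ℕ)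
      omega
  have hdesc : ∀ (s : Fin (n + 4 + 1)) (k : ℕ), 3 ≤ (s : ℕ) →
      exponent s (1 : ZMod 2) (Or.inl (by decide)) (descProd a k) =
        if 1 ≤ (s : ℕ) - 2 ∧ (s : ℕ) - 2 ≤ k then Multiplicative.ofAdd 1 else 1 := by
    intro s k hs
    refine map_descProd_eq (exponent s (1 : ZMod 2) (Or.inl (by decide))) (fun i => ?_) k
    rw [ha, exponent_pathGen]
    congr 1
    exact propext (by omega)
  have hg : a (n + 2) * (descProd a (n + 1) * pathWord (n + 4)) =
      descProd a (n + 2) * pathWord (n + 4) := by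
    rw [← mul_assoc]; rfl
  obtain ⟨ψ, hψ, hpos, hle⟩ := exists_quasimorphism_pathWord (by omega : 2 ≤ n + 4)
    (hmem (n + 2)) (fun s hs => by
      rw [hdesc s _ hs, if_pos (by omega)]
      decide)
  have h1 := hle _ (hmem (n + 1)) fun h => by
    have h2 := exponent_eq_of_isConj (s := Fin.last (n + 4)) (z := (1 : ZMod 2))
      (hz := Or.inl (by decide)) h
    rw [map_mul, map_mul, mul_left_inj, hdesc _ _ (by simp), hdesc _ _ (by simp),
      if_neg (by simp), if_pos (by simp)] at h2
    exact absurd h2 (by decide)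
  have hscl := scl_descProd_coxeter hcomm (fun i _ => pathGen_mul_self (i + 2)) ht (n + 1)
  refine ⟨2, _, lt_of_lt_of_le ?_ (hψ.le_scl (by norm_num) le_rfl), hscl.trans ?_⟩
  · rw [ENNReal.ofReal_pos]
    refine div_pos ?_ (by norm_num)
    rw [Fin.sum_univ_two]
    simp only [Matrix.cons_val_zero, Matrix.cons_val_one]
    rw [hψ.map_inv, hg]
    linarith
  · refine ENNReal.div_le_div_left ?_ 1
    exact_mod_cast (by omega : n + 4 ≤ 2 * (n + 1 + 1))

/-- The chain `[b * y] - [y]`, where `b * y` is the path word and `y` is conjugate to its inverse. -/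
theorem exists_chain_coxeter_two :
    ∃ (k : ℕ) (c : Fin k → GraphGroup (oppositePath 2) Set.univ), 0 < scl c ∧ scl c ≤ 1 / 4 := by
  have hsq := fun i => pathGen_mul_self (m := 2) i
  obtain ⟨ψ, hψ, hpos, -⟩ := exists_quasimorphism_pathWord (le_refl 2) (Subgroup.one_mem _)
    (fun s hs => by omega)
  rw [one_mul] at hpos
  set A := pathGen 2 Set.univ 0
  set B := pathGen 2 Set.univ 1
  set C := pathGen 2 Set.univ 2
  set y := A * B * C * B * A * C with hy
  have ht : pathWord 2 = B * y := by
    change B * A * B * C * B * A * C = B * y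
    rw [hy]
    group
  have hψy : ψ y = 0 := by
    have hA : A⁻¹ = A := inv_eq_of_mul_eq_one_left (hsq 0)
    have hB : B⁻¹ = B := inv_eq_of_mul_eq_one_left (hsq 1)
    have hC : C⁻¹ = C := inv_eq_of_mul_eq_one_left (hsq 2)
    have h1 : C * y * C⁻¹ = y⁻¹ := by
      rw [hy, ← mul_assoc, mul_inv_cancel_right]
      simp only [mul_inv_rev, hA, hB, hC, mul_assoc]
    have h2 := hψ.map_conj y C
    rw [h1, hψ.map_inv] at h2
    linarith
  refine ⟨2, _, lt_of_lt_of_le ?_ (hψ.le_scl (by norm_num) le_rfl),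
    scl_le_of_involution (s := B) (y := y) (hsq 1)⟩
  rw [ENNReal.ofReal_pos]
  refine div_pos ?_ (by norm_num)
  rw [Fin.sum_univ_two]
  simp only [Matrix.cons_val_zero, Matrix.cons_val_one]
  rw [hψ.map_inv, hψy, ← ht]
  linarith

/-! ### Three pairwise non-adjacent vertices -/

/-- The chain `[a * b * c] - [b * c]` in the free product of three groups of order two; the product
`a * b * c` is told from its inverse by the trace of a representation. -/
theorem exists_chain_free_product :
    ∃ (k : ℕ) (c : Fin k → GraphGroup (⊥ : SimpleGraph (Fin 3)) Set.univ),
      0 < scl c ∧ scl c ≤ 1 / 4 := by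
  let ρ : GraphGroup (⊥ : SimpleGraph (Fin 3)) Set.univ →* (Matrix (Fin 2) (Fin 2) ℤ)ˣ :=
    lift ![involutionUnit !![-1, -1; 0, 1] (by decide), involutionUnit !![-1, 0; 0, 1] (by decide),
      involutionUnit !![0, -1; -1, 0] (by decide)] (fun _ _ h => h.elim) (fun i _ => by
        fin_cases i <;> exact involutionUnit_sq _ _)
  set A : GraphGroup (⊥ : SimpleGraph (Fin 3)) Set.univ := gen 0
  set B : GraphGroup (⊥ : SimpleGraph (Fin 3)) Set.univ := gen 1
  set C : GraphGroup (⊥ : SimpleGraph (Fin 3)) Set.univ := gen 2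
  have hsq : ∀ i, (gen i : GraphGroup (⊥ : SimpleGraph (Fin 3)) Set.univ) * gen i = 1 := fun i => by
    rw [← pow_two, gen_sq (Set.mem_univ i)]
  have hA : A⁻¹ = A := inv_eq_of_mul_eq_one_left (hsq 0)
  have hB : B⁻¹ = B := inv_eq_of_mul_eq_one_left (hsq 1)
  have hC : C⁻¹ = C := inv_eq_of_mul_eq_one_left (hsq 2)
  have hP : B * C ∈ par {(0 : Fin 3)}ᶜ :=
    Subgroup.mul_mem _ (gen_mem_par (by simp)) (gen_mem_par (by simp))
  have hword : word 0 (A * (B * C)) = [A] := by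
    rw [word_mul_of_mem_right hP, word_gen_self]
  have hretr : retr {0}ᶜ (A * (B * C)) = B * C := by
    rw [map_mul, mem_par.1 hP, retr_gen_of_notMem (by simp), one_mul]
  have hcr : IsCyclicallyReduced 0 (A * (B * C)) := by
    unfold IsCyclicallyReduced
    rw [hword, hretr]
    refine List.isChain_cons_cons.2 ⟨fun h => ?_, List.isChain_singleton _⟩
    have h0 : A * (B * C * A * (B * C)⁻¹) = 1 := h
    rw [mul_inv_rev, hB, hC] at h0
    have h1 := congrArg (fun x => ((ρ x : (Matrix (Fin 2) (Fin 2) ℤ)ˣ) :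
      Matrix (Fin 2) (Fin 2) ℤ) 0 0) h0
    simp [ρ, A, B, C, involutionUnit] at h1
  have hexp : ∀ s : Fin 3, exponent s (1 : ZMod 2) (Or.inl (by decide)) (A * (B * C)) ≠ 1 := by
    intro s
    simp only [map_mul, exponent, lift_gen, A, B, C]
    fin_cases s <;> simp
  have hinv : ¬ IsConj (A * (B * C))⁻¹ (A * (B * C)) := fun h => by
    have h1 := trace_eq_of_isConj (ρ.map_isConj h)
    rw [map_inv] at h1
    simp [ρ, A, B, C, involutionUnit, Matrix.trace, Fin.sum_univ_two] at h1
  have hconn : ∀ Λ : Set (Fin 3), 0 ∉ Λ →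
      (∀ u ∈ Λ, ∀ s ∉ Λ, (⊥ : SimpleGraph (Fin 3)).Adj s u) → Λ = ∅ := fun Λ hv hΛ =>
    Set.eq_empty_of_forall_notMem fun u hu => (hΛ u hu 0 hv).elim
  obtain ⟨ψ, hψ, hpos, -, hzero⟩ := exists_separating_quasimorphism (v := 0)
    hconn
    (fun s => conj_notMem_par_of_exponent (hexp s)) hcr hinv
  refine ⟨2, _, lt_of_lt_of_le ?_ (hψ.le_scl (by norm_num) le_rfl),
    scl_le_of_involution (s := A) (y := B * C) (hsq 0)⟩
  rw [ENNReal.ofReal_pos]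
  refine div_pos ?_ (by norm_num)
  rw [Fin.sum_univ_two]
  simp only [Matrix.cons_val_zero, Matrix.cons_val_one]
  rw [hψ.map_inv, hzero _ hP]
  linarith

end GraphGroup

/-! ### The upper bounds -/

theorem oppositePathLength_oppositePath {m : ℕ} (hm : 1 ≤ m) :
    oppositePathLength (oppositePath m) = m := by
  refine le_antisymm ?_ (le_oppositePathLength hm ⟨SimpleGraph.Embedding.refl⟩)
  simpa using oppositePathLength_le_card (oppositePath m)

/-- An initial segment of an opposite path. -/
def oppositePathEmbedding {m n : ℕ} (h : m ≤ n) : oppositePath m ↪g oppositePath n where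
  toFun := Fin.castLE (by omega)
  inj' := Fin.castLE_injective _
  map_rel_iff' := Iff.rfl

section Upper

variable {V : Type*} {Γ : SimpleGraph V}

theorem exists_embedding_of_le {n : ℕ} (hn : 1 ≤ n) (h : (n : ℕ∞) ≤ oppositePathLength Γ) :
    ∃ m, n ≤ m ∧ Nonempty (oppositePath m ↪g Γ) := by
  have h1 : ((n - 1 : ℕ) : ℕ∞) < oppositePathLength Γ :=
    lt_of_lt_of_le (by exact_mod_cast (by omega : n - 1 < n)) h
  simp only [oppositePathLength, lt_iSup_iff] at h1
  obtain ⟨m, _, hf, hlt⟩ := h1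
  have : n - 1 < m := by exact_mod_cast hlt
  exact ⟨m, by omega, hf⟩

theorem le_one_div_oppositePathLength {x : ℝ≥0∞}
    (h : ∀ n : ℕ, 1 ≤ n → (n : ℕ∞) ≤ oppositePathLength Γ → x ≤ 1 / n) :
    x ≤ 1 / (oppositePathLength Γ : ℝ≥0∞) := by
  rcases eq_or_ne (oppositePathLength Γ) ⊤ with htop | hne
  · rw [htop] at h ⊢
    have h0 : x = 0 := by
      by_contra hx
      obtain ⟨n, hn⟩ := ENNReal.exists_inv_nat_lt hx
      have hn0 : n ≠ 0 := by rintro rfl; simp at hn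
      have := h n (by omega) le_top
      rw [one_div] at this
      exact absurd hn (not_lt.2 this)
    simp [h0]
  · obtain ⟨n, hn⟩ := ENat.ne_top_iff_exists.1 hne
    rw [← hn] at h ⊢
    rcases Nat.eq_zero_or_pos n with rfl | hpos
    · simp
    · exact h n hpos le_rfl

theorem optimalChainGap_artin_le (Γ : SimpleGraph V) :
    optimalChainGap (GraphGroup Γ ∅) ≤ 1 / (oppositePathLength Γ : ℝ≥0∞) := by
  refine le_one_div_oppositePathLength fun n hn hle => ?_
  obtain ⟨m, hnm, ⟨f⟩⟩ := exists_embedding_of_le hn hle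
  obtain ⟨k, c, hc, hcm⟩ := GraphGroup.exists_chain_artin (hn.trans hnm)
  refine GraphGroup.optimalChainGap_le_of_embedding f (by simp) hc (hcm.trans ?_)
  exact ENNReal.div_le_div_left (by exact_mod_cast hnm) 1

theorem optimalChainGap_coxeter_le (Γ : SimpleGraph V)
    (h : oppositePathLength Γ = 1 → ∃ u v w : V, Γᶜ.Adj u v ∧ Γᶜ.Adj v w ∧ Γᶜ.Adj u w) :
    optimalChainGap (GraphGroup Γ Set.univ) ≤ 1 / (oppositePathLength Γ : ℝ≥0∞) := by
  have key : ∀ n : ℕ, 2 ≤ n → (n : ℕ∞) ≤ oppositePathLength Γ →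
      optimalChainGap (GraphGroup Γ Set.univ) ≤ 1 / n := by
    intro n hn hle
    obtain ⟨m, hnm, ⟨f⟩⟩ := exists_embedding_of_le (by omega) hle
    rcases Nat.lt_or_ge m 4 with hm | hm
    · obtain ⟨k, c, hc, hcm⟩ := GraphGroup.exists_chain_coxeter_two
      refine GraphGroup.optimalChainGap_le_of_embedding
        (f.comp (oppositePathEmbedding (hn.trans hnm))) (by simp) hc (hcm.trans ?_)
      exact ENNReal.div_le_div_left (by exact_mod_cast (by omega : n ≤ 4)) 1
    · obtain ⟨k, c, hc, hcm⟩ := GraphGroup.exists_chain_coxeter hm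
      refine GraphGroup.optimalChainGap_le_of_embedding f (by simp) hc (hcm.trans ?_)
      exact ENNReal.div_le_div_left (by exact_mod_cast hnm) 1
  refine le_one_div_oppositePathLength fun n hn hle => ?_
  obtain rfl | hn2 : n = 1 ∨ 2 ≤ n := by omega
  · rcases eq_or_ne (oppositePathLength Γ) 1 with h1 | h1
    · obtain ⟨u, v, w, huv, hvw, huw⟩ := h h1
      obtain ⟨k, c, hc, hc4⟩ := GraphGroup.exists_chain_free_product
      rw [SimpleGraph.compl_adj] at huv hvw huw
      have hadj : ∀ i j : Fin 3, ¬ Γ.Adj (![u, v, w] i) (![u, v, w] j) := by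
        have h10 := mt Γ.adj_symm huv.2
        have h21 := mt Γ.adj_symm hvw.2
        have h20 := mt Γ.adj_symm huw.2
        intro i j
        fin_cases i <;> fin_cases j <;> simp [huv.2, hvw.2, huw.2, h10, h21, h20]
      let f : (⊥ : SimpleGraph (Fin 3)) ↪g Γ :=
        ⟨⟨![u, v, w], fun i j hij => by
          fin_cases i <;> fin_cases j <;>
            simp_all [huv.1.symm, hvw.1.symm, huw.1.symm]⟩,
          fun {i j} => iff_of_false (hadj i j) (by simp)⟩
      refine GraphGroup.optimalChainGap_le_of_embedding f (by simp) hc (hc4.trans ?_)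
      exact ENNReal.div_le_div_left (by norm_num) 1
    · have h2 : ((2 : ℕ) : ℕ∞) ≤ oppositePathLength Γ := by
        have hlt : (1 : ℕ∞) < oppositePathLength Γ := lt_of_le_of_ne (by simpa using hle) h1.symm
        have := Order.add_one_le_of_lt hlt
        rwa [one_add_one_eq_two] at this
      exact (key 2 le_rfl h2).trans (ENNReal.div_le_div_left (by norm_num) 1)
  · exact key n hn2 hle

/-- Chains of small positive stable commutator length in the groups of opposite paths rule out a
uniform gap. -/
theorem not_exists_uniform_gap {Q : ∀ n : ℕ, Set (Fin n)}
    (h : ∀ m : ℕ, 4 ≤ m → ∃ (k : ℕ) (c : Fin k → GraphGroup (oppositePath m) (Q (m + 1))),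
      0 < scl c ∧ scl c ≤ 1 / (m : ℝ≥0∞)) :
    ¬ ∃ C : ℝ≥0∞, 0 < C ∧
      ∀ (n : ℕ) (Γ : SimpleGraph (Fin n)), HasChainGap (GraphGroup Γ (Q n)) C := by
  rintro ⟨C, hC, hgap⟩
  obtain ⟨n, hn⟩ := ENNReal.exists_inv_nat_lt hC.ne'
  obtain ⟨k, c, hc, hcm⟩ := h (n + 4) (by omega)
  refine hgap _ (oppositePath (n + 4)) k c ⟨hc, (hcm.trans ?_).trans_lt hn⟩
  rw [one_div]
  exact ENNReal.inv_le_inv.2 (by exact_mod_cast (by omega : n ≤ n + 4))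

end Upper

theorem theoremA :
    -- right-angled Artin groups
    (∀ (V : Type*) (Γ : SimpleGraph V),
      1 / (24 + 12 * (oppositePathLength Γ : ℝ≥0∞)) ≤ optimalChainGap (RightAngledArtinGroup Γ) ∧
      optimalChainGap (RightAngledArtinGroup Γ) ≤ 1 / (oppositePathLength Γ : ℝ≥0∞)) ∧
    -- right-angled Coxeter groups
    (∀ (V : Type*) (Γ : SimpleGraph V),
      1 / (24 + 12 * (oppositePathLength Γ : ℝ≥0∞)) ≤ optimalChainGap (RightAngledCoxeterGroup Γ) ∧
      ((oppositePathLength Γ = 1 → ∃ u v w : V, Γᶜ.Adj u v ∧ Γᶜ.Adj v w ∧ Γᶜ.Adj u w) →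
        optimalChainGap (RightAngledCoxeterGroup Γ) ≤ 1 / (oppositePathLength Γ : ℝ≥0∞))) ∧
    -- every `m ≥ 1` is the opposite path length of a finite graph, and neither gap is uniform
    (∀ m : ℕ, 1 ≤ m → oppositePathLength (oppositePath m) = m) ∧
    (¬ ∃ C : ℝ≥0∞, 0 < C ∧
      ∀ (n : ℕ) (Γ : SimpleGraph (Fin n)), HasChainGap (RightAngledArtinGroup Γ) C) ∧
    (¬ ∃ C : ℝ≥0∞, 0 < C ∧
      ∀ (n : ℕ) (Γ : SimpleGraph (Fin n)), HasChainGap (RightAngledCoxeterGroup Γ) C) := by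
  refine ⟨fun V Γ => ?_, fun V Γ => ?_, fun m hm => oppositePathLength_oppositePath hm, ?_, ?_⟩
  · have h1 := GraphGroup.le_optimalChainGap Γ ∅
    have h2 := optimalChainGap_artin_le Γ
    unfold GraphGroup at h1 h2
    rw [graphRels_empty] at h1 h2
    exact ⟨h1, h2⟩
  · have h1 := GraphGroup.le_optimalChainGap Γ Set.univ
    have h2 := optimalChainGap_coxeter_le Γ
    unfold GraphGroup at h1 h2
    rw [graphRels_univ] at h1 h2
    exact ⟨h1, h2⟩
  · have h := not_exists_uniform_gap (Q := fun _ => ∅)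
      fun m hm => GraphGroup.exists_chain_artin (by omega)
    rintro ⟨C, hC, hgap⟩
    refine h ⟨C, hC, fun n Γ => ?_⟩
    unfold GraphGroup
    rw [graphRels_empty]
    exact hgap n Γ
  · have h := not_exists_uniform_gap (Q := fun _ => Set.univ)
      fun m hm => GraphGroup.exists_chain_coxeter hm
    rintro ⟨C, hC, hgap⟩
    refine h ⟨C, hC, fun n Γ => ?_⟩
    unfold GraphGroup
    rw [graphRels_univ]
    exact hgap n Γ
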